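/- Let $\epsilon,\mu,\delta>0$, $\gamma\ge 0$, $\mathrm{Bo}^{-1}\ge 0$, and let ${\sf F}_1,{\sf F}_2:\mathbb R\to\mathbb R$ be arbitrary even measurable functions of at most polynomial growth; ${\sf F}_i^\mu={\sf F}_i(\sqrt\mu D)$ is the Fourier multiplier $\widehat{{\sf F}_i^\mu\varphi}(\xi)={\sf F}_i(\sqrt\mu\,\xi)\widehat\varphi(\xi)$. Write $H^\infty=\bigcap_N H^N(\mathbb R)$, $h_1=1-\epsilon\zeta$, $h_2=\delta^{-1}+\epsilon\zeta$, and \[ \mathcal Q_i[h]u=-\tfrac13h^{-1}\partial_x{\sf F}_i^\mu\{h^3\partial_x{\sf F}_i^\mu u\},\quad \mathcal R_i[h,u]=\tfrac12(h\,\partial_x{\sf F}_i^\mu u)^2+\tfrac13h^{-1}u\,\partial_x{\sf F}_i^\mu\{h^3\partial_x{\sf F}_i^\mu u\},\quad \mathcal A_i[h]w=h^{-1}w+\mu\mathcal Q_i[h](h^{-1}w), \] \[ \mathcal Q^{\sf F}[\epsilon\zeta]w=\mathcal Q_2[h_2](h_2^{-1}w)-\gamma\mathcal Q_1[h_1](-h_1^{-1}w),\quad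 \mathcal R^{\sf F}[\epsilon\zeta,w]=\mathcal R_2[h_2,h_2^{-1}w]-\gamma\mathcal R_1[h_1,-h_1^{-1}w],\quad \mathcal A^{\sf F}[\epsilon\zeta]=\gamma\mathcal A_1[h_1]+\mathcal A_2[h_2]. \] Throughout, $\zeta\in H^\infty$ (for each time) with $h_1,h_2>0$. Functional derivatives are taken with respect to smooth compactly supported variations, and inverses of $\mathcal A_i[h_i]$ and $\mathcal A^{\sf F}[\epsilon\zeta]$ are understood in the sense of their quadratic forms (e.g. $(\mathcal A_i[h]w,w')=\int h^{-1}ww'+\frac\mu3h^3\,\partial_x{\sf F}_i^\mu\{h^{-1}w\}\,\partial_x{\sf F}_i^\mu\{h^{-1}w'\}$) on the maximal form domain. Let $I\subset\mathbb R$ be an interval. \textbf{(1)} For every $v\in L^2(\mathbb R)$ the equation $\mathcal A^{\sf F}[\epsilon\zeta]w=v$ has exactly one solution $w=\mathcal A^{\sf F}[\epsilon\zeta]^{-1}v$ in the form domain. If $w\in H^\infty$, then $\mathcal A^{\sf F}[\epsilon\zeta]w=\frac{h_1+\gamma h_2}{h_1h_2}w+\mu\mathcal Q^{\sf F}[\epsilon\zeta]w\in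 H^\infty$ and $\mathcal A^{\sf F}[\epsilon\zeta]^{-1}\mathcal A^{\sf F}[\epsilon\zeta]w=w$. \textbf{(2)} Let \[ \mathcal H^{\sf F}(\zeta,v)=\frac12\int_{\mathbb R}(\gamma+\delta)\zeta^2+\frac{2(\gamma+\delta)}{\mu\epsilon^2\mathrm{Bo}}\Big(\sqrt{1+\mu\epsilon^2|\partial_x\zeta|^2}-1\Big)+v\,\mathcal A^{\sf F}[\epsilon\zeta]^{-1}v\ dx. \] If $w\in H^\infty$, $v=\mathcal A^{\sf F}[\epsilon\zeta]w$ and $u_i=(-1)^iw/h_i$, then the last term of the integrand may be replaced by $\gamma h_1u_1^2+h_2u_2^2+\frac{\mu\gamma}3h_1(h_1\partial_x{\sf F}_1^\mu u_1)^2+\frac\mu3h_2(h_2\partial_x{\sf F}_2^\mu u_2)^2$, and \[ \frac{\delta\mathcal H^{\sf F}}{\delta v}=w,\qquad \frac{\delta\mathcal H^{\sf F}}{\delta\zeta}=(\gamma+\delta)\zeta-\frac{\gamma+\delta}{\mathrm{Bo}}\partial_x\Big(\frac{\partial_x\zeta}{\sqrt{1+\mu\epsilon^2|\partial_x\zeta|^2}}\Big)+\frac\epsilon2\frac{h_1^2-\gamma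 h_2^2}{h_1^2h_2^2}w^2-\mu\epsilon\mathcal R^{\sf F}[\epsilon\zeta,w]. \] \textbf{(3)} Let $\zeta(t,\cdot),w(t,\cdot)\in H^\infty$ for $t\in I$. Then $(\zeta,w)$ solves the modified Green--Naghdi system \[ \partial_t\zeta+\partial_xw=0,\qquad \partial_t\Big(\tfrac{h_1+\gamma h_2}{h_1h_2}w+\mu\mathcal Q^{\sf F}[\epsilon\zeta]w\Big)+(\gamma+\delta)\partial_x\zeta+\tfrac\epsilon2\partial_x\Big(\tfrac{h_1^2-\gamma h_2^2}{(h_1h_2)^2}w^2\Big)=\mu\epsilon\,\partial_x\mathcal R^{\sf F}[\epsilon\zeta,w]+\tfrac{\gamma+\delta}{\mathrm{Bo}}\partial_x^2\Big(\tfrac{\partial_x\zeta}{\sqrt{1+\mu\epsilon^2|\partial_x\zeta|^2}}\Big) \] on $I\times\mathbb R$ if and only if $(\zeta,v)$ with $v=\mathcal A^{\sf F}[\epsilon\zeta]w$ solves \[ \partial_t\zeta=-\partial_x\Big(\frac{\delta\mathcal H^{\sf F}}{\delta v}\Big),\qquad \partial_tv=-\partial_x\Big(\frac{\delta\mathcal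 H^{\sf F}}{\delta\zeta}\Big). \] \textbf{(4)} Let $(\zeta,w)$ be a solution of this system such that $\zeta$ and $w$ are differentiable on $I$ as functions of time with values in $H^\infty$, and $v=\mathcal A^{\sf F}[\epsilon\zeta]w$. Then the energy $\mathcal H^{\sf F}(\zeta,v)$ and the horizontal impulse $\int_{\mathbb R}\zeta v\,dx$ are conserved: their time derivatives vanish on $I$. If moreover $\zeta(t,\cdot)$ is integrable for all $t\in I$, the mass $\int_{\mathbb R}\zeta\,dx$ is conserved; if $v(t,\cdot)$ is integrable for all $t\in I$, the horizontal velocity mass $\int_{\mathbb R}v\,dx=\int_{\mathbb R}\frac{h_1+\gamma h_2}{h_1h_2}w+\mu\mathcal Q^{\sf F}[\epsilon\zeta]w\,dx$ is conserved. \textbf{(5)} Suppose in addition $\gamma>0$, $\gamma\ne1$, and consider the four-equation form ($i=1,2$) \[ \partial_th_i+\epsilon\partial_x(h_iu_i)=0,\qquad \partial_tv_i+\frac{\gamma+\delta}{1-\gamma}\partial_x\zeta+\frac\epsilon2\partial_x(u_i^2)=\mu\epsilon\,\partial_x\mathcal R_i[h_i,u_i]-\frac1{\gamma^{2-i}}\partial_xP_i,\qquad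 v_i=u_i+\mu\mathcal Q_i[h_i]u_i, \] with $P_2=P_1-\frac{\gamma+\delta}{\mathrm{Bo}}\partial_x\big(\frac{\partial_x\zeta}{\sqrt{1+\mu\epsilon^2|\partial_x\zeta|^2}}\big)$, where $u_i(t,\cdot)\in H^\infty$ and $P_1(t,\cdot)$ is smooth. For $v\in L^2$ the equation $\mathcal A_i[h_i]w=v$ has exactly one solution in the form domain; for $u_i\in H^\infty$ one has $v_i=\mathcal A_i[h_i](h_iu_i)\in H^\infty$ and $\mathcal A_i[h_i]^{-1}v_i=h_iu_i$. Let \[ \mathcal H^{\sf F}(h_1,h_2,v_1,v_2)=\frac12\int_{\mathbb R}\frac1{\epsilon^2}\frac{\gamma+\delta}{1-\gamma}(h_2^2-\gamma h_1^2-C)+\frac2\epsilon(h_1+h_2-1-\delta^{-1})P_1+\frac{2(\gamma+\delta)}{\mu\epsilon^2\mathrm{Bo}}\Big(\sqrt{1+\mu|\partial_xh_2|^2}-1\Big)+\gamma v_1\mathcal A_1[h_1]^{-1}v_1+v_2\mathcal A_2[h_2]^{-1}v_2\ dx \] with $C=c_0+c_1h_1+c_2h_2$, the constants $c_j$ being such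 that $h_2^2-\gamma h_1^2-C$ is integrable (at every time considered). Then in $\mathcal H^{\sf F}$ the last two terms of the integrand may be replaced by $\gamma h_1u_1^2+h_2u_2^2+\frac{\mu\gamma}3h_1(h_1\partial_x{\sf F}_1^\mu u_1)^2+\frac\mu3h_2(h_2\partial_x{\sf F}_2^\mu u_2)^2$, and \begin{gather*} \frac{\delta\mathcal H^{\sf F}}{\delta v_1}=\gamma h_1u_1,\qquad \frac{\delta\mathcal H^{\sf F}}{\delta v_2}=h_2u_2,\\ \frac{\delta\mathcal H^{\sf F}}{\delta h_1}=\frac1{\epsilon^2}\frac{\gamma+\delta}{1-\gamma}\Big(-\gamma h_1-\frac{c_1}2\Big)+\frac{P_1}\epsilon+\frac\gamma2u_1^2-\gamma\mu\mathcal R_1[h_1,u_1],\\ \frac{\delta\mathcal H^{\sf F}}{\delta h_2}=\frac1{\epsilon^2}\frac{\gamma+\delta}{1-\gamma}\Big(h_2-\frac{c_2}2\Big)+\frac{P_1}\epsilon-\frac{\gamma+\delta}{\epsilon^2\mathrm{Bo}}\partial_x\Big(\frac{\partial_xh_2}{\sqrt{1+\mu|\partial_xh_2|^2}}\Big)+\frac12u_2^2-\mu\mathcal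 R_2[h_2,u_2]. \end{gather*} The four-equation system on $I\times\mathbb R$ is equivalent to \[ \partial_th_1=-\frac\epsilon\gamma\partial_x\frac{\delta\mathcal H^{\sf F}}{\delta v_1},\quad \partial_tv_1=-\frac\epsilon\gamma\partial_x\frac{\delta\mathcal H^{\sf F}}{\delta h_1},\quad \partial_th_2=-\epsilon\partial_x\frac{\delta\mathcal H^{\sf F}}{\delta v_2},\quad \partial_tv_2=-\epsilon\partial_x\frac{\delta\mathcal H^{\sf F}}{\delta h_2}. \] Finally, for a solution of the four-equation system such that $\zeta,u_1,u_2$ are differentiable on $I$ with values in $H^\infty$ and such that $P_1(t,x)-P_1(t,-x)\to0$ as $x\to+\infty$, locally uniformly in $t\in I$, the horizontal velocity mass $\int_{\mathbb R}v_i\,dx$ of the layer $i$ is conserved as soon as $v_i(t,\cdot)$ is integrable for all $t\in I$ ($i=1,2$). -/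

import Mathlib

open MeasureTheory Filter Topology
open scoped ContDiff FourierTransform

noncomputable section

namespace GreenNaghdi

/-! ### Function spaces -/

/-- The real space `H^∞(ℝ)`: smooth functions all of whose derivatives are square integrable. -/
def HInf (f : ℝ → ℝ) : Prop :=
  ContDiff ℝ ∞ f ∧ ∀ n : ℕ, MemLp (iteratedDeriv n f) 2 volume

/-- `t ↦ f t` takes its values in `H^∞(ℝ)` for `t ∈ I` and is differentiable on `I` for the
topology of `H^∞(ℝ)`: every space derivative of the difference quotient converges in `L²`. -/
def HInfDifferentiableOn (I : Set ℝ) (f : ℝ → ℝ → ℝ) : Prop :=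
  ∀ t ∈ I, HInf (f t) ∧ ∃ f' : ℝ → ℝ, HInf f' ∧ ∀ n : ℕ,
    Tendsto (fun s => eLpNorm (iteratedDeriv n fun x => (f s x - f t x) / (s - t) - f' x) 2 volume)
      (𝓝[I \ {t}] t) (𝓝 0)

/-- The smooth function `g` is the functional (variational, `L²`) derivative of `J` at `f`. -/
def IsVarDeriv (J : (ℝ → ℝ) → ℝ) (f g : ℝ → ℝ) : Prop :=
  ContDiff ℝ ∞ g ∧ ∀ φ : ℝ → ℝ, ContDiff ℝ ∞ φ → HasCompactSupport φ →
    HasDerivAt (fun s : ℝ => J (fun x => f x + s * φ x)) (∫ x, g x * φ x) 0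

/-! ### Fourier multipliers -/

/-- The functions `F` for which the multiplier `F(√μ D)` is considered: real-valued, even,
measurable, with at most polynomial growth. -/
structure IsMultiplierFunction (F : ℝ → ℝ) : Prop where
  measurable : Measurable F
  even : ∀ k, F (-k) = F k
  growth : ∃ (C : ℝ) (N : ℕ), ∀ k, |F k| ≤ C * (1 + |k|) ^ N

/-- `f` and `g` are square integrable and `ĝ = m f̂` almost everywhere, with the Fourier transform
of `L²(ℝ)` normalised as `f̂(ξ) = ∫ exp(-2πixξ) f(x) dx`. -/
def MultiplierRel (m : ℝ → ℂ) (f g : ℝ → ℝ) : Prop :=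
  ∃ (hf : MemLp (fun x => (f x : ℂ)) 2 (volume : Measure ℝ))
    (hg : MemLp (fun x => (g x : ℂ)) 2 (volume : Measure ℝ)),
    ((𝓕 (hg.toLp _) : Lp ℂ 2 (volume : Measure ℝ)) : ℝ → ℂ) =ᵐ[volume]
      fun ξ => m ξ * ((𝓕 (hf.toLp _) : Lp ℂ 2 (volume : Measure ℝ)) : ℝ → ℂ) ξ

/-- Symbol of `F(√μ D)`, `D = -i∂ₓ`; the wave number of the frequency `ξ` is `2πξ`. -/
def symb (F : ℝ → ℝ) (μ : ℝ) (ξ : ℝ) : ℂ :=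
  (F (√μ * (2 * Real.pi * ξ)) : ℂ)

/-- Symbol of `∂ₓ F(√μ D)`. -/
def symbD (F : ℝ → ℝ) (μ : ℝ) (ξ : ℝ) : ℂ :=
  2 * Real.pi * Complex.I * (ξ : ℂ) * symb F μ ξ

open Classical in
/-- `F(√μ D) f` as a function: the (unique) continuous function with Fourier transform
`F(√μ ·) f̂`. -/
def fmul (F : ℝ → ℝ) (μ : ℝ) (f : ℝ → ℝ) : ℝ → ℝ :=
  if h : ∃ g : ℝ → ℝ, Continuous g ∧ MultiplierRel (symb F μ) f g then h.choose else 0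

open Classical in
/-- `∂ₓ F(√μ D) f` as an element of `L²` (defined up to null sets), for `f` of low regularity. -/
def dmul (F : ℝ → ℝ) (μ : ℝ) (f : ℝ → ℝ) : ℝ → ℝ :=
  if h : ∃ g : ℝ → ℝ, MultiplierRel (symbD F μ) f g then h.choose else 0

/-! ### Operators of one layer -/

/-- `𝒬[h]u = -⅓ h⁻¹ ∂ₓF{h³ ∂ₓF u}`. -/
def layerQ (F : ℝ → ℝ) (μ : ℝ) (h u : ℝ → ℝ) : ℝ → ℝ := fun x =>
  -(1 / 3) * (h x)⁻¹ * deriv (fmul F μ fun y => h y ^ 3 * deriv (fmul F μ u) y) x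

/-- `ℛ[h,u] = ½ (h ∂ₓF u)² + ⅓ h⁻¹ u ∂ₓF{h³ ∂ₓF u}`. -/
def layerR (F : ℝ → ℝ) (μ : ℝ) (h u : ℝ → ℝ) : ℝ → ℝ := fun x =>
  1 / 2 * (h x * deriv (fmul F μ u) x) ^ 2
    + 1 / 3 * (h x)⁻¹ * u x * deriv (fmul F μ fun y => h y ^ 3 * deriv (fmul F μ u) y) x

/-- `𝒜[h]w = h⁻¹ w - (μ/3) h⁻¹ ∂ₓF{h³ ∂ₓF{h⁻¹ w}}`. -/
def layerA (F : ℝ → ℝ) (μ : ℝ) (h w : ℝ → ℝ) : ℝ → ℝ := fun x =>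
  (h x)⁻¹ * w x - μ / 3 * (h x)⁻¹ *
    deriv (fmul F μ fun y => h y ^ 3 * deriv (fmul F μ fun z => (h z)⁻¹ * w z) y) x

/-- Form domain of `𝒜[h]`: `w ∈ L²` with `∂ₓF{h⁻¹ w} ∈ L²`. -/
def LayerDom (F : ℝ → ℝ) (μ : ℝ) (h w : ℝ → ℝ) : Prop :=
  MemLp w 2 volume ∧ ∃ g, MultiplierRel (symbD F μ) (fun x => (h x)⁻¹ * w x) g

/-- The quadratic form of `𝒜[h]`, that is `(𝒜[h]w, w')` after integration by parts. -/
def layerForm (F : ℝ → ℝ) (μ : ℝ) (h w w' : ℝ → ℝ) : ℝ :=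
  ∫ x, (h x)⁻¹ * w x * w' x + μ / 3 * h x ^ 3 *
    dmul F μ (fun y => (h y)⁻¹ * w y) x * dmul F μ (fun y => (h y)⁻¹ * w' y) x

/-- `w` solves `𝒜w = v`, for the operator `𝒜` of the form `q` on the form domain `D`. -/
def IsFormSol (D : (ℝ → ℝ) → Prop) (q : (ℝ → ℝ) → (ℝ → ℝ) → ℝ) (v w : ℝ → ℝ) : Prop :=
  D w ∧ ∀ w', D w' → q w w' = ∫ x, v x * w' x

open Classical in
/-- `𝒜⁻¹v` (defined up to null sets), for the operator `𝒜` of the form `q` on `D`. -/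
def formInv (D : (ℝ → ℝ) → Prop) (q : (ℝ → ℝ) → (ℝ → ℝ) → ℝ) (v : ℝ → ℝ) : ℝ → ℝ :=
  if h : ∃ w, IsFormSol D q v w then h.choose else 0

/-- `𝒜[h]⁻¹v`. -/
def layerAInv (F : ℝ → ℝ) (μ : ℝ) (h v : ℝ → ℝ) : ℝ → ℝ :=
  formInv (LayerDom F μ h) (layerForm F μ h) v

/-! ### Parameters -/

/-- The dimensionless parameters and the two multiplier functions; `iBo` is the inverse `Bo⁻¹` of
the Bond number, so that `iBo = 0` means absence of surface tension. -/
structure Params where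
  ε : ℝ
  μ : ℝ
  δ : ℝ
  γ : ℝ
  iBo : ℝ
  F₁ : ℝ → ℝ
  F₂ : ℝ → ℝ

structure Params.Valid (p : Params) : Prop where
  ε_pos : 0 < p.ε
  μ_pos : 0 < p.μ
  δ_pos : 0 < p.δ
  γ_nonneg : 0 ≤ p.γ
  iBo_nonneg : 0 ≤ p.iBo
  F₁_mult : IsMultiplierFunction p.F₁
  F₂_mult : IsMultiplierFunction p.F₂

namespace Params

variable (p : Params)

/-- Depth of the upper layer, `h₁ = 1 - εζ`. -/
def h₁ (ζ : ℝ → ℝ) : ℝ → ℝ := fun x => 1 - p.ε * ζ x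

/-- Depth of the lower layer, `h₂ = δ⁻¹ + εζ`. -/
def h₂ (ζ : ℝ → ℝ) : ℝ → ℝ := fun x => p.δ⁻¹ + p.ε * ζ x

/-- An admissible deformation: `ζ ∈ H^∞` and both depths are positive. -/
def Adm (ζ : ℝ → ℝ) : Prop :=
  HInf ζ ∧ ∀ x, 0 < p.h₁ ζ x ∧ 0 < p.h₂ ζ x

/-- `∂ₓζ / √(1 + με²|∂ₓζ|²)`. -/
def slope (ζ : ℝ → ℝ) : ℝ → ℝ := fun x =>
  deriv ζ x / √(1 + p.μ * p.ε ^ 2 * deriv ζ x ^ 2)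

/-! ### The two-equation system -/

/-- `𝒬^F[εζ]w = 𝒬₂[h₂](h₂⁻¹w) - γ 𝒬₁[h₁](-h₁⁻¹w)`. -/
def Q (ζ w : ℝ → ℝ) : ℝ → ℝ := fun x =>
  layerQ p.F₂ p.μ (p.h₂ ζ) (fun y => (p.h₂ ζ y)⁻¹ * w y) x
    - p.γ * layerQ p.F₁ p.μ (p.h₁ ζ) (fun y => -((p.h₁ ζ y)⁻¹ * w y)) x

/-- `ℛ^F[εζ,w] = ℛ₂[h₂,h₂⁻¹w] - γ ℛ₁[h₁,-h₁⁻¹w]`. -/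
def R (ζ w : ℝ → ℝ) : ℝ → ℝ := fun x =>
  layerR p.F₂ p.μ (p.h₂ ζ) (fun y => (p.h₂ ζ y)⁻¹ * w y) x
    - p.γ * layerR p.F₁ p.μ (p.h₁ ζ) (fun y => -((p.h₁ ζ y)⁻¹ * w y)) x

/-- `(h₁ + γh₂)/(h₁h₂) w + μ 𝒬^F[εζ]w`. -/
def momentum (ζ w : ℝ → ℝ) : ℝ → ℝ := fun x =>
  (p.h₁ ζ x + p.γ * p.h₂ ζ x) / (p.h₁ ζ x * p.h₂ ζ x) * w x + p.μ * p.Q ζ w x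

/-- `(ζ,w)` satisfies the modified Green-Naghdi system, in its two-equation form, on `I × ℝ`. -/
def IsGNSol (I : Set ℝ) (ζ w : ℝ → ℝ → ℝ) : Prop :=
  ∀ t ∈ I, ∀ x,
    HasDerivWithinAt (fun s => ζ s x) (-deriv (w t) x) I t ∧
    HasDerivWithinAt (fun s => p.momentum (ζ s) (w s) x)
      (-(p.γ + p.δ) * deriv (ζ t) x
        - p.ε / 2 * deriv (fun y =>
            (p.h₁ (ζ t) y ^ 2 - p.γ * p.h₂ (ζ t) y ^ 2)
              / (p.h₁ (ζ t) y * p.h₂ (ζ t) y) ^ 2 * w t y ^ 2) x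
        + p.μ * p.ε * deriv (p.R (ζ t) (w t)) x
        + (p.γ + p.δ) * p.iBo * iteratedDeriv 2 (p.slope (ζ t)) x) I t

/-- `𝒜^F[εζ]w = γ 𝒜₁[h₁]w + 𝒜₂[h₂]w`. -/
def A (ζ w : ℝ → ℝ) : ℝ → ℝ := fun x =>
  p.γ * layerA p.F₁ p.μ (p.h₁ ζ) w x + layerA p.F₂ p.μ (p.h₂ ζ) w x

/-- Form domain of `𝒜^F[εζ]`; the upper layer is not felt when `γ = 0`. -/
def ADom (ζ w : ℝ → ℝ) : Prop :=
  (p.γ ≠ 0 → LayerDom p.F₁ p.μ (p.h₁ ζ) w) ∧ LayerDom p.F₂ p.μ (p.h₂ ζ) w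

/-- The quadratic form of `𝒜^F[εζ]`. -/
def AForm (ζ w w' : ℝ → ℝ) : ℝ :=
  p.γ * layerForm p.F₁ p.μ (p.h₁ ζ) w w' + layerForm p.F₂ p.μ (p.h₂ ζ) w w'

/-- `𝒜^F[εζ]⁻¹v`. -/
def AInv (ζ v : ℝ → ℝ) : ℝ → ℝ :=
  formInv (p.ADom ζ) (p.AForm ζ) v

/-- The Hamiltonian functional of the two-equation form, in the variables `(ζ,v)`. -/
def hamiltonian (ζ v : ℝ → ℝ) : ℝ :=
  1 / 2 * ∫ x, (p.γ + p.δ) * ζ x ^ 2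
    + 2 * (p.γ + p.δ) * p.iBo / (p.μ * p.ε ^ 2)
        * (√(1 + p.μ * p.ε ^ 2 * deriv ζ x ^ 2) - 1)
    + v x * p.AInv ζ v x

/-- The Hamiltonian system `∂ₜζ = -∂ₓ(δH/δv)`, `∂ₜv = -∂ₓ(δH/δζ)` on `I × ℝ`. -/
def IsHamSol (I : Set ℝ) (ζ v : ℝ → ℝ → ℝ) : Prop :=
  ∃ gζ gv : ℝ → ℝ → ℝ, ∀ t ∈ I,
    IsVarDeriv (fun η => p.hamiltonian η (v t)) (ζ t) (gζ t) ∧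
    IsVarDeriv (fun η => p.hamiltonian (ζ t) η) (v t) (gv t) ∧
    ∀ x, HasDerivWithinAt (fun s => ζ s x) (-deriv (gv t) x) I t ∧
      HasDerivWithinAt (fun s => v s x) (-deriv (gζ t) x) I t

/-! ### The four-equation system -/

/-- Pressure of the lower layer, `P₂ = P₁ - (γ+δ)Bo⁻¹ ∂ₓ(∂ₓζ/√(1+με²|∂ₓζ|²))`. -/
def P₂ (ζ P₁ : ℝ → ℝ) : ℝ → ℝ := fun x =>
  P₁ x - (p.γ + p.δ) * p.iBo * deriv (p.slope ζ) x

/-- Velocity variable of the upper layer, `u₁ + μ 𝒬₁[h₁]u₁`. -/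
def v₁ (ζ u₁ : ℝ → ℝ) : ℝ → ℝ := fun x => u₁ x + p.μ * layerQ p.F₁ p.μ (p.h₁ ζ) u₁ x

/-- Velocity variable of the lower layer, `u₂ + μ 𝒬₂[h₂]u₂`. -/
def v₂ (ζ u₂ : ℝ → ℝ) : ℝ → ℝ := fun x => u₂ x + p.μ * layerQ p.F₂ p.μ (p.h₂ ζ) u₂ x

/-- `(ζ,u₁,u₂,P₁)` satisfies on `I × ℝ` the conservations of mass
`∂ₜhᵢ + ε∂ₓ(hᵢuᵢ) = 0` and the momentum equations
`∂ₜ(uᵢ + μ𝒬ᵢ[hᵢ]uᵢ) + (γ+δ)/(1-γ) ∂ₓζ + (ε/2)∂ₓ(uᵢ²) = με∂ₓℛᵢ[hᵢ,uᵢ] - γ^{-(2-i)} ∂ₓPᵢ`. -/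
def IsGN4Sol (I : Set ℝ) (ζ u₁ u₂ P₁ : ℝ → ℝ → ℝ) : Prop :=
  ∀ t ∈ I, ∀ x,
    HasDerivWithinAt (fun s => p.h₁ (ζ s) x)
      (-(p.ε * deriv (fun y => p.h₁ (ζ t) y * u₁ t y) x)) I t ∧
    HasDerivWithinAt (fun s => p.h₂ (ζ s) x)
      (-(p.ε * deriv (fun y => p.h₂ (ζ t) y * u₂ t y) x)) I t ∧
    HasDerivWithinAt (fun s => p.v₁ (ζ s) (u₁ s) x)
      (-((p.γ + p.δ) / (1 - p.γ)) * deriv (ζ t) x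
        - p.ε / 2 * deriv (fun y => u₁ t y ^ 2) x
        + p.μ * p.ε * deriv (layerR p.F₁ p.μ (p.h₁ (ζ t)) (u₁ t)) x
        - p.γ⁻¹ * deriv (P₁ t) x) I t ∧
    HasDerivWithinAt (fun s => p.v₂ (ζ s) (u₂ s) x)
      (-((p.γ + p.δ) / (1 - p.γ)) * deriv (ζ t) x
        - p.ε / 2 * deriv (fun y => u₂ t y ^ 2) x
        + p.μ * p.ε * deriv (layerR p.F₂ p.μ (p.h₂ (ζ t)) (u₂ t)) x
        - deriv (p.P₂ (ζ t) (P₁ t)) x) I t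

/-- `h₂² - γh₁² - C` with `C = c₀ + c₁h₁ + c₂h₂`. -/
def pot4 (c₀ c₁ c₂ : ℝ) (h₁ h₂ : ℝ → ℝ) : ℝ → ℝ := fun x =>
  h₂ x ^ 2 - p.γ * h₁ x ^ 2 - (c₀ + c₁ * h₁ x + c₂ * h₂ x)

/-- The part of the density of the four-variable Hamiltonian that only involves the depths and the
Lagrange multiplier `P₁` of the constraint `h₁ + h₂ = 1 + δ⁻¹`. -/
def density4 (c₀ c₁ c₂ : ℝ) (P₁ h₁ h₂ : ℝ → ℝ) : ℝ → ℝ := fun x =>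
  1 / p.ε ^ 2 * ((p.γ + p.δ) / (1 - p.γ)) * p.pot4 c₀ c₁ c₂ h₁ h₂ x
    + 2 / p.ε * (h₁ x + h₂ x - (1 + p.δ⁻¹)) * P₁ x
    + 2 * (p.γ + p.δ) * p.iBo / (p.μ * p.ε ^ 2) * (√(1 + p.μ * deriv h₂ x ^ 2) - 1)

/-- The four-variable Hamiltonian in the variables `(h₁,h₂,v₁,v₂)`. -/
def hamiltonian4 (c₀ c₁ c₂ : ℝ) (P₁ h₁ h₂ v₁ v₂ : ℝ → ℝ) : ℝ :=
  1 / 2 * ∫ x, p.density4 c₀ c₁ c₂ P₁ h₁ h₂ x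
    + p.γ * v₁ x * layerAInv p.F₁ p.μ h₁ v₁ x + v₂ x * layerAInv p.F₂ p.μ h₂ v₂ x

/-- The four-variable Hamiltonian in the variables `(h₁,h₂,u₁,u₂)`. -/
def hamiltonian4u (c₀ c₁ c₂ : ℝ) (P₁ h₁ h₂ u₁ u₂ : ℝ → ℝ) : ℝ :=
  1 / 2 * ∫ x, p.density4 c₀ c₁ c₂ P₁ h₁ h₂ x
    + p.γ * h₁ x * u₁ x ^ 2 + h₂ x * u₂ x ^ 2
    + p.μ * (p.γ / 3) * h₁ x * (h₁ x * deriv (fmul p.F₁ p.μ u₁) x) ^ 2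
    + p.μ * (1 / 3) * h₂ x * (h₂ x * deriv (fmul p.F₂ p.μ u₂) x) ^ 2

/-- `g₁, g₂, k₁, k₂` are the functional derivatives of the four-variable Hamiltonian with respect to
`h₁, h₂, v₁, v₂` at `(h₁,h₂,v₁,v₂)`. -/
def IsGradient4 (c₀ c₁ c₂ : ℝ) (P₁ h₁ h₂ v₁ v₂ g₁ g₂ k₁ k₂ : ℝ → ℝ) : Prop :=
  IsVarDeriv (fun η => p.hamiltonian4 c₀ c₁ c₂ P₁ η h₂ v₁ v₂) h₁ g₁ ∧
  IsVarDeriv (fun η => p.hamiltonian4 c₀ c₁ c₂ P₁ h₁ η v₁ v₂) h₂ g₂ ∧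
  IsVarDeriv (fun η => p.hamiltonian4 c₀ c₁ c₂ P₁ h₁ h₂ η v₂) v₁ k₁ ∧
  IsVarDeriv (fun η => p.hamiltonian4 c₀ c₁ c₂ P₁ h₁ h₂ v₁ η) v₂ k₂

/-- The system `∂ₜU + εJ δH/δU = 0` on `I × ℝ` for `U = (h₁,v₁,h₂,v₂)`, where the nonzero entries of
`J` are `J₁₂ = J₂₁ = γ⁻¹∂ₓ` and `J₃₄ = J₄₃ = ∂ₓ`. -/
def IsHam4Sol (c₀ c₁ c₂ : ℝ) (I : Set ℝ) (P₁ h₁ v₁ h₂ v₂ : ℝ → ℝ → ℝ) : Prop :=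
  ∃ g₁ g₂ k₁ k₂ : ℝ → ℝ → ℝ, ∀ t ∈ I,
    p.IsGradient4 c₀ c₁ c₂ (P₁ t) (h₁ t) (h₂ t) (v₁ t) (v₂ t) (g₁ t) (g₂ t) (k₁ t) (k₂ t) ∧
    ∀ x, HasDerivWithinAt (fun s => h₁ s x) (-(p.ε * (p.γ⁻¹ * deriv (k₁ t) x))) I t ∧
      HasDerivWithinAt (fun s => v₁ s x) (-(p.ε * (p.γ⁻¹ * deriv (g₁ t) x))) I t ∧
      HasDerivWithinAt (fun s => h₂ s x) (-(p.ε * deriv (k₂ t) x)) I t ∧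
      HasDerivWithinAt (fun s => v₂ s x) (-(p.ε * deriv (g₂ t) x)) I t

end Params

end GreenNaghdi

end

noncomputable section

namespace GreenNaghdi

open scoped ENNReal

/-! ### The Fourier transform on L², handled by duality with Schwartz functions -/

section

/-! Write T = ∂ₓF(√μ D) (`opT` on smooth functions, `dmul` on rough ones). Its symbol is purely
imaginary, because F is real; hence T is antisymmetric in L² (`integral_mul_multiplierRel`). This is
the only integration by parts that the non-local operators need. It makes 𝒜[h] symmetric, with
quadratic form ∫ h⁻¹ww' + (μ/3) h³ T(h⁻¹w) T(h⁻¹w'), so that (𝒜[h](hu), hu) is twice the kinetic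
energy of a layer. Since F is even with polynomial growth, T also preserves H^∞ and real functions,
so no commutator or ellipticity estimate is ever used.

Solvability. The form need not control any derivative, but the graph of T is closed in L² × L². On
the pairs (w, T(h⁻¹w)) the form is a weighted L² inner product, and the weak solution is an
orthogonal projection (`exists_weak_solution`). Positivity of h⁻¹ gives coercivity in L², hence
uniqueness and ⟨v, 𝒜⁻¹v⟩ ≤ κ⁻¹‖v‖² (`CoerciveForm.sol_bound`).

Functional derivatives. In v the energy is quadratic, and its expansion is exact. In the depth, the
operator and its form domain both move. The inverse is not differentiated: with b_s = 𝒜_s w one has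
𝒜_s⁻¹b_s = w, so ⟨b₀, 𝒜_s⁻¹b₀⟩ = 2⟨b₀, w⟩ − ⟨b_s, w⟩ + ⟨b₀ − b_s, 𝒜_s⁻¹(b₀ − b_s)⟩, and coercivity,
uniform in s, makes the last term O(s²) (`hasDerivAt_integral_mul_formInv_param`). What remains is
the variation of 𝒜[h]w at fixed w, tested against w. By the product rule and the antisymmetry of T
it equals ∫ h'(−u² + 2μ ℛ[h,u]), where u = w/h (`integral_layerDot_mul`): this is where ℛ comes
from.

Dynamics. Smooth functional derivatives are unique, so the Hamiltonian system is the Green–Naghdi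
system rewritten with 𝒜 and the explicit gradient. Energy is conserved because ∂ₓ is antisymmetric.
The impulse is conserved because the energy is invariant under translations, in the infinitesimal
form ∫ (δH/δζ) ∂ₓζ = ∫ v ∂ₓw (`integral_grad_mul_deriv`); this is the same layer identity with ∂ₓ in
the role of the variation. The masses are integrals of densities with fluxes that balance at ±∞,
locally uniformly in time (`hasDerivWithinAt_integral_zero`).

The four-equation form uses the same one-layer lemmas with h₁ and h₂ varied independently. The rest
of its density is a quadratic polynomial in the depths plus the capillary term.

All limits are taken in a small calculus of smooth families for the seminorms ‖∂ⁿ·‖_{L^p} (`SmTo`,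
`SmDeriv`), which serves both for time derivatives and for variations. -/

open SchwartzMap in
theorem integral_schwartz_mul_fourier (f : Lp ℂ 2 (volume : Measure ℝ)) (φ : 𝓢(ℝ, ℂ)) :
    ∫ x, φ x * (𝓕 f : Lp ℂ 2 (volume : Measure ℝ)) x = ∫ x, 𝓕 (φ : ℝ → ℂ) x * f x := by
  have h := congrArg (fun T : TemperedDistribution ℝ ℂ => T φ)
    (Lp.fourier_toTemperedDistribution_eq f)
  simp only [TemperedDistribution.fourier_apply, Lp.toTemperedDistribution_apply, smul_eq_mul] at h
  rw [← h]
  rfl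

open SchwartzMap in
theorem integral_schwartz_mul_fourierInv (f : Lp ℂ 2 (volume : Measure ℝ)) (φ : 𝓢(ℝ, ℂ)) :
    ∫ x, φ x * (𝓕⁻ f : Lp ℂ 2 (volume : Measure ℝ)) x = ∫ x, 𝓕⁻ (φ : ℝ → ℂ) x * f x := by
  have h := congrArg (fun T : TemperedDistribution ℝ ℂ => T φ)
    (Lp.fourierInv_toTemperedDistribution_eq f)
  simp only [TemperedDistribution.fourierInv_apply, Lp.toTemperedDistribution_apply,
    smul_eq_mul] at h
  rw [← h, SchwartzMap.fourierInv_coe]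

/-- Real-valued test functions already separate locally integrable functions; their reality is what
allows conjugation to be moved across the pairing in `fourier_ofReal_neg_ae`. -/
theorem ae_eq_of_forall_integral_test {f g : ℝ → ℂ} (hf : LocallyIntegrable f)
    (hg : LocallyIntegrable g)
    (h : ∀ φ : SchwartzMap ℝ ℂ, HasCompactSupport φ → (∃ a : ℝ → ℝ, ∀ x, φ x = a x) →
      ∫ x, φ x * f x = ∫ x, φ x * g x) : f =ᵐ[volume] g := by
  refine ae_eq_of_integral_contDiff_smul_eq hf hg fun a ha hc => ?_
  have hc' : HasCompactSupport (fun x => (a x : ℂ)) := hc.comp_left (g := fun y : ℝ => (y : ℂ)) (by simp)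
  have ha' : ContDiff ℝ ∞ (fun x => (a x : ℂ)) := Complex.ofRealCLM.contDiff.comp ha
  simpa [Complex.real_smul] using h (hc'.toSchwartzMap ha') hc' ⟨a, fun x => rfl⟩

theorem locallyIntegrable_of_memLp_two {f : ℝ → ℂ} (hf : MemLp f 2 volume) :
    LocallyIntegrable f :=
  hf.locallyIntegrable (by norm_num)

/-- Fourier transform of a square integrable derivative. -/
theorem fourier_deriv_ae {f f' : ℝ → ℂ} (hd : ∀ x, HasDerivAt f (f' x) x)
    (hf : MemLp f 2 volume) (hf' : MemLp f' 2 volume) :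
    ((𝓕 (hf'.toLp _) : Lp ℂ 2 (volume : Measure ℝ)) : ℝ → ℂ) =ᵐ[volume]
      fun ξ => 2 * Real.pi * Complex.I * ξ *
        ((𝓕 (hf.toLp _) : Lp ℂ 2 (volume : Measure ℝ)) : ℝ → ℂ) ξ := by
  have hcont : Continuous fun ξ : ℝ => (2 * Real.pi * Complex.I * ξ : ℂ) := by fun_prop
  refine ae_eq_of_forall_integral_test (locallyIntegrable_of_memLp_two (Lp.memLp _)) ?_ ?_
  · exact (locallyIntegrable_of_memLp_two (Lp.memLp (𝓕 (hf.toLp _)))).continuous_smul hcont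
  · intro φ hφ _
    -- The factor 2πiξ is absorbed into the test function. The Fourier transform of 2πiξ φ is minus
    -- the derivative of that of φ, and this derivative passes to f by parts.
    have hc : HasCompactSupport fun x : ℝ => (2 * Real.pi * Complex.I * x : ℂ) * φ x :=
      hφ.mul_left
    have hs : ContDiff ℝ ∞ fun x : ℝ => (2 * Real.pi * Complex.I * x : ℂ) * φ x :=
      ((contDiff_const.mul Complex.ofRealCLM.contDiff)).mul (φ.smooth ⊤)
    have key := integral_schwartz_mul_fourier (hf.toLp _) (hc.toSchwartzMap hs)
    have e1 : ∫ x, φ x * (2 * Real.pi * Complex.I * x *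
        ((𝓕 (hf.toLp _) : Lp ℂ 2 (volume : Measure ℝ)) : ℝ → ℂ) x) =
        ∫ x, (hc.toSchwartzMap hs) x * (𝓕 (hf.toLp _) : Lp ℂ 2 (volume : Measure ℝ)) x := by
      refine integral_congr_ae (Eventually.of_forall fun x => ?_)
      change _ = (2 * Real.pi * Complex.I * x : ℂ) * φ x * _
      ring
    rw [e1, key, integral_schwartz_mul_fourier]
    have dF : ∀ x, HasDerivAt (𝓕 (φ : ℝ → ℂ))
        (-𝓕 ((hc.toSchwartzMap hs : SchwartzMap ℝ ℂ) : ℝ → ℂ) x) x := by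
      intro x
      have h1 : Integrable (fun x : ℝ => x • φ x) :=
        (continuous_id.smul φ.continuous).integrable_of_hasCompactSupport hφ.smul_left
      convert! Real.hasDerivAt_fourier φ.integrable h1 x using 1
      rw [Real.fourier_eq, Real.fourier_eq, ← integral_neg]
      congr 1
      ext y
      rw [← smul_neg]
      congr 1
      change -((2 * Real.pi * Complex.I * y : ℂ) * φ y) = _
      simp
    have m1 : MemLp (𝓕 (φ : ℝ → ℂ)) 2 volume := (𝓕 φ : SchwartzMap ℝ ℂ).memLp 2 volume
    have m2 : MemLp (𝓕 ((hc.toSchwartzMap hs : SchwartzMap ℝ ℂ) : ℝ → ℂ)) 2 volume :=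
      (𝓕 (hc.toSchwartzMap hs) : SchwartzMap ℝ ℂ).memLp 2 volume
    have ibp := integral_mul_deriv_eq_deriv_mul_of_integrable (u := 𝓕 (φ : ℝ → ℂ)) (v := f)
      (fun x _ => dF x) (fun x _ => hd x) (m1.integrable_mul hf')
      (m2.neg.integrable_mul hf) (m1.integrable_mul hf)
    have a1 : ∫ x, 𝓕 (φ : ℝ → ℂ) x * (hf'.toLp f' : Lp ℂ 2 (volume : Measure ℝ)) x =
        ∫ x, 𝓕 (φ : ℝ → ℂ) x * f' x := by
      refine integral_congr_ae ?_
      filter_upwards [hf'.coeFn_toLp] with x hx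
      rw [hx]
    have a2 : ∫ x, 𝓕 ((hc.toSchwartzMap hs : SchwartzMap ℝ ℂ) : ℝ → ℂ) x *
        (hf.toLp f : Lp ℂ 2 (volume : Measure ℝ)) x =
        ∫ x, 𝓕 ((hc.toSchwartzMap hs : SchwartzMap ℝ ℂ) : ℝ → ℂ) x * f x := by
      refine integral_congr_ae ?_
      filter_upwards [hf.coeFn_toLp] with x hx
      rw [hx]
    rw [a1, a2, ibp, ← integral_neg]
    simp

/-- The Fourier integral and the `L²` Fourier transform agree on `L¹ ∩ L²`. -/
theorem fourierInv_toLp_ae {G : ℝ → ℂ} (h1 : Integrable G) (h2 : MemLp G 2 volume) :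
    ((𝓕⁻ (h2.toLp _) : Lp ℂ 2 (volume : Measure ℝ)) : ℝ → ℂ) =ᵐ[volume] 𝓕⁻ G := by
  have hc : Continuous (𝓕⁻ G) := by
    rw [Real.fourierInv_eq_fourier_comp_neg]
    exact VectorFourier.fourierIntegral_continuous Real.continuous_fourierChar
      (L := innerₗ ℝ) (by exact continuous_inner) h1.comp_neg
  refine ae_eq_of_forall_integral_test (locallyIntegrable_of_memLp_two (Lp.memLp _))
    hc.locallyIntegrable fun φ hφ _ => ?_
  rw [integral_schwartz_mul_fourierInv]
  have a1 : ∫ x, 𝓕⁻ (φ : ℝ → ℂ) x * (h2.toLp G : Lp ℂ 2 (volume : Measure ℝ)) x =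
      ∫ x, 𝓕⁻ (φ : ℝ → ℂ) x * G x := by
    refine integral_congr_ae ?_
    filter_upwards [h2.coeFn_toLp] with x hx
    rw [hx]
  rw [a1]
  -- Fubini for the Fourier kernel; the inverse transform is written as the direct transform of the
  -- reflected function.
  have := VectorFourier.integral_bilin_fourierIntegral_eq_flip (ContinuousLinearMap.mul ℂ ℂ)
    (L := innerₗ ℝ) (μ := volume) (ν := volume) Real.continuous_fourierChar
    (by exact continuous_inner) φ.integrable h1.comp_neg
  simp only [ContinuousLinearMap.mul_apply', flip_innerₗ] at this
  rw [Real.fourierInv_eq_fourier_comp_neg G]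
  refine Eq.trans ?_ this
  rw [← integral_neg_eq_self]
  refine integral_congr_ae (Eventually.of_forall fun x => ?_)
  simp only [Real.fourierInv_eq_fourier_neg, neg_neg]
  rfl

/-- Hermitian symmetry of the Fourier transform of a real function. -/
theorem fourier_ofReal_neg_ae {f : ℝ → ℝ} (hf : MemLp (fun x => (f x : ℂ)) 2 volume) :
    (fun ξ => ((𝓕 (hf.toLp _) : Lp ℂ 2 (volume : Measure ℝ)) : ℝ → ℂ) (-ξ)) =ᵐ[volume]
      fun ξ => (starRingEnd ℂ) (((𝓕 (hf.toLp _) : Lp ℂ 2 (volume : Measure ℝ)) : ℝ → ℂ) ξ) := by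
  set K := (𝓕 (hf.toLp _) : Lp ℂ 2 (volume : Measure ℝ))
  have hK : MemLp K 2 volume := Lp.memLp K
  have hK' : MemLp (fun ξ => K (-ξ)) 2 volume :=
    hK.comp_measurePreserving (Measure.measurePreserving_neg volume)
  have hK'' : MemLp (fun ξ => (starRingEnd ℂ) (K ξ)) 2 volume := hK.star
  refine ae_eq_of_forall_integral_test (locallyIntegrable_of_memLp_two hK')
    (locallyIntegrable_of_memLp_two hK'') ?_
  rintro φ hφ ⟨a, ha⟩
  have hc : HasCompactSupport fun x : ℝ => φ (-x) := hφ.comp_homeomorph (Homeomorph.neg ℝ)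
  have hs : ContDiff ℝ ∞ fun x : ℝ => φ (-x) := (φ.smooth ⊤).comp contDiff_neg
  have k1 := integral_schwartz_mul_fourier (hf.toLp _) (hc.toSchwartzMap hs)
  have k2 := integral_schwartz_mul_fourier (hf.toLp _) φ
  have e1 : ∫ x, φ x * K (-x) = ∫ x, (hc.toSchwartzMap hs) x * K x := by
    rw [← integral_neg_eq_self]
    refine integral_congr_ae (Eventually.of_forall fun x => ?_)
    change φ (-x) * K (- -x) = φ (-x) * K x
    rw [neg_neg]
  -- Conjugation leaves φ unchanged, because φ is real.
  have e2 : ∫ x, φ x * (starRingEnd ℂ) (K x) = (starRingEnd ℂ) (∫ x, φ x * K x) := by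
    rw [← integral_conj]
    refine integral_congr_ae (Eventually.of_forall fun x => ?_)
    simp [ha]
  rw [e1, e2, k1, k2, ← integral_conj]
  refine integral_congr_ae ?_
  filter_upwards [hf.coeFn_toLp] with x hx
  rw [hx, map_mul, Complex.conj_ofReal]
  congr 1
  rw [Real.fourier_real_eq_integral_exp_smul, Real.fourier_real_eq_integral_exp_smul,
    ← integral_conj, ← integral_neg_eq_self]
  refine integral_congr_ae (Eventually.of_forall fun y => ?_)
  change _ • φ (- -y) = _
  simp only [smul_eq_mul, map_mul, ha, Complex.conj_ofReal, ← Complex.exp_conj, neg_neg]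
  simp

end

/-! ### Real functions in L², H^∞ on the Fourier side, symbols of polynomial growth -/

section

open Classical in
/-- The `L²` Fourier transform of a real function (zero unless the function is in `L²`). -/
def ftr (f : ℝ → ℝ) : ℝ → ℂ :=
  if hf : MemLp (fun x => (f x : ℂ)) 2 (volume : Measure ℝ) then
    ((𝓕 (hf.toLp _) : Lp ℂ 2 (volume : Measure ℝ)) : ℝ → ℂ) else 0

theorem memLp_ofReal_iff {f : ℝ → ℝ} {p : ENNReal} :
    MemLp (fun x => (f x : ℂ)) p (volume : Measure ℝ) ↔ MemLp f p volume :=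
  ⟨fun h => by simpa using h.re, fun h => h.ofReal⟩

theorem ftr_eq {f : ℝ → ℝ} (hf : MemLp (fun x => (f x : ℂ)) 2 (volume : Measure ℝ)) :
    ftr f = ((𝓕 (hf.toLp _) : Lp ℂ 2 (volume : Measure ℝ)) : ℝ → ℂ) := dif_pos hf

theorem multiplierRel_iff {m : ℝ → ℂ} {f g : ℝ → ℝ} :
    MultiplierRel m f g ↔ MemLp f 2 volume ∧ MemLp g 2 volume ∧
      ftr g =ᵐ[volume] fun ξ => m ξ * ftr f ξ := by
  constructor
  · rintro ⟨hf, hg, h⟩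
    exact ⟨memLp_ofReal_iff.1 hf, memLp_ofReal_iff.1 hg, by rwa [ftr_eq hf, ftr_eq hg]⟩
  · rintro ⟨hf, hg, h⟩
    have hf' := memLp_ofReal_iff.2 hf
    have hg' := memLp_ofReal_iff.2 hg
    exact ⟨hf', hg', by rwa [ftr_eq hf', ftr_eq hg'] at h⟩

theorem memLp_ftr (f : ℝ → ℝ) : MemLp (ftr f) 2 volume := by
  unfold ftr
  split_ifs with hf
  · exact Lp.memLp _
  · exact MemLp.zero

theorem ftr_congr {f g : ℝ → ℝ} (h : f =ᵐ[volume] g) : ftr f = ftr g := by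
  have h' : (fun x => (f x : ℂ)) =ᵐ[volume] fun x => (g x : ℂ) := by
    filter_upwards [h] with x hx
    rw [hx]
  by_cases hf : MemLp (fun x => (f x : ℂ)) 2 (volume : Measure ℝ)
  · have hg := (memLp_congr_ae h').1 hf
    rw [ftr_eq hf, ftr_eq hg, (MemLp.toLp_eq_toLp_iff hf hg).2 h']
  · have hg : ¬ MemLp (fun x => (g x : ℂ)) 2 (volume : Measure ℝ) :=
      fun hg => hf ((memLp_congr_ae h').2 hg)
    simp only [ftr, dif_neg hf, dif_neg hg]

theorem ftr_add {f g : ℝ → ℝ} (hf : MemLp f 2 volume) (hg : MemLp g 2 volume) :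
    ftr (fun x => f x + g x) =ᵐ[volume] fun ξ => ftr f ξ + ftr g ξ := by
  have hf' := memLp_ofReal_iff.2 hf
  have hg' := memLp_ofReal_iff.2 hg
  have hs := memLp_ofReal_iff.2 (hf.add hg)
  have e : hs.toLp _ = hf'.toLp _ + hg'.toLp _ := by
    rw [← MemLp.toLp_add]
    congr 1
    ext x
    simp
  rw [show (fun x => f x + g x) = f + g from rfl, ftr_eq hf', ftr_eq hg', ftr_eq hs, e,
    FourierTransform.fourier_add]
  exact Lp.coeFn_add _ _

theorem ftr_const_mul (c : ℝ) {f : ℝ → ℝ} (hf : MemLp f 2 volume) :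
    ftr (fun x => c * f x) =ᵐ[volume] fun ξ => (c : ℂ) * ftr f ξ := by
  have hf' := memLp_ofReal_iff.2 hf
  have hs := memLp_ofReal_iff.2 (hf.const_mul c)
  have e : hs.toLp _ = (c : ℂ) • hf'.toLp _ := by
    rw [← MemLp.toLp_const_smul]
    congr 1
    ext x
    simp
  rw [ftr_eq hf', ftr_eq hs, e, FourierTransform.fourier_smul]
  filter_upwards [Lp.coeFn_smul (c : ℂ) (𝓕 (hf'.toLp _) : Lp ℂ 2 (volume : Measure ℝ))] with x hx
  rw [hx]
  rfl

theorem eLpNorm_ftr {f : ℝ → ℝ} (hf : MemLp f 2 volume) :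
    eLpNorm (ftr f) 2 volume = eLpNorm f 2 volume := by
  have hf' := memLp_ofReal_iff.2 hf
  have h1 : ‖(𝓕 (hf'.toLp _) : Lp ℂ 2 (volume : Measure ℝ))‖ = ‖hf'.toLp _‖ :=
    Lp.norm_fourier_eq _
  rw [Lp.norm_def, Lp.norm_def, ENNReal.toReal_eq_toReal_iff' (Lp.eLpNorm_ne_top _)
    (Lp.eLpNorm_ne_top _), eLpNorm_congr_ae hf'.coeFn_toLp] at h1
  rw [ftr_eq hf', h1]
  exact eLpNorm_congr_norm_ae (Eventually.of_forall fun x => by simp)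

theorem ae_eq_of_ftr_ae_eq {f g : ℝ → ℝ} (hf : MemLp f 2 volume) (hg : MemLp g 2 volume)
    (h : ftr f =ᵐ[volume] ftr g) : f =ᵐ[volume] g := by
  have hf' := memLp_ofReal_iff.2 hf
  have hg' := memLp_ofReal_iff.2 hg
  rw [ftr_eq hf', ftr_eq hg'] at h
  have h1 : (𝓕 (hf'.toLp _) : Lp ℂ 2 (volume : Measure ℝ)) = 𝓕 (hg'.toLp _) := Lp.ext h
  have h2 := (Lp.fourierTransformₗᵢ ℝ ℂ).injective h1
  filter_upwards [(MemLp.toLp_eq_toLp_iff hf' hg').1 h2] with x hx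
  exact_mod_cast hx

theorem ftr_neg_ae {f : ℝ → ℝ} (hf : MemLp f 2 volume) :
    (fun ξ => ftr f (-ξ)) =ᵐ[volume] fun ξ => (starRingEnd ℂ) (ftr f ξ) := by
  rw [ftr_eq (memLp_ofReal_iff.2 hf)]
  exact fourier_ofReal_neg_ae _

theorem integral_mul_eq_ftr {f g : ℝ → ℝ} (hf : MemLp f 2 volume) (hg : MemLp g 2 volume) :
    ((∫ x, f x * g x : ℝ) : ℂ) = ∫ ξ, (starRingEnd ℂ) (ftr f ξ) * ftr g ξ := by
  have hf' := memLp_ofReal_iff.2 hf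
  have hg' := memLp_ofReal_iff.2 hg
  have h := Lp.inner_fourier_eq (hf'.toLp _) (hg'.toLp _)
  rw [L2.inner_def, L2.inner_def] at h
  rw [ftr_eq hf', ftr_eq hg', ← integral_complex_ofReal]
  simp only [RCLike.inner_apply] at h
  refine Eq.trans ?_ (h.symm.trans ?_)
  · refine integral_congr_ae ?_
    filter_upwards [hf'.coeFn_toLp, hg'.coeFn_toLp] with x hx hy
    rw [hx, hy]
    simp [mul_comm]
  · exact integral_congr_ae (Eventually.of_forall fun x => mul_comm _ _)

theorem HInf.memLp {f : ℝ → ℝ} (hf : HInf f) : MemLp f 2 volume := by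
  simpa using hf.2 0

theorem HInf.deriv {f : ℝ → ℝ} (hf : HInf f) : HInf (deriv f) := by
  refine ⟨(contDiff_infty_iff_deriv.1 hf.1).2, fun n => ?_⟩
  rw [← iteratedDeriv_succ']
  exact hf.2 _

theorem HInf.iteratedDeriv {f : ℝ → ℝ} (hf : HInf f) (n : ℕ) : HInf (iteratedDeriv n f) := by
  induction n with
  | zero => simpa using hf
  | succ n ih => rw [iteratedDeriv_succ]; exact ih.deriv

theorem ftr_deriv {f : ℝ → ℝ} (hf : HInf f) :
    ftr (deriv f) =ᵐ[volume] fun ξ => 2 * Real.pi * Complex.I * ξ * ftr f ξ := by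
  have hf' := memLp_ofReal_iff.2 hf.memLp
  have hg' := memLp_ofReal_iff.2 hf.deriv.memLp
  rw [ftr_eq hf', ftr_eq hg']
  exact fourier_deriv_ae (fun x => ((hf.1.differentiable (by simp)) x).hasDerivAt.ofReal_comp)
    hf' hg'

theorem ftr_iteratedDeriv {f : ℝ → ℝ} (hf : HInf f) (n : ℕ) :
    ftr (iteratedDeriv n f) =ᵐ[volume]
      fun ξ => (2 * Real.pi * Complex.I * ξ) ^ n * ftr f ξ := by
  induction n with
  | zero => simp
  | succ n ih =>
    rw [iteratedDeriv_succ]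
    filter_upwards [ih, ftr_deriv (hf.iteratedDeriv n)] with ξ h1 h2
    rw [h2, h1]
    ring

theorem memLp_inv_one_add_sq : MemLp (fun x : ℝ => (((1 + x ^ 2)⁻¹ : ℝ) : ℂ)) 2 volume := by
  refine memLp_ofReal_iff.2 ?_
  have hc : Continuous fun x : ℝ => (1 + x ^ 2)⁻¹ :=
    Continuous.inv₀ (by fun_prop) fun x => by positivity
  refine (memLp_two_iff_integrable_sq hc.aestronglyMeasurable).2 ?_
  refine integrable_inv_one_add_sq.mono' (hc.pow 2).aestronglyMeasurable
    (Eventually.of_forall fun x => ?_)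
  have h1 : (1 + x ^ 2)⁻¹ ≤ 1 := inv_le_one_of_one_le₀ (by nlinarith [sq_nonneg x])
  have h0 : 0 ≤ (1 + x ^ 2)⁻¹ := by positivity
  rw [Real.norm_of_nonneg (by positivity)]
  nlinarith

/-- Cauchy–Schwarz: G is the product of (1 + ξ²)⁻¹ and (1 + ξ²)G, both square integrable. -/
theorem integrable_of_memLp_moments {G : ℝ → ℂ} (h0 : MemLp G 2 volume)
    (h2 : MemLp (fun ξ : ℝ => (ξ : ℂ) ^ 2 * G ξ) 2 volume) : Integrable G := by
  refine (memLp_inv_one_add_sq.integrable_mul (h0.add h2)).congr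
    (Eventually.of_forall fun ξ => ?_)
  have : (1 + (ξ : ℂ) ^ 2) ≠ 0 := by
    have : (1 + ξ ^ 2 : ℝ) ≠ 0 := by positivity
    exact_mod_cast this
  simp only [Pi.mul_apply, Pi.add_apply]
  push_cast
  field_simp

/-- A rapidly decreasing (in the mean) hermitian function is the Fourier transform of an element
of `H^∞`. -/
theorem exists_hInf_of_moments {G : ℝ → ℂ}
    (hG : ∀ n : ℕ, MemLp (fun ξ : ℝ => (ξ : ℂ) ^ n * G ξ) 2 volume)
    (hs : (fun ξ => G (-ξ)) =ᵐ[volume] fun ξ => (starRingEnd ℂ) (G ξ)) :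
    ∃ g, HInf g ∧ ∀ n : ℕ, ftr (iteratedDeriv n g) =ᵐ[volume]
      fun ξ => (2 * Real.pi * Complex.I * ξ) ^ n * G ξ := by
  have hI : ∀ n : ℕ, Integrable (fun ξ : ℝ => (ξ : ℂ) ^ n * G ξ) := by
    intro n
    refine integrable_of_memLp_moments (hG n) ((memLp_congr_ae (Eventually.of_forall fun ξ => ?_)).1
      (hG (n + 2)))
    ring
  have hG0 : Integrable G := by simpa using hI 0
  have hP : ∀ n : ℕ, Integrable (fun ξ : ℝ => (2 * Real.pi * Complex.I * ξ) ^ n * G ξ) := by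
    intro n
    refine ((hI n).const_mul ((2 * Real.pi * Complex.I) ^ n)).congr
      (Eventually.of_forall fun ξ => ?_)
    ring
  have hP2 : ∀ n : ℕ, MemLp (fun ξ : ℝ => (2 * Real.pi * Complex.I * ξ) ^ n * G ξ) 2 volume := by
    intro n
    refine (memLp_congr_ae (Eventually.of_forall fun ξ => ?_)).1
      ((hG n).const_mul ((2 * Real.pi * Complex.I) ^ n))
    ring
  -- The classical Fourier integral is used rather than the L² transform, since it gives a genuine
  -- function whose smoothness follows from the integrable moments.
  set k : ℝ → ℂ := 𝓕⁻ G with hk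
  have hk' : k = 𝓕 fun ξ => G (-ξ) := Real.fourierInv_eq_fourier_comp_neg G
  have hmom : ∀ n : ℕ, Integrable (fun ξ : ℝ => ξ ^ n • G (-ξ)) := by
    intro n
    refine (((hI n).comp_neg).const_mul ((-1) ^ n)).congr (Eventually.of_forall fun ξ => ?_)
    simp only [Complex.real_smul, Complex.ofReal_neg, Complex.ofReal_pow]
    rw [neg_pow (ξ : ℂ), ← mul_assoc, ← mul_assoc, ← mul_pow]
    simp
  have hsm : ContDiff ℝ ∞ k := by
    rw [hk']
    refine Real.contDiff_fourier (N := ⊤) fun n _ => ?_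
    refine (hmom n).norm.congr (Eventually.of_forall fun ξ => ?_)
    simp
  have hder : ∀ n : ℕ, iteratedDeriv n k =
      𝓕⁻ fun ξ : ℝ => (2 * Real.pi * Complex.I * ξ) ^ n * G ξ := by
    intro n
    rw [hk', Real.iteratedDeriv_fourier (N := ⊤) (fun n _ => hmom n) le_top,
      Real.fourierInv_eq_fourier_comp_neg]
    congr 1
    ext ξ
    simp
  -- Hermitian symmetry of G makes its inverse transform real.
  have hreal : ∀ x, (starRingEnd ℂ) (k x) = k x := by
    intro x
    rw [hk, Real.fourierInv_eq', ← integral_conj, ← integral_neg_eq_self]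
    refine integral_congr_ae ?_
    filter_upwards [hs] with ξ h
    simp only [smul_eq_mul, map_mul, h, Complex.conj_conj, ← Complex.exp_conj]
    congr 2
    simp [Complex.conj_ofNat]
  set g : ℝ → ℝ := fun x => (k x).re with hg
  have hkg : k = fun x => (g x : ℂ) := by
    ext x
    exact (Complex.conj_eq_iff_re.1 (hreal x)).symm
  have hgs : ContDiff ℝ ∞ g := Complex.reCLM.contDiff.comp hsm
  have hdg : ∀ n x, iteratedDeriv n k x = ((iteratedDeriv n g x : ℝ) : ℂ) := by
    intro n
    induction n with
    | zero => intro x; simpa using congrFun hkg x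
    | succ n ih =>
      intro x
      rw [iteratedDeriv_succ, iteratedDeriv_succ, funext ih]
      have hd : DifferentiableAt ℝ (iteratedDeriv n g) x :=
        (hgs.differentiable_iteratedDeriv n (by exact_mod_cast ENat.natCast_lt_top n)) x
      exact hd.hasDerivAt.ofReal_comp.deriv
  -- Classical and L² inverse transforms agree on L¹ ∩ L², so every derivative of g is square
  -- integrable and its transform can be read off.
  have hae : ∀ n : ℕ, (fun x => ((iteratedDeriv n g x : ℝ) : ℂ)) =ᵐ[volume]
      ((𝓕⁻ ((hP2 n).toLp _) : Lp ℂ 2 (volume : Measure ℝ)) : ℝ → ℂ) := by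
    intro n
    refine Filter.EventuallyEq.symm ((fourierInv_toLp_ae (hP n) (hP2 n)).trans
      (Eventually.of_forall fun x => ?_))
    simp only [← hdg n x, hder n]
  have hmem : ∀ n : ℕ, MemLp (fun x => ((iteratedDeriv n g x : ℝ) : ℂ)) 2 volume :=
    fun n => (memLp_congr_ae (hae n)).2 (Lp.memLp _)
  refine ⟨g, ⟨hgs, fun n => memLp_ofReal_iff.1 (hmem n)⟩, fun n => ?_⟩
  have e : (hmem n).toLp _ = (𝓕⁻ ((hP2 n).toLp _) : Lp ℂ 2 (volume : Measure ℝ)) :=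
    Lp.ext ((hmem n).coeFn_toLp.trans (hae n))
  rw [ftr_eq (hmem n), e, FourierTransform.fourier_fourierInv_eq]
  exact (hP2 n).coeFn_toLp

/-- Measurable symbols of polynomial growth that map real functions to real functions. -/
structure IsSymbol (m : ℝ → ℂ) : Prop where
  measurable : Measurable m
  hermitian : ∀ ξ, m (-ξ) = (starRingEnd ℂ) (m ξ)
  growth : ∃ (C : ℝ) (N : ℕ), ∀ ξ, ‖m ξ‖ ≤ C * (1 + |ξ|) ^ N

/-- Growth is compared with 1 + |2πiξ|^M so that, after multiplication by the transform of f, only f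
and its derivative of order M are involved. -/
theorem IsSymbol.growth_pow {m : ℝ → ℂ} (hm : IsSymbol m) (n : ℕ) :
    ∃ (C : ℝ) (M : ℕ), 0 ≤ C ∧ ∀ ξ : ℝ, ‖(2 * Real.pi * Complex.I * ξ) ^ n * m ξ‖ ≤
      C * (1 + ‖(2 * Real.pi * Complex.I * ξ : ℂ)‖ ^ M) := by
  obtain ⟨C, N, h⟩ := hm.growth
  have hC : 0 ≤ C := by
    have := (norm_nonneg _).trans (h 0)
    simpa using this
  -- The power of 2 is the constant in (1 + a)^k ≤ 2^(k−1) (1 + a^k), with k = n + N.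
  refine ⟨C * 2 ^ (n + N - 1), n + N, by positivity, fun ξ => ?_⟩
  set a : ℝ := ‖(2 * Real.pi * Complex.I * ξ : ℂ)‖ with ha
  have ha' : a = 2 * Real.pi * |ξ| := by
    simp [ha, abs_of_pos Real.pi_pos]
  have h1 : |ξ| ≤ a := by
    rw [ha']
    nlinarith [abs_nonneg ξ, Real.pi_gt_three]
  have a0 : 0 ≤ a := norm_nonneg _
  rw [norm_mul, norm_pow, ← ha]
  calc a ^ n * ‖m ξ‖ ≤ (1 + a) ^ n * (C * (1 + a) ^ N) := by
        gcongr
        · linarith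
        · exact (h ξ).trans (by gcongr)
    _ = C * (1 + a) ^ (n + N) := by ring
    _ ≤ C * (2 ^ (n + N - 1) * (1 ^ (n + N) + a ^ (n + N))) := by
        gcongr
        exact add_pow_le zero_le_one a0 _
    _ = _ := by rw [one_pow]; ring

theorem IsSymbol.memLp_mul_ftr {m : ℝ → ℂ} (hm : IsSymbol m) {f : ℝ → ℝ} (hf : HInf f) (n : ℕ) :
    MemLp (fun ξ : ℝ => (2 * Real.pi * Complex.I * ξ) ^ n * (m ξ * ftr f ξ)) 2 volume := by
  obtain ⟨C, M, hC, h⟩ := hm.growth_pow n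
  have h1 := (memLp_ftr f).norm.add (memLp_ftr (iteratedDeriv M f)).norm
  have hmeas : AEStronglyMeasurable
      (fun ξ : ℝ => (2 * Real.pi * Complex.I * ξ) ^ n * (m ξ * ftr f ξ)) volume :=
    ((by fun_prop : Continuous fun ξ : ℝ => (2 * Real.pi * Complex.I * ξ : ℂ) ^ n)
      ).aestronglyMeasurable.mul
      (hm.measurable.aestronglyMeasurable.mul (memLp_ftr f).1)
  refine (h1.const_mul C).mono hmeas ?_
  filter_upwards [ftr_iteratedDeriv hf M] with ξ hξ
  simp only [Pi.add_apply]
  rw [hξ, ← mul_assoc, norm_mul, norm_mul (_ ^ M), norm_pow (_ : ℂ) M]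
  refine (mul_le_mul_of_nonneg_right (h ξ) (norm_nonneg _)).trans (le_of_eq ?_)
  rw [Real.norm_of_nonneg (by positivity)]
  ring

/-- Fourier multipliers with symbols of polynomial growth act on `H^∞`. -/
theorem IsSymbol.exists_hInf {m : ℝ → ℂ} (hm : IsSymbol m) {f : ℝ → ℝ} (hf : HInf f) :
    ∃ g, HInf g ∧ ∀ n : ℕ, ftr (iteratedDeriv n g) =ᵐ[volume]
      fun ξ => (2 * Real.pi * Complex.I * ξ) ^ n * (m ξ * ftr f ξ) := by
  refine exists_hInf_of_moments (fun n => ?_) ?_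
  · refine (memLp_congr_ae (Eventually.of_forall fun ξ => ?_)).1
      ((hm.memLp_mul_ftr hf n).const_mul (((2 * Real.pi * Complex.I) ^ n)⁻¹))
    have : (2 * Real.pi * Complex.I : ℂ) ^ n ≠ 0 := by
      refine pow_ne_zero _ ?_
      simp [Real.pi_ne_zero]
    rw [mul_pow _ (ξ : ℂ), ← mul_assoc, ← mul_assoc, ← mul_assoc, inv_mul_cancel₀ this, one_mul, mul_assoc]
  · filter_upwards [ftr_neg_ae hf.memLp] with ξ h
    rw [h, hm.hermitian, map_mul]

/-- Plancherel turns the pointwise bound on the symbol into continuity of the multiplier for the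
seminorms of H^∞, with constants that do not depend on f. -/
theorem IsSymbol.exists_bound {m : ℝ → ℂ} (hm : IsSymbol m) (n : ℕ) :
    ∃ (C : NNReal) (M : ℕ), ∀ f g : ℝ → ℝ, HInf f → HInf g →
      ftr g =ᵐ[volume] (fun ξ => m ξ * ftr f ξ) →
      eLpNorm (iteratedDeriv n g) 2 volume ≤
        C * (eLpNorm f 2 volume + eLpNorm (iteratedDeriv M f) 2 volume) := by
  obtain ⟨C, M, hC, h⟩ := hm.growth_pow n
  refine ⟨C.toNNReal, M, fun f g hf hg hfg => ?_⟩
  have hm1 := (memLp_ftr f).norm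
  have hm2 := (memLp_ftr (iteratedDeriv M f)).norm
  rw [← eLpNorm_ftr (hg.2 n), ← eLpNorm_ftr hf.memLp, ← eLpNorm_ftr (hf.2 M),
    ← eLpNorm_norm (ftr f), ← eLpNorm_norm (ftr (iteratedDeriv M f))]
  refine le_trans ?_ (mul_le_mul_right (eLpNorm_add_le hm1.1 hm2.1 (by norm_num)) _)
  refine eLpNorm_le_nnreal_smul_eLpNorm_of_ae_le_mul ?_ 2
  filter_upwards [ftr_iteratedDeriv hf M, ftr_iteratedDeriv hg n, hfg] with ξ h1 h2 h3
  rw [← NNReal.coe_le_coe]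
  simp only [Pi.add_apply, coe_nnnorm, NNReal.coe_mul, Real.coe_toNNReal _ hC]
  rw [h2, h3, h1, ← mul_assoc, norm_mul, norm_mul (_ ^ M), norm_pow (_ : ℂ) M]
  refine (mul_le_mul_of_nonneg_right (h ξ) (norm_nonneg _)).trans (le_of_eq ?_)
  rw [Real.norm_of_nonneg (by positivity)]
  ring

end

/-! ### The multipliers F(√μ D) and ∂ₓF(√μ D) -/

section

theorem IsMultiplierFunction.isSymbol_symb {F : ℝ → ℝ} (hF : IsMultiplierFunction F) (μ : ℝ) :
    IsSymbol (symb F μ) := by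
  refine ⟨?_, fun ξ => ?_, ?_⟩
  · exact Complex.measurable_ofReal.comp (hF.measurable.comp (by fun_prop))
  · simp only [symb, Complex.conj_ofReal]
    rw [← hF.even]
    congr 2
    ring
  · obtain ⟨C, N, h⟩ := hF.growth
    have hC : 0 ≤ C := by simpa using (abs_nonneg _).trans (h 0)
    set a : ℝ := |√μ * (2 * Real.pi)| with ha
    have ha0 : 0 ≤ a := abs_nonneg _
    refine ⟨C * (1 + a) ^ N, N, fun ξ => ?_⟩
    have e : |√μ * (2 * Real.pi * ξ)| = a * |ξ| := by
      rw [ha, ← abs_mul]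
      ring_nf
    have h1 : 1 + |√μ * (2 * Real.pi * ξ)| ≤ (1 + a) * (1 + |ξ|) := by
      rw [e]
      nlinarith [abs_nonneg ξ]
    simp only [symb, Complex.norm_real, Real.norm_eq_abs]
    refine (h _).trans ?_
    rw [mul_assoc C, ← mul_pow]
    gcongr

theorem IsMultiplierFunction.isSymbol_symbD {F : ℝ → ℝ} (hF : IsMultiplierFunction F) (μ : ℝ) :
    IsSymbol (symbD F μ) := by
  have h := hF.isSymbol_symb μ
  refine ⟨?_, fun ξ => ?_, ?_⟩
  · exact ((by fun_prop : Continuous fun ξ : ℝ => 2 * Real.pi * Complex.I * (ξ : ℂ))).measurable.mul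
      h.measurable
  · simp only [symbD, h.hermitian ξ, map_mul, Complex.conj_ofReal, Complex.conj_I,
      Complex.conj_ofNat]
    push_cast
    ring
  · obtain ⟨C, N, h1⟩ := h.growth
    have hC : 0 ≤ C := by simpa using (norm_nonneg _).trans (h1 0)
    refine ⟨2 * Real.pi * C, N + 1, fun ξ => ?_⟩
    have e : ‖symbD F μ ξ‖ = 2 * Real.pi * |ξ| * ‖symb F μ ξ‖ := by
      simp [symbD, abs_of_pos Real.pi_pos]
    rw [e]
    calc 2 * Real.pi * |ξ| * ‖symb F μ ξ‖
        ≤ 2 * Real.pi * (1 + |ξ|) * (C * (1 + |ξ|) ^ N) := by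
          gcongr
          · linarith
          · exact h1 ξ
      _ = _ := by ring

theorem MultiplierRel.ae_unique {m : ℝ → ℂ} {f g g' : ℝ → ℝ} (h : MultiplierRel m f g)
    (h' : MultiplierRel m f g') : g =ᵐ[volume] g' := by
  rw [multiplierRel_iff] at h h'
  exact ae_eq_of_ftr_ae_eq h.2.1 h'.2.1 (h.2.2.trans h'.2.2.symm)

theorem MultiplierRel.congr {m : ℝ → ℂ} {f f' g g' : ℝ → ℝ} (h : MultiplierRel m f g)
    (hf : f =ᵐ[volume] f') (hg : g =ᵐ[volume] g') : MultiplierRel m f' g' := by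
  rw [multiplierRel_iff] at h ⊢
  exact ⟨(memLp_congr_ae hf).1 h.1, (memLp_congr_ae hg).1 h.2.1,
    by rw [← ftr_congr hf, ← ftr_congr hg]; exact h.2.2⟩

theorem MultiplierRel.add {m : ℝ → ℂ} {f f' g g' : ℝ → ℝ} (h : MultiplierRel m f g)
    (h' : MultiplierRel m f' g') :
    MultiplierRel m (fun x => f x + f' x) (fun x => g x + g' x) := by
  rw [multiplierRel_iff] at h h' ⊢
  refine ⟨h.1.add h'.1, h.2.1.add h'.2.1, ?_⟩
  filter_upwards [h.2.2, h'.2.2, ftr_add h.1 h'.1, ftr_add h.2.1 h'.2.1] with ξ h1 h2 h3 h4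
  rw [h3, h4, h1, h2, mul_add]

theorem MultiplierRel.const_mul {m : ℝ → ℂ} {f g : ℝ → ℝ} (c : ℝ) (h : MultiplierRel m f g) :
    MultiplierRel m (fun x => c * f x) (fun x => c * g x) := by
  rw [multiplierRel_iff] at h ⊢
  refine ⟨h.1.const_mul c, h.2.1.const_mul c, ?_⟩
  filter_upwards [h.2.2, ftr_const_mul c h.1, ftr_const_mul c h.2.1] with ξ h1 h2 h3
  rw [h2, h3, h1]
  ring

theorem MultiplierRel.deriv {m : ℝ → ℂ} {f g : ℝ → ℝ} (h : MultiplierRel m f g) (hf : HInf f)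
    (hg : HInf g) : MultiplierRel m (deriv f) (deriv g) := by
  rw [multiplierRel_iff] at h ⊢
  refine ⟨hf.deriv.memLp, hg.deriv.memLp, ?_⟩
  filter_upwards [h.2.2, ftr_deriv hf, ftr_deriv hg] with ξ h1 h2 h3
  rw [h2, h3, h1]
  ring

/-- By Plancherel this says that the symbol of ∂ₓF(√μ D) is purely imaginary. Only membership of
both pairs in the graph is needed, so that rough functions of a form domain are allowed. -/
theorem integral_mul_multiplierRel {F : ℝ → ℝ} {μ : ℝ} {f g a b : ℝ → ℝ}
    (h : MultiplierRel (symbD F μ) f a) (h' : MultiplierRel (symbD F μ) g b) :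
    ∫ x, a x * g x = -∫ x, f x * b x := by
  rw [multiplierRel_iff] at h h'
  have e1 := integral_mul_eq_ftr h.2.1 h'.1
  have e2 := integral_mul_eq_ftr h.1 h'.2.1
  have : ((∫ x, a x * g x : ℝ) : ℂ) = ((-∫ x, f x * b x : ℝ) : ℂ) := by
    rw [Complex.ofReal_neg, e1, e2, ← integral_neg]
    refine integral_congr_ae ?_
    filter_upwards [h.2.2, h'.2.2] with ξ h1 h2
    rw [h1, h2]
    simp only [symbD, symb, map_mul, Complex.conj_ofReal, Complex.conj_I, Complex.conj_ofNat]
    ring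
  exact_mod_cast this

/-- `∂ₓF(√μ D) f` for smooth `f`. -/
def opT (F : ℝ → ℝ) (μ : ℝ) (f : ℝ → ℝ) : ℝ → ℝ := deriv (fmul F μ f)

section Smooth

variable {F : ℝ → ℝ} (μ : ℝ)

/-- The choice in the definition of `fmul` is harmless: two continuous functions with the same L²
transform coincide everywhere. -/
theorem exists_fmul (hF : IsMultiplierFunction F) {f : ℝ → ℝ} (hf : HInf f) :
    HInf (fmul F μ f) ∧ MultiplierRel (symb F μ) f (fmul F μ f) := by
  obtain ⟨g, hg, h⟩ := (hF.isSymbol_symb μ).exists_hInf hf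
  have hr : MultiplierRel (symb F μ) f g := by
    rw [multiplierRel_iff]
    exact ⟨hf.memLp, hg.memLp, by simpa using h 0⟩
  have hex : ∃ g : ℝ → ℝ, Continuous g ∧ MultiplierRel (symb F μ) f g := ⟨g, hg.1.continuous, hr⟩
  have e : fmul F μ f = hex.choose := dif_pos hex
  have hs := hex.choose_spec
  rw [← e] at hs
  have : fmul F μ f = g := hs.1.ae_eq_iff_eq (μ := volume) hg.1.continuous |>.1 (hs.2.ae_unique hr)
  rw [this]
  exact ⟨hg, hr⟩

theorem hInf_fmul (hF : IsMultiplierFunction F) {f : ℝ → ℝ} (hf : HInf f) : HInf (fmul F μ f) := (exists_fmul μ hF hf).1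

theorem hInf_opT (hF : IsMultiplierFunction F) {f : ℝ → ℝ} (hf : HInf f) : HInf (opT F μ f) := (hInf_fmul μ hF hf).deriv

theorem multiplierRel_opT (hF : IsMultiplierFunction F) {f : ℝ → ℝ} (hf : HInf f) :
    MultiplierRel (symbD F μ) f (opT F μ f) := by
  have h := (exists_fmul μ hF hf).2
  have h' := hInf_fmul μ hF hf
  rw [multiplierRel_iff] at h ⊢
  refine ⟨h.1, h'.deriv.memLp, ?_⟩
  filter_upwards [h.2.2, ftr_deriv h'] with ξ h1 h2
  rw [opT, h2, h1, symbD]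
  ring

/-- Linearity and commutation with ∂ₓ are all proved through this characterisation: it is enough to
exhibit a continuous candidate with the right transform. -/
theorem opT_eq_of_rel (hF : IsMultiplierFunction F) {f g : ℝ → ℝ} (hf : HInf f) (hg : Continuous g)
    (h : MultiplierRel (symbD F μ) f g) : opT F μ f = g :=
  ((hInf_opT μ hF hf).1.continuous.ae_eq_iff_eq (μ := volume) hg).1
    ((multiplierRel_opT μ hF hf).ae_unique h)

theorem opT_add (hF : IsMultiplierFunction F) {f g : ℝ → ℝ} (hf : HInf f) (hg : HInf g) (hfg : HInf fun x => f x + g x) :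
    opT F μ (fun x => f x + g x) = fun x => opT F μ f x + opT F μ g x :=
  opT_eq_of_rel μ hF hfg ((hInf_opT μ hF hf).1.continuous.add (hInf_opT μ hF hg).1.continuous)
    ((multiplierRel_opT μ hF hf).add (multiplierRel_opT μ hF hg))

theorem opT_const_mul (hF : IsMultiplierFunction F) (c : ℝ) {f : ℝ → ℝ} (hf : HInf f) (hcf : HInf fun x => c * f x) :
    opT F μ (fun x => c * f x) = fun x => c * opT F μ f x :=
  opT_eq_of_rel μ hF hcf (continuous_const.mul (hInf_opT μ hF hf).1.continuous)
    ((multiplierRel_opT μ hF hf).const_mul c)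

theorem opT_deriv (hF : IsMultiplierFunction F) {f : ℝ → ℝ} (hf : HInf f) : opT F μ (deriv f) = deriv (opT F μ f) :=
  opT_eq_of_rel μ hF hf.deriv (hInf_opT μ hF hf).deriv.1.continuous
    ((multiplierRel_opT μ hF hf).deriv hf (hInf_opT μ hF hf))

theorem integral_opT_mul (hF : IsMultiplierFunction F) {f g : ℝ → ℝ} (hf : HInf f) (hg : HInf g) :
    ∫ x, opT F μ f x * g x = -∫ x, f x * opT F μ g x :=
  integral_mul_multiplierRel (multiplierRel_opT μ hF hf) (multiplierRel_opT μ hF hg)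

theorem opT_bound (hF : IsMultiplierFunction F) (n : ℕ) : ∃ (C : NNReal) (M : ℕ), ∀ f, HInf f →
    eLpNorm (iteratedDeriv n (opT F μ f)) 2 volume ≤
      C * (eLpNorm f 2 volume + eLpNorm (iteratedDeriv M f) 2 volume) := by
  obtain ⟨C, M, h⟩ := (hF.isSymbol_symbD μ).exists_bound n
  exact ⟨C, M, fun f hf => h f _ hf (hInf_opT μ hF hf)
    (multiplierRel_iff.1 (multiplierRel_opT μ hF hf)).2.2⟩

theorem multiplierRel_dmul {f : ℝ → ℝ} (h : ∃ g, MultiplierRel (symbD F μ) f g) :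
    MultiplierRel (symbD F μ) f (dmul F μ f) := by
  have e : dmul F μ f = h.choose := dif_pos h
  rw [e]
  exact h.choose_spec

end Smooth

end

/-! ### Smooth functions with all derivatives in L^p, and families of them -/

section

/-- Smooth functions all of whose derivatives are in `L^p`. -/
def Sm (p : ℝ≥0∞) (f : ℝ → ℝ) : Prop :=
  ContDiff ℝ ∞ f ∧ ∀ n : ℕ, MemLp (iteratedDeriv n f) p volume

variable {p q r : ℝ≥0∞}

theorem contDiffAt_of_smooth {f : ℝ → ℝ} (hf : ContDiff ℝ ∞ f) (n : ℕ) (x : ℝ) :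
    ContDiffAt ℝ n f x := (hf.of_le (by exact_mod_cast le_top)).contDiffAt

theorem iteratedDeriv_smooth_add {f g : ℝ → ℝ} (hf : ContDiff ℝ ∞ f) (hg : ContDiff ℝ ∞ g)
    (n : ℕ) : iteratedDeriv n (fun x => f x + g x) =
      fun x => iteratedDeriv n f x + iteratedDeriv n g x := by
  ext x
  exact iteratedDeriv_fun_add (contDiffAt_of_smooth hf n x) (contDiffAt_of_smooth hg n x)

theorem iteratedDeriv_smooth_const_mul (c : ℝ) {f : ℝ → ℝ} (hf : ContDiff ℝ ∞ f)
    (n : ℕ) : iteratedDeriv n (fun x => c * f x) = fun x => c * iteratedDeriv n f x := by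
  ext x
  exact iteratedDeriv_const_mul c (contDiffAt_of_smooth hf n x)

theorem aestronglyMeasurable_iteratedDeriv {f : ℝ → ℝ} (hf : ContDiff ℝ ∞ f) (n : ℕ) :
    AEStronglyMeasurable (iteratedDeriv n f) volume :=
  (hf.continuous_iteratedDeriv n (by exact_mod_cast le_top)).aestronglyMeasurable

theorem eLpNorm_iteratedDeriv_mul_le [ENNReal.HolderTriple p q r] [hr : Fact (1 ≤ r)]
    {f g : ℝ → ℝ} (hf : ContDiff ℝ ∞ f) (hg : ContDiff ℝ ∞ g) (n : ℕ) :
    eLpNorm (iteratedDeriv n fun x => f x * g x) r volume ≤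
      ∑ i ∈ Finset.range (n + 1), (n.choose i : ℝ≥0∞) *
        (eLpNorm (iteratedDeriv i f) p volume * eLpNorm (iteratedDeriv (n - i) g) q volume) := by
  have e : (iteratedDeriv n fun x => f x * g x) = ∑ i ∈ Finset.range (n + 1),
      ((n.choose i : ℝ) • (iteratedDeriv i f • iteratedDeriv (n - i) g)) := by
    ext x
    rw [iteratedDeriv_fun_mul (contDiffAt_of_smooth hf n x) (contDiffAt_of_smooth hg n x),
      Finset.sum_apply]
    exact Finset.sum_congr rfl fun i _ => by simp [mul_assoc]
  have hm : ∀ i, AEStronglyMeasurable (iteratedDeriv i f • iteratedDeriv (n - i) g) volume :=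
    fun i => (aestronglyMeasurable_iteratedDeriv hf i).smul
      (aestronglyMeasurable_iteratedDeriv hg _)
  rw [e]
  refine (eLpNorm_sum_le (fun i _ => (hm i).const_smul _) hr.out).trans
    (Finset.sum_le_sum fun i _ => ?_)
  rw [eLpNorm_const_smul]
  gcongr
  · simp
  · exact eLpNorm_smul_le_mul_eLpNorm (aestronglyMeasurable_iteratedDeriv hg _)
      (aestronglyMeasurable_iteratedDeriv hf _)

theorem Sm.add {f g : ℝ → ℝ} (hf : Sm p f) (hg : Sm p g) : Sm p fun x => f x + g x :=
  ⟨hf.1.add hg.1, fun n => by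
    rw [iteratedDeriv_smooth_add hf.1 hg.1]; exact (hf.2 n).add (hg.2 n)⟩

theorem Sm.const_mul (c : ℝ) {f : ℝ → ℝ} (hf : Sm p f) : Sm p fun x => c * f x :=
  ⟨contDiff_const.mul hf.1, fun n => by
    rw [iteratedDeriv_smooth_const_mul c hf.1]; exact (hf.2 n).const_mul c⟩

theorem Sm.neg {f : ℝ → ℝ} (hf : Sm p f) : Sm p fun x => -f x := by
  simpa using hf.const_mul (-1)

theorem Sm.sub {f g : ℝ → ℝ} (hf : Sm p f) (hg : Sm p g) : Sm p fun x => f x - g x := by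
  simpa [sub_eq_add_neg] using hf.add hg.neg

theorem Sm.mul [ENNReal.HolderTriple p q r] [hr : Fact (1 ≤ r)] {f g : ℝ → ℝ} (hf : Sm p f)
    (hg : Sm q g) : Sm r fun x => f x * g x := by
  refine ⟨hf.1.mul hg.1, fun n => ⟨aestronglyMeasurable_iteratedDeriv (hf.1.mul hg.1) n, ?_⟩⟩
  refine (eLpNorm_iteratedDeriv_mul_le (p := p) (q := q) hf.1 hg.1 n).trans_lt ?_
  refine ENNReal.sum_lt_top.2 fun i _ => ENNReal.mul_lt_top (by simp) ?_
  exact ENNReal.mul_lt_top (hf.2 i).eLpNorm_lt_top (hg.2 _).eLpNorm_lt_top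

theorem Sm.deriv {f : ℝ → ℝ} (hf : Sm p f) : Sm p (deriv f) := by
  refine ⟨(contDiff_infty_iff_deriv.1 hf.1).2, fun n => ?_⟩
  rw [← iteratedDeriv_succ']
  exact hf.2 _

theorem Sm.memLp {f : ℝ → ℝ} (hf : Sm p f) : MemLp f p volume := by
  simpa using hf.2 0

theorem Sm.zero : Sm p fun _ => 0 :=
  ⟨contDiff_const, fun n => by
    have : iteratedDeriv n (fun _ : ℝ => (0 : ℝ)) = fun _ => 0 := by
      ext x; simp
    rw [this]; exact MemLp.zero⟩

theorem Sm.const (c : ℝ) : Sm ∞ fun _ => c :=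
  ⟨contDiff_const, fun n => by
    have : iteratedDeriv n (fun _ : ℝ => c) = fun _ => if n = 0 then c else 0 := by
      ext x; simp [iteratedDeriv_const]
    rw [this]; exact memLp_top_const _⟩

theorem Sm.of_hasCompactSupport {f : ℝ → ℝ} (hf : ContDiff ℝ ∞ f) (hc : HasCompactSupport f) :
    Sm p f := by
  refine ⟨hf, fun n => ?_⟩
  have h : HasCompactSupport (iteratedDeriv n f) := by
    induction n with
    | zero => simpa using hc
    | succ n ih => rw [iteratedDeriv_succ]; exact ih.deriv
  exact (hf.continuous_iteratedDeriv n (by exact_mod_cast le_top)).memLp_of_hasCompactSupport h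

/-- For a smooth function the essential supremum controls every value. -/
theorem enorm_le_eLpNorm_top {f : ℝ → ℝ} (hf : Continuous f) (x : ℝ) :
    ‖f x‖ₑ ≤ eLpNorm f ∞ volume := by
  have h : ∀ᵐ y ∂(volume : Measure ℝ), ‖f y‖ₑ ≤ eLpNorm f ∞ volume := by
    rw [eLpNorm_exponent_top]
    exact ae_le_eLpNormEssSup
  -- A conull set is dense, and by continuity of f this set is closed.
  have hd : Dense {y | ‖f y‖ₑ ≤ eLpNorm f ∞ volume} := Measure.dense_of_ae h
  have hcl : IsClosed {y | ‖f y‖ₑ ≤ eLpNorm f ∞ volume} :=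
    isClosed_le hf.enorm continuous_const
  have := hcl.closure_eq ▸ hd.closure_eq
  exact (this ▸ Set.mem_univ x : x ∈ {y | ‖f y‖ₑ ≤ eLpNorm f ∞ volume})

theorem toReal_eLpNorm_two_sq {f : ℝ → ℝ} (hf : MemLp f 2 volume) :
    (eLpNorm f 2 volume).toReal ^ 2 = ∫ x, f x ^ 2 := by
  have h1 : ‖hf.toLp f‖ = (eLpNorm f 2 volume).toReal := Lp.norm_toLp f hf
  rw [← h1, ← real_inner_self_eq_norm_sq, L2.inner_def]
  refine integral_congr_ae ?_
  filter_upwards [hf.coeFn_toLp] with x hx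
  rw [hx]
  simp [sq]

/-- Since f² vanishes at −∞, f(x)² is the integral of 2ff' up to x, hence at most ‖f‖² + ‖f'‖² ≤
(‖f‖ + ‖f'‖)². -/
theorem eLpNorm_top_le_of_two {f : ℝ → ℝ} (hf : Sm 2 f) :
    eLpNorm f ∞ volume ≤ eLpNorm f 2 volume + eLpNorm (_root_.deriv f) 2 volume := by
  have hd : ∀ x, HasDerivAt f (_root_.deriv f x) x := fun x =>
    ((hf.1.differentiable (by simp)) x).hasDerivAt
  have m0 := hf.memLp
  have m1 := hf.deriv.memLp
  set a := (eLpNorm f 2 volume).toReal with ha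
  set b := (eLpNorm (_root_.deriv f) 2 volume).toReal with hb
  have key : ∀ x, |f x| ≤ a + b := by
    intro x
    have hi : Integrable fun y => f y ^ 2 := m0.integrable_sq
    have hi' : Integrable fun y => _root_.deriv f y ^ 2 := m1.integrable_sq
    have hp : Integrable fun y => 2 * (f y * _root_.deriv f y) :=
      (m0.integrable_mul m1).const_mul 2
    have hD : ∀ y, HasDerivAt (fun y => f y ^ 2) (2 * (f y * _root_.deriv f y)) y := by
      intro y
      convert! (hd y).pow 2 using 1
      simp; ring
    have h0 : Tendsto (fun y => f y ^ 2) atBot (𝓝 0) :=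
      tendsto_zero_of_hasDerivAt_of_integrableOn_Iic (a := x) (fun y _ => hD y)
        hp.integrableOn hi.integrableOn
    have h1 := integral_Iic_of_hasDerivAt_of_tendsto' (a := x) (fun y _ => hD y)
      hp.integrableOn h0
    have h2 : ∫ y in Set.Iic x, 2 * (f y * _root_.deriv f y) ≤
        ∫ y, (f y ^ 2 + _root_.deriv f y ^ 2) := by
      refine (setIntegral_mono hp.integrableOn (hi.add hi').integrableOn fun y => ?_).trans
        (setIntegral_le_integral (hi.add hi') (Eventually.of_forall fun y => ?_))
      · simp only [Pi.add_apply]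
        nlinarith [sq_nonneg (f y - _root_.deriv f y)]
      · simp only [Pi.zero_apply, Pi.add_apply]
        positivity
    rw [integral_add hi hi', ← toReal_eLpNorm_two_sq m0, ← toReal_eLpNorm_two_sq m1] at h2
    refine abs_le_of_sq_le_sq ?_ (by positivity)
    have : 0 ≤ a * b := by positivity
    nlinarith
  have : eLpNorm f ∞ volume ≤ ENNReal.ofReal (a + b) := by
    rw [eLpNorm_exponent_top]
    refine eLpNormEssSup_le_of_ae_bound (Eventually.of_forall fun x => ?_)
    exact key x
  rwa [ENNReal.ofReal_add (by positivity) (by positivity), ha, hb,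
    ENNReal.ofReal_toReal m0.eLpNorm_ne_top, ENNReal.ofReal_toReal m1.eLpNorm_ne_top] at this

theorem Sm.iteratedDeriv {f : ℝ → ℝ} (hf : Sm p f) (n : ℕ) : Sm p (iteratedDeriv n f) := by
  induction n with
  | zero => simpa using hf
  | succ n ih => rw [iteratedDeriv_succ]; exact ih.deriv

theorem eLpNorm_iteratedDeriv_top_le_of_two {f : ℝ → ℝ} (hf : Sm 2 f) (n : ℕ) :
    eLpNorm (iteratedDeriv n f) ∞ volume ≤
      eLpNorm (iteratedDeriv n f) 2 volume + eLpNorm (iteratedDeriv (n + 1) f) 2 volume := by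
  rw [iteratedDeriv_succ]
  exact eLpNorm_top_le_of_two (hf.iteratedDeriv n)

theorem Sm.top {f : ℝ → ℝ} (hf : Sm 2 f) : Sm ∞ f :=
  ⟨hf.1, fun n => ⟨aestronglyMeasurable_iteratedDeriv hf.1 n,
    (eLpNorm_iteratedDeriv_top_le_of_two hf n).trans_lt
      (ENNReal.add_lt_top.2 ⟨(hf.2 n).eLpNorm_lt_top, (hf.2 _).eLpNorm_lt_top⟩)⟩⟩

/-! ### Families of smooth functions -/

variable {ι : Type*} {l : Filter ι}

/-- Families bounded, along a filter, for all seminorms `‖∂ⁿ·‖_{L^p}`. -/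
def Bdd (p : ℝ≥0∞) (l : Filter ι) (f : ι → ℝ → ℝ) : Prop :=
  (∀ᶠ s in l, Sm p (f s)) ∧
    ∀ n : ℕ, ∃ C : NNReal, ∀ᶠ s in l, eLpNorm (iteratedDeriv n (f s)) p volume ≤ C

/-- Families converging to zero, along a filter, for all seminorms `‖∂ⁿ·‖_{L^p}`. -/
def Null (p : ℝ≥0∞) (l : Filter ι) (f : ι → ℝ → ℝ) : Prop :=
  (∀ᶠ s in l, Sm p (f s)) ∧
    ∀ n : ℕ, Tendsto (fun s => eLpNorm (iteratedDeriv n (f s)) p volume) l (𝓝 0)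

/-- Convergence for all seminorms `‖∂ⁿ·‖_{L^p}`. -/
def SmTo (p : ℝ≥0∞) (l : Filter ι) (f : ι → ℝ → ℝ) (g : ℝ → ℝ) : Prop :=
  Sm p g ∧ Null p l fun s x => f s x - g x

theorem Null.congr {f g : ι → ℝ → ℝ} (hf : Null p l f) (h : ∀ᶠ s in l, f s = g s) :
    Null p l g := by
  refine ⟨?_, fun n => (hf.2 n).congr' ?_⟩
  · filter_upwards [hf.1, h] with s h1 h2
    rwa [← h2]
  · filter_upwards [h] with s h2
    rw [h2]

theorem Null.add [hp : Fact (1 ≤ p)] {f g : ι → ℝ → ℝ} (hf : Null p l f) (hg : Null p l g) :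
    Null p l fun s x => f s x + g s x := by
  refine ⟨by filter_upwards [hf.1, hg.1] with s h1 h2 using h1.add h2, fun n => ?_⟩
  have h0 := (hf.2 n).add (hg.2 n)
  rw [add_zero] at h0
  refine tendsto_of_tendsto_of_tendsto_of_le_of_le' tendsto_const_nhds h0
    (Eventually.of_forall fun _ => zero_le) ?_
  filter_upwards [hf.1, hg.1] with s h1 h2
  rw [iteratedDeriv_smooth_add h1.1 h2.1]
  exact eLpNorm_add_le (h1.2 n).1 (h2.2 n).1 hp.out

theorem Null.const_mul (c : ℝ) {f : ι → ℝ → ℝ} (hf : Null p l f) :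
    Null p l fun s x => c * f s x := by
  refine ⟨by filter_upwards [hf.1] with s h1 using h1.const_mul c, fun n => ?_⟩
  have h0 := ENNReal.Tendsto.const_mul (a := ‖c‖ₑ) (hf.2 n) (Or.inr (by simp))
  rw [mul_zero] at h0
  refine h0.congr' ?_
  filter_upwards [hf.1] with s h1
  rw [iteratedDeriv_smooth_const_mul c h1.1]
  exact (eLpNorm_const_smul c _ _ _).symm

theorem Null.bdd {f : ι → ℝ → ℝ} (hf : Null p l f) : Bdd p l f :=
  ⟨hf.1, fun n => ⟨1, by
    filter_upwards [(hf.2 n).eventually_lt_const zero_lt_one] with s h using by simpa using h.le⟩⟩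

theorem Bdd.of_sm {g : ℝ → ℝ} (hg : Sm p g) : Bdd p l fun _ => g :=
  ⟨Eventually.of_forall fun _ => hg, fun n => ⟨(eLpNorm (iteratedDeriv n g) p volume).toNNReal,
    Eventually.of_forall fun _ => by rw [ENNReal.coe_toNNReal (hg.2 n).eLpNorm_ne_top]⟩⟩

theorem Bdd.add [hp : Fact (1 ≤ p)] {f g : ι → ℝ → ℝ} (hf : Bdd p l f) (hg : Bdd p l g) :
    Bdd p l fun s x => f s x + g s x := by
  refine ⟨by filter_upwards [hf.1, hg.1] with s h1 h2 using h1.add h2, fun n => ?_⟩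
  obtain ⟨C, hC⟩ := hf.2 n
  obtain ⟨D, hD⟩ := hg.2 n
  refine ⟨C + D, ?_⟩
  filter_upwards [hf.1, hg.1, hC, hD] with s h1 h2 h3 h4
  rw [iteratedDeriv_smooth_add h1.1 h2.1, ENNReal.coe_add]
  exact (eLpNorm_add_le (h1.2 n).1 (h2.2 n).1 hp.out).trans (add_le_add h3 h4)

theorem Bdd.congr {f g : ι → ℝ → ℝ} (hf : Bdd p l f) (h : ∀ᶠ s in l, f s = g s) :
    Bdd p l g := by
  refine ⟨by filter_upwards [hf.1, h] with s h1 h2 using h2 ▸ h1, fun n => ?_⟩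
  obtain ⟨C, hC⟩ := hf.2 n
  exact ⟨C, by filter_upwards [hC, h] with s h1 h2 using h2 ▸ h1⟩

theorem Null.mul_bdd [ENNReal.HolderTriple p q r] [Fact (1 ≤ r)] {f g : ι → ℝ → ℝ}
    (hf : Null p l f) (hg : Bdd q l g) : Null r l fun s x => f s x * g s x := by
  refine ⟨by filter_upwards [hf.1, hg.1] with s h1 h2 using h1.mul h2, fun n => ?_⟩
  choose C hC using hg.2
  have h0 : Tendsto (fun s => ∑ i ∈ Finset.range (n + 1), (n.choose i : ℝ≥0∞) *
      (eLpNorm (iteratedDeriv i (f s)) p volume * (C (n - i) : ℝ≥0∞))) l (𝓝 0) := by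
    have : (0 : ℝ≥0∞) = ∑ i ∈ Finset.range (n + 1), (n.choose i : ℝ≥0∞) *
      (0 * (C (n - i) : ℝ≥0∞)) := by simp
    rw [this]
    refine tendsto_finsetSum _ fun i _ => ?_
    exact ENNReal.Tendsto.const_mul (ENNReal.Tendsto.mul_const (hf.2 i) (Or.inr (by simp)))
      (Or.inr (by simp))
  refine tendsto_of_tendsto_of_tendsto_of_le_of_le' tendsto_const_nhds h0
    (Eventually.of_forall fun _ => zero_le) ?_
  have hC' : ∀ᶠ s in l, ∀ i ∈ Finset.range (n + 1),
      eLpNorm (iteratedDeriv (n - i) (g s)) q volume ≤ C (n - i) :=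
    (Finset.eventually_all _).2 fun i _ => hC _
  filter_upwards [hf.1, hg.1, hC'] with s h1 h2 h3
  refine (eLpNorm_iteratedDeriv_mul_le (p := p) (q := q) h1.1 h2.1 n).trans ?_
  gcongr with i hi
  exact h3 i hi

theorem SmTo.congr {f f' : ι → ℝ → ℝ} {g : ℝ → ℝ} (hf : SmTo p l f g)
    (h : ∀ᶠ s in l, f s = f' s) : SmTo p l f' g :=
  ⟨hf.1, hf.2.congr (by filter_upwards [h] with s hs; rw [hs])⟩

theorem SmTo.sm_eventually {f : ι → ℝ → ℝ} {g : ℝ → ℝ} (hf : SmTo p l f g) :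
    ∀ᶠ s in l, Sm p (f s) := by
  filter_upwards [hf.2.1] with s h
  simpa using h.add hf.1

theorem SmTo.bdd [Fact (1 ≤ p)] {f : ι → ℝ → ℝ} {g : ℝ → ℝ} (hf : SmTo p l f g) : Bdd p l f :=
  (hf.2.bdd.add (Bdd.of_sm hf.1)).congr (Eventually.of_forall fun s => by simp)

theorem SmTo.const {g : ℝ → ℝ} (hg : Sm p g) : SmTo p l (fun _ => g) g := by
  refine ⟨hg, ?_⟩
  simp only [sub_self]
  refine ⟨Eventually.of_forall fun _ => Sm.zero, fun n => ?_⟩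
  have : iteratedDeriv n (fun _ : ℝ => (0 : ℝ)) = 0 := by
    ext x; simp
  simp [this, tendsto_const_nhds]

theorem SmTo.add [Fact (1 ≤ p)] {f f' : ι → ℝ → ℝ} {g g' : ℝ → ℝ} (h : SmTo p l f g)
    (h' : SmTo p l f' g') : SmTo p l (fun s x => f s x + f' s x) fun x => g x + g' x :=
  ⟨h.1.add h'.1, (h.2.add h'.2).congr (Eventually.of_forall fun s => by ext x; ring)⟩

theorem SmTo.const_mul (c : ℝ) {f : ι → ℝ → ℝ} {g : ℝ → ℝ} (h : SmTo p l f g) :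
    SmTo p l (fun s x => c * f s x) fun x => c * g x :=
  ⟨h.1.const_mul c, (h.2.const_mul c).congr (Eventually.of_forall fun s => by ext x; ring)⟩

theorem SmTo.mul [ENNReal.HolderTriple p q r] [ENNReal.HolderTriple q p r] [Fact (1 ≤ r)]
    [Fact (1 ≤ q)] {f f' : ι → ℝ → ℝ} {g g' : ℝ → ℝ} (h : SmTo p l f g) (h' : SmTo q l f' g') :
    SmTo r l (fun s x => f s x * f' s x) fun x => g x * g' x := by
  refine ⟨h.1.mul h'.1, ?_⟩
  have h1 : Null r l fun s x => (f s x - g x) * f' s x := h.2.mul_bdd h'.bdd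
  have h2 : Null r l fun s x => (f' s x - g' x) * g x := h'.2.mul_bdd (Bdd.of_sm h.1)
  exact (h1.add h2).congr (Eventually.of_forall fun s => by ext x; ring)

theorem SmTo.deriv {f : ι → ℝ → ℝ} {g : ℝ → ℝ} (h : SmTo p l f g) :
    SmTo p l (fun s => deriv (f s)) (deriv g) := by
  have e : ∀ᶠ s in l, _root_.deriv (fun x => f s x - g x) =
      fun x => _root_.deriv (f s) x - _root_.deriv g x := by
    filter_upwards [h.sm_eventually] with s hs
    ext x
    exact deriv_fun_sub ((hs.1.differentiable (by simp)) x) ((h.1.1.differentiable (by simp)) x)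
  refine ⟨h.1.deriv, ?_, fun n => (h.2.2 (n + 1)).congr' ?_⟩
  · filter_upwards [h.2.1, e] with s hs he
    rw [← he]
    exact hs.deriv
  · filter_upwards [e] with s he
    rw [iteratedDeriv_succ', he]

theorem Null.top {f : ι → ℝ → ℝ} (hf : Null 2 l f) : Null ∞ l f := by
  refine ⟨by filter_upwards [hf.1] with s h using h.top, fun n => ?_⟩
  have h0 := (hf.2 n).add (hf.2 (n + 1))
  rw [add_zero] at h0
  refine tendsto_of_tendsto_of_tendsto_of_le_of_le' tendsto_const_nhds h0
    (Eventually.of_forall fun _ => zero_le) ?_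
  filter_upwards [hf.1] with s h
  exact eLpNorm_iteratedDeriv_top_le_of_two h n

theorem SmTo.top {f : ι → ℝ → ℝ} {g : ℝ → ℝ} (h : SmTo 2 l f g) : SmTo ∞ l f g :=
  ⟨h.1.top, h.2.top⟩

theorem Null.forall_abs_lt {f : ι → ℝ → ℝ} (hf : Null ∞ l f) {e : ℝ} (he : 0 < e) :
    ∀ᶠ s in l, ∀ x, |f s x| < e := by
  have h0 := hf.2 0
  simp only [iteratedDeriv_zero] at h0
  filter_upwards [hf.1, h0.eventually_lt_const (ENNReal.ofReal_pos.2 he)] with s h1 h2 x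
  have h3 := (enorm_le_eLpNorm_top h1.1.continuous x).trans_lt h2
  rw [Real.enorm_eq_ofReal_abs] at h3
  exact (ENNReal.ofReal_lt_ofReal_iff he).1 h3

theorem SmTo.tendsto_apply {f : ι → ℝ → ℝ} {g : ℝ → ℝ} (h : SmTo ∞ l f g) (x : ℝ) :
    Tendsto (fun s => f s x) l (𝓝 (g x)) := by
  rw [Metric.tendsto_nhds]
  intro e he
  filter_upwards [h.2.forall_abs_lt he] with s hs
  exact hs x

theorem SmTo.tendsto_integral {f : ι → ℝ → ℝ} {g : ℝ → ℝ} (h : SmTo 1 l f g) :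
    Tendsto (fun s => ∫ x, f s x) l (𝓝 (∫ x, g x)) := by
  refine tendsto_integral_of_L1' g h.1.memLp.1
    (by filter_upwards [h.sm_eventually] with s hs using memLp_one_iff_integrable.1 hs.memLp) ?_
  simpa using! h.2.2 0

theorem deriv_inv_smooth {h : ℝ → ℝ} (hs : ContDiff ℝ ∞ h) (h0 : ∀ x, h x ≠ 0) :
    deriv (fun x => (h x)⁻¹) = fun x => (-1) * (deriv h x * ((h x)⁻¹ * (h x)⁻¹)) := by
  ext x
  rw [deriv_fun_inv'' ((hs.differentiable (by simp)) x) (h0 x)]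
  field_simp

/-- Strong induction on the order through (1/f)' = −f'/f², which expresses a derivative of order n +
1 by derivatives of 1/f of order at most n. -/
theorem eLpNorm_inv_bound {f : ι → ℝ → ℝ} {c : ℝ} (hc : 0 < c) (hf : Bdd ∞ l f)
    (hl : ∀ᶠ s in l, ∀ x, c ≤ f s x) (n : ℕ) :
    ∃ C : NNReal, ∀ᶠ s in l, ∀ k ≤ n,
      eLpNorm (iteratedDeriv k fun x => (f s x)⁻¹) ∞ volume ≤ C := by
  induction n with
  | zero =>
    refine ⟨(c⁻¹).toNNReal, ?_⟩
    filter_upwards [hl] with s hs k hk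
    rw [Nat.le_zero.1 hk, iteratedDeriv_zero, eLpNorm_exponent_top]
    refine (eLpNormEssSup_le_of_ae_bound (C := c⁻¹) (Eventually.of_forall fun x => ?_))
    rw [Real.norm_of_nonneg (inv_nonneg.2 (hc.le.trans (hs x)))]
    exact inv_anti₀ hc (hs x)
  | succ n ih =>
    obtain ⟨C, hC⟩ := ih
    choose D hD using hf.2
    -- The Leibniz rule applied twice, to f'·(f⁻¹·f⁻¹) and then to f⁻¹·f⁻¹.
    set E : NNReal := ∑ i ∈ Finset.range (n + 1), (n.choose i : NNReal) *
      (D (i + 1) * ∑ j ∈ Finset.range (n - i + 1), ((n - i).choose j : NNReal) * (C * C))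
    refine ⟨C + E, ?_⟩
    have hD' : ∀ᶠ s in l, ∀ i ∈ Finset.range (n + 1),
      eLpNorm (iteratedDeriv (i + 1) (f s)) ∞ volume ≤ D (i + 1) :=
      (Finset.eventually_all _).2 fun i _ => hD _
    filter_upwards [hf.1, hl, hC, hD'] with s h1 h2 h3 h4 k hk
    have hne : ∀ x, f s x ≠ 0 := fun x => (hc.trans_le (h2 x)).ne'
    have hinv : ContDiff ℝ ∞ fun x => (f s x)⁻¹ := h1.1.inv hne
    have hder : ContDiff ℝ ∞ (deriv (f s)) := h1.deriv.1
    rcases Nat.of_le_succ hk with hk | hk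
    · exact (h3 k hk).trans (by simp)
    · rw [hk, iteratedDeriv_succ', deriv_inv_smooth h1.1 hne,
        iteratedDeriv_smooth_const_mul _ (hder.mul (hinv.mul hinv))]
      have e1 : eLpNorm (fun x => -1 * iteratedDeriv n
          (fun x => deriv (f s) x * ((f s x)⁻¹ * (f s x)⁻¹)) x) ∞ volume =
          eLpNorm (iteratedDeriv n fun x => deriv (f s) x * ((f s x)⁻¹ * (f s x)⁻¹)) ∞ volume :=
        eLpNorm_congr_norm_ae (Eventually.of_forall fun x => by simp)
      rw [e1]
      refine le_trans ?_ (show (E : ℝ≥0∞) ≤ ((C + E : NNReal) : ℝ≥0∞) by simp)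
      refine (eLpNorm_iteratedDeriv_mul_le (p := ∞) (q := ∞) hder (hinv.mul hinv) n).trans ?_
      simp only [E]
      push_cast
      gcongr with i hi j hj
      · rw [← iteratedDeriv_succ']
        exact h4 i hi
      · refine (eLpNorm_iteratedDeriv_mul_le (p := ∞) (q := ∞) hinv hinv (n - i)).trans ?_
        gcongr with j hj
        · exact h3 j (by have := Finset.mem_range.1 hj; omega)
        · exact h3 _ (by omega)

theorem Bdd.inv {f : ι → ℝ → ℝ} {c : ℝ} (hc : 0 < c) (hf : Bdd ∞ l f)
    (hl : ∀ᶠ s in l, ∀ x, c ≤ f s x) : Bdd ∞ l fun s x => (f s x)⁻¹ := by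
  have hsm : ∀ g : ℝ → ℝ, Sm ∞ g → (∀ x, c ≤ g x) → Sm ∞ fun x => (g x)⁻¹ := by
    intro g hg hgc
    have hinv : ContDiff ℝ ∞ fun x => (g x)⁻¹ := hg.1.inv fun x => (hc.trans_le (hgc x)).ne'
    refine ⟨hinv, fun n => ⟨aestronglyMeasurable_iteratedDeriv hinv n, ?_⟩⟩
    -- A single function is a constant family along the filter `pure ()`.
    obtain ⟨C, hC⟩ := eLpNorm_inv_bound (l := pure ()) (f := fun _ => g) hc (Bdd.of_sm hg)
      (by simpa using hgc) n
    have := (eventually_pure.1 hC) n le_rfl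
    exact this.trans_lt ENNReal.coe_lt_top
  refine ⟨by filter_upwards [hf.1, hl] with s h1 h2 using hsm _ h1 h2, fun n => ?_⟩
  obtain ⟨C, hC⟩ := eLpNorm_inv_bound hc hf hl n
  exact ⟨C, by filter_upwards [hC] with s hs using hs n le_rfl⟩

/-- Bounded smooth functions bounded below by a positive constant. -/
def Depth (h : ℝ → ℝ) : Prop := Sm ∞ h ∧ ∃ c > 0, ∀ x, c ≤ h x

theorem Depth.pos {h : ℝ → ℝ} (hh : Depth h) (x : ℝ) : 0 < h x := by
  obtain ⟨c, hc, hl⟩ := hh.2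
  exact hc.trans_le (hl x)

theorem Depth.inv {h : ℝ → ℝ} (hh : Depth h) : Sm ∞ fun x => (h x)⁻¹ := by
  obtain ⟨c, hc, hl⟩ := hh.2
  exact eventually_pure.1 (Bdd.inv (l := pure ()) (f := fun _ => h) hc (Bdd.of_sm hh.1)
    (by simpa using hl)).1

theorem SmTo.eventually_depth {f : ι → ℝ → ℝ} {g : ℝ → ℝ} (h : SmTo ∞ l f g) (hg : Depth g) :
    ∃ c > 0, ∀ᶠ s in l, Sm ∞ (f s) ∧ ∀ x, c ≤ f s x := by
  obtain ⟨c, hc, hl⟩ := hg.2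
  refine ⟨c / 2, by positivity, ?_⟩
  filter_upwards [h.2.forall_abs_lt (half_pos hc), h.sm_eventually] with s hs h1
  refine ⟨h1, fun x => ?_⟩
  have := (abs_lt.1 (hs x)).1
  linarith [hl x]

theorem SmTo.inv {f : ι → ℝ → ℝ} {g : ℝ → ℝ} (h : SmTo ∞ l f g) (hg : Depth g) :
    SmTo ∞ l (fun s x => (f s x)⁻¹) fun x => (g x)⁻¹ := by
  obtain ⟨c, hc, hl⟩ := h.eventually_depth hg
  have hb : Bdd ∞ l fun s x => (f s x)⁻¹ := h.bdd.inv hc (hl.mono fun s hs => hs.2)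
  refine ⟨hg.inv, ?_⟩
  have h1 : Null ∞ l fun s x => (f s x - g x) * (f s x)⁻¹ := h.2.mul_bdd hb
  have h2 : Null ∞ l fun s x => (f s x - g x) * (f s x)⁻¹ * (g x)⁻¹ :=
    h1.mul_bdd (Bdd.of_sm hg.inv)
  refine (h2.const_mul (-1)).congr ?_
  filter_upwards [hl] with s hs
  ext x
  have e1 : f s x ≠ 0 := (hc.trans_le (hs.2 x)).ne'
  have e2 := (hg.pos x).ne'
  field_simp
  ring

/-- Continuity of T on H^∞; together with linearity it lets every limit in this calculus pass
through the multiplier. -/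
theorem Null.opT {F : ℝ → ℝ} (hF : IsMultiplierFunction F) (μ : ℝ) {f : ι → ℝ → ℝ}
    (hf : Null 2 l f) : Null 2 l fun s => opT F μ (f s) := by
  refine ⟨by filter_upwards [hf.1] with s h using hInf_opT μ hF h, fun n => ?_⟩
  obtain ⟨C, M, hC⟩ := opT_bound μ hF n
  have h0 := ENNReal.Tendsto.const_mul (a := (C : ℝ≥0∞)) ((hf.2 0).add (hf.2 M))
    (Or.inr (by simp))
  rw [add_zero, mul_zero] at h0
  refine tendsto_of_tendsto_of_tendsto_of_le_of_le' tendsto_const_nhds h0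
    (Eventually.of_forall fun _ => zero_le) ?_
  filter_upwards [hf.1] with s h
  simpa using hC (f s) h

theorem opT_sub {F : ℝ → ℝ} (hF : IsMultiplierFunction F) (μ : ℝ) {f g : ℝ → ℝ} (hf : HInf f)
    (hg : HInf g) : opT F μ (fun x => f x - g x) = fun x => opT F μ f x - opT F μ g x := by
  have h1 : HInf fun x => (-1) * g x := Sm.const_mul (-1) hg
  have h2 := opT_add μ hF hf h1 (Sm.add hf h1)
  rw [opT_const_mul μ hF (-1) hg h1] at h2
  have e : (fun x => f x - g x) = fun x => f x + (-1) * g x := by ext x; ring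
  rw [e, h2]
  ext x
  ring

theorem SmTo.opT {F : ℝ → ℝ} (hF : IsMultiplierFunction F) (μ : ℝ) {f : ι → ℝ → ℝ} {g : ℝ → ℝ}
    (h : SmTo 2 l f g) : SmTo 2 l (fun s => opT F μ (f s)) (opT F μ g) :=
  ⟨hInf_opT μ hF h.1, (h.2.opT hF μ).congr (by
    filter_upwards [h.sm_eventually] with s hs using opT_sub hF μ hs h.1)⟩

end

/-! ### Differentiation with respect to a parameter -/

section

variable {p q r : ℝ≥0∞}

/-- `s ↦ f s` is differentiable at `t` within `I`, with derivative `f'`, for all seminorms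
`‖∂ⁿ·‖_{L^p}`. -/
def SmDeriv (p : ℝ≥0∞) (I : Set ℝ) (t : ℝ) (f : ℝ → ℝ → ℝ) (f' : ℝ → ℝ) : Prop :=
  Sm p (f t) ∧ SmTo p (𝓝[I \ {t}] t) (fun s x => (f s x - f t x) / (s - t)) f'

variable {I : Set ℝ} {t : ℝ}

theorem eventually_ne_of_punctured : ∀ᶠ s in 𝓝[I \ {t}] t, s ∈ I ∧ s - t ≠ 0 := by
  filter_upwards [self_mem_nhdsWithin] with s hs
  exact ⟨hs.1, sub_ne_zero.2 hs.2⟩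

theorem HInfDifferentiableOn.exists_smDeriv {f : ℝ → ℝ → ℝ} (hf : HInfDifferentiableOn I f)
    (ht : t ∈ I) : ∃ f', SmDeriv 2 I t f f' := by
  obtain ⟨h1, f', h2, h3⟩ := hf t ht
  refine ⟨f', h1, h2, ?_, h3⟩
  filter_upwards [eventually_ne_of_punctured] with s hs
  have := ((Sm.sub (hf s hs.1).1 h1).const_mul (s - t)⁻¹).sub h2
  convert this using 2 with x
  ring

theorem Bdd.null_mul {ι : Type*} {l : Filter ι} {c : ι → ℝ} (hc : Tendsto c l (𝓝 0))
    {f : ι → ℝ → ℝ} (hf : Bdd p l f) : Null p l fun s x => c s * f s x := by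
  refine ⟨by filter_upwards [hf.1] with s h using h.const_mul _, fun n => ?_⟩
  obtain ⟨C, hC⟩ := hf.2 n
  have h0 : Tendsto (fun s => ‖c s‖ₑ * (C : ℝ≥0∞)) l (𝓝 0) := by
    have := ENNReal.Tendsto.mul_const (b := (C : ℝ≥0∞)) hc.enorm (Or.inr (by simp))
    simpa using this
  refine tendsto_of_tendsto_of_tendsto_of_le_of_le' tendsto_const_nhds h0
    (Eventually.of_forall fun _ => zero_le) ?_
  filter_upwards [hf.1, hC] with s h1 h2
  rw [iteratedDeriv_smooth_const_mul _ h1.1]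
  refine (eLpNorm_const_smul (c s) _ _ _).le.trans ?_
  gcongr

theorem tendsto_sub_punctured : Tendsto (fun s => s - t) (𝓝[I \ {t}] t) (𝓝 0) := by
  have : Tendsto (fun s => s - t) (𝓝 t) (𝓝 (t - t)) := tendsto_id.sub_const t
  rw [sub_self] at this
  exact this.mono_left nhdsWithin_le_nhds

/-- The increment is s − t times a bounded difference quotient. -/
theorem SmDeriv.tendsto [Fact (1 ≤ p)] {f : ℝ → ℝ → ℝ} {f' : ℝ → ℝ} (h : SmDeriv p I t f f') :
    SmTo p (𝓝[I \ {t}] t) f (f t) := by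
  refine ⟨h.1, (Bdd.null_mul tendsto_sub_punctured h.2.bdd).congr ?_⟩
  filter_upwards [eventually_ne_of_punctured] with s hs
  ext x
  have := hs.2
  field_simp

theorem SmDeriv.congr {f g : ℝ → ℝ → ℝ} {f' : ℝ → ℝ} (h : SmDeriv p I t f f')
    (hfg : ∀ᶠ s in 𝓝[I \ {t}] t, f s = g s) (ht : f t = g t) : SmDeriv p I t g f' :=
  ⟨ht ▸ h.1, h.2.congr (by filter_upwards [hfg] with s hs; rw [hs, ht])⟩

theorem SmDeriv.const {g : ℝ → ℝ} (hg : Sm p g) : SmDeriv p I t (fun _ => g) fun _ => 0 :=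
  ⟨hg, (SmTo.const Sm.zero).congr (Eventually.of_forall fun s => by ext x; simp)⟩

theorem SmDeriv.add [Fact (1 ≤ p)] {f g : ℝ → ℝ → ℝ} {f' g' : ℝ → ℝ} (hf : SmDeriv p I t f f')
    (hg : SmDeriv p I t g g') :
    SmDeriv p I t (fun s x => f s x + g s x) fun x => f' x + g' x :=
  ⟨hf.1.add hg.1, (hf.2.add hg.2).congr (Eventually.of_forall fun s => by ext x; ring)⟩

theorem SmDeriv.const_mul (c : ℝ) {f : ℝ → ℝ → ℝ} {f' : ℝ → ℝ} (hf : SmDeriv p I t f f') :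
    SmDeriv p I t (fun s x => c * f s x) fun x => c * f' x :=
  ⟨hf.1.const_mul c, (hf.2.const_mul c).congr (Eventually.of_forall fun s => by ext x; ring)⟩

theorem SmDeriv.mul [ENNReal.HolderTriple p q r] [ENNReal.HolderTriple q p r] [Fact (1 ≤ r)]
    [Fact (1 ≤ q)] [Fact (1 ≤ p)] {f g : ℝ → ℝ → ℝ} {f' g' : ℝ → ℝ} (hf : SmDeriv p I t f f')
    (hg : SmDeriv q I t g g') :
    SmDeriv r I t (fun s x => f s x * g s x) fun x => f' x * g t x + f t x * g' x := by
  refine ⟨hf.1.mul hg.1, ?_⟩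
  have h1 : SmTo r (𝓝[I \ {t}] t) _ _ := hf.2.mul hg.tendsto
  have h2 : SmTo r (𝓝[I \ {t}] t) _ _ := (SmTo.const hf.1).mul hg.2
  refine (h1.add h2).congr (Eventually.of_forall fun s => ?_)
  ext x
  ring

theorem SmDeriv.top {f : ℝ → ℝ → ℝ} {f' : ℝ → ℝ} (hf : SmDeriv 2 I t f f') :
    SmDeriv ∞ I t f f' := ⟨hf.1.top, hf.2.top⟩

theorem SmDeriv.sm_eventually [Fact (1 ≤ p)] {f : ℝ → ℝ → ℝ} {f' : ℝ → ℝ}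
    (h : SmDeriv p I t f f') : ∀ᶠ s in 𝓝[I \ {t}] t, Sm p (f s) := h.tendsto.sm_eventually

theorem SmDeriv.deriv [Fact (1 ≤ p)] {f : ℝ → ℝ → ℝ} {f' : ℝ → ℝ} (hf : SmDeriv p I t f f') :
    SmDeriv p I t (fun s => deriv (f s)) (deriv f') := by
  refine ⟨hf.1.deriv, hf.2.deriv.congr ?_⟩
  filter_upwards [hf.sm_eventually] with s hs
  ext x
  rw [deriv_div_const, deriv_fun_sub ((hs.1.differentiable (by simp)) x)
    ((hf.1.1.differentiable (by simp)) x)]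

theorem SmDeriv.opT {F : ℝ → ℝ} (hF : IsMultiplierFunction F) (μ : ℝ) {f : ℝ → ℝ → ℝ}
    {f' : ℝ → ℝ} (hf : SmDeriv 2 I t f f') :
    SmDeriv 2 I t (fun s => opT F μ (f s)) (opT F μ f') := by
  refine ⟨hInf_opT μ hF hf.1, (hf.2.opT hF μ).congr ?_⟩
  filter_upwards [hf.sm_eventually] with s hs
  have hd : HInf fun x => f s x - f t x := Sm.sub hs hf.1
  have e : (fun x => (f s x - f t x) / (s - t)) = fun x => (s - t)⁻¹ * (f s x - f t x) := by
    ext x; ring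
  rw [e, opT_const_mul μ hF _ hd (Sm.const_mul _ hd), opT_sub hF μ hs hf.1]
  ext x
  ring

/-- The exact identity 1/f(s) − 1/f(t) = −(f(s) − f(t)) / (f(s) f(t)) reduces the claim to
convergence of products and of inverses. -/
theorem SmDeriv.inv {f : ℝ → ℝ → ℝ} {f' : ℝ → ℝ} (hf : SmDeriv ∞ I t f f')
    (hd : Depth (f t)) : SmDeriv ∞ I t (fun s x => (f s x)⁻¹)
      fun x => (-1) * (f' x * ((f t x)⁻¹ * (f t x)⁻¹)) := by
  refine ⟨hd.inv, ?_⟩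
  have hi := hf.tendsto.inv hd
  have h1 : SmTo ∞ (𝓝[I \ {t}] t) _ _ := hi.mul (SmTo.const (l := 𝓝[I \ {t}] t) hd.inv)
  have h2 : SmTo ∞ (𝓝[I \ {t}] t) _ _ := hf.2.mul h1
  refine (h2.const_mul (-1)).congr ?_
  obtain ⟨c, hc, hl⟩ := hf.tendsto.eventually_depth hd
  filter_upwards [hl] with s hs
  ext x
  have e1 : f s x ≠ 0 := (hc.trans_le (hs.2 x)).ne'
  have e2 := (hd.pos x).ne'
  field_simp
  ring

theorem SmDeriv.hasDerivWithinAt_apply {f : ℝ → ℝ → ℝ} {f' : ℝ → ℝ} (hf : SmDeriv ∞ I t f f')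
    (x : ℝ) : HasDerivWithinAt (fun s => f s x) (f' x) I t := by
  rw [hasDerivWithinAt_iff_tendsto_slope]
  refine (hf.2.tendsto_apply x).congr fun s => ?_
  rw [slope_def_field]

theorem SmDeriv.hasDerivWithinAt_integral {f : ℝ → ℝ → ℝ} {f' : ℝ → ℝ}
    (hf : SmDeriv 1 I t f f') : HasDerivWithinAt (fun s => ∫ x, f s x) (∫ x, f' x) I t := by
  rw [hasDerivWithinAt_iff_tendsto_slope]
  refine hf.2.tendsto_integral.congr' ?_
  filter_upwards [hf.sm_eventually] with s hs
  rw [slope_def_field, integral_div, integral_sub (memLp_one_iff_integrable.1 hs.memLp)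
    (memLp_one_iff_integrable.1 hf.1.memLp)]

/-- Functional derivatives are derivatives at s = 0 of such families, so variations and evolution in
time share the same calculus. -/
theorem SmDeriv.affine {f φ : ℝ → ℝ} (hf : Sm p f) (hφ : Sm p φ) :
    SmDeriv p Set.univ 0 (fun s x => f x + s * φ x) φ := by
  refine ⟨by simpa using hf, (SmTo.const hφ).congr ?_⟩
  filter_upwards [eventually_ne_of_punctured] with s hs
  ext x
  have := hs.2
  rw [sub_zero] at this ⊢
  field_simp
  ring

theorem HInf.mul_integrable {f g : ℝ → ℝ} (hf : Sm 2 f) (hg : Sm 2 g) :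
    Integrable fun x => f x * g x := hf.memLp.integrable_mul hg.memLp

/-! ### One layer -/

variable {F : ℝ → ℝ} {μ : ℝ}

theorem layerA_eq (F : ℝ → ℝ) (μ : ℝ) (h w : ℝ → ℝ) : layerA F μ h w = fun x =>
    (h x)⁻¹ * w x - μ / 3 * (h x)⁻¹ *
      opT F μ (fun y => h y ^ 3 * opT F μ (fun z => (h z)⁻¹ * w z) y) x := rfl

theorem layerR_eq (F : ℝ → ℝ) (μ : ℝ) (h u : ℝ → ℝ) : layerR F μ h u = fun x =>
    1 / 2 * (h x * opT F μ u x) ^ 2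
      + 1 / 3 * (h x)⁻¹ * u x * opT F μ (fun y => h y ^ 3 * opT F μ u y) x := rfl

theorem layerQ_eq (F : ℝ → ℝ) (μ : ℝ) (h u : ℝ → ℝ) : layerQ F μ h u = fun x =>
    -(1 / 3) * (h x)⁻¹ * opT F μ (fun y => h y ^ 3 * opT F μ u y) x := rfl

theorem Sm.congr {f g : ℝ → ℝ} (hf : Sm p f) (h : ∀ x, f x = g x) : Sm p g :=
  funext h ▸ hf

theorem Sm.top_mul {f g : ℝ → ℝ} (hf : Sm ∞ f) (hg : Sm 2 g) : Sm 2 fun x => f x * g x :=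
  hf.mul hg

theorem Sm.top_mul_top {f g : ℝ → ℝ} (hf : Sm ∞ f) (hg : Sm ∞ g) : Sm ∞ fun x => f x * g x :=
  hf.mul hg

theorem Sm.cube {f : ℝ → ℝ} (hf : Sm ∞ f) : Sm ∞ fun x => f x ^ 3 := by
  have := hf.top_mul_top (hf.top_mul_top hf)
  convert this using 2
  ring

theorem Depth.cube_mul {h g : ℝ → ℝ} (hh : Depth h) (hg : Sm 2 g) :
    HInf fun x => h x ^ 3 * g x := hh.1.cube.top_mul hg

theorem hInf_flux (hF : IsMultiplierFunction F) {h u : ℝ → ℝ} (hh : Depth h) (hu : HInf u) :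
    HInf (opT F μ fun y => h y ^ 3 * opT F μ u y) :=
  hInf_opT μ hF (hh.cube_mul (hInf_opT μ hF hu))

theorem hInf_layerA (hF : IsMultiplierFunction F) {h w : ℝ → ℝ} (hh : Depth h) (hw : HInf w) :
    HInf (layerA F μ h w) := by
  have hu : HInf fun z => (h z)⁻¹ * w z := hh.inv.top_mul hw
  have h1 := (hh.inv.top_mul (hInf_flux (μ := μ) hF hh hu)).const_mul (μ / 3)
  have := Sm.sub hu h1
  rw [layerA_eq]
  exact this.congr fun x => by ring

theorem hInf_layerR (hF : IsMultiplierFunction F) {h u : ℝ → ℝ} (hh : Depth h) (hu : HInf u) :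
    HInf (layerR F μ h u) := by
  have h1 := (hh.inv.top_mul_top (Sm.top hu)).top_mul (hInf_flux (μ := μ) hF hh hu)
  have h2 := hh.1.top_mul (hInf_opT μ hF hu)
  have h3 := (h2.top.top_mul h2).const_mul (1 / 2)
  have := h3.add (h1.const_mul (1 / 3))
  rw [layerR_eq]
  exact this.congr fun x => by ring

/-- The quadratic form of one layer for smooth functions. -/
theorem integral_layerA_mul (hF : IsMultiplierFunction F) {h u u' : ℝ → ℝ} (hh : Depth h)
    (hu : HInf u) (hu' : HInf u') :
    ∫ x, layerA F μ h (fun y => h y * u y) x * (h x * u' x) =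
      ∫ x, h x * u x * u' x + μ / 3 * h x ^ 3 * opT F μ u x * opT F μ u' x := by
  have e : (fun z => (h z)⁻¹ * (h z * u z)) = u := by
    ext z; rw [inv_mul_cancel_left₀ (hh.pos z).ne']
  set n := opT F μ fun y => h y ^ 3 * opT F μ u y with hn
  have hnI : HInf n := hInf_flux hF hh hu
  have hk := hInf_opT μ hF hu
  have hk' := hInf_opT μ hF hu'
  have i1 : Integrable fun x => h x * u x * u' x := HInf.mul_integrable (hh.1.top_mul hu) hu'
  have i2 : Integrable fun x => n x * u' x := HInf.mul_integrable hnI hu'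
  have i3 : Integrable fun x => h x ^ 3 * opT F μ u x * opT F μ u' x :=
    HInf.mul_integrable (hh.cube_mul hk) hk'
  have key : ∫ x, n x * u' x = -∫ x, h x ^ 3 * opT F μ u x * opT F μ u' x :=
    integral_opT_mul μ hF (hh.cube_mul hk) hu'
  have e1 : ∫ x, layerA F μ h (fun y => h y * u y) x * (h x * u' x) =
      ∫ x, (h x * u x * u' x - μ / 3 * (n x * u' x)) := by
    refine integral_congr_ae (Eventually.of_forall fun x => ?_)
    rw [layerA_eq]
    simp only [e, ← hn]
    have := (hh.pos x).ne'
    field_simp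
  have e2 : ∫ x, h x * u x * u' x + μ / 3 * h x ^ 3 * opT F μ u x * opT F μ u' x =
      ∫ x, (h x * u x * u' x + μ / 3 * (h x ^ 3 * opT F μ u x * opT F μ u' x)) := by
    refine integral_congr_ae (Eventually.of_forall fun x => ?_)
    ring
  rw [e1, e2, integral_sub i1 (i2.const_mul _), integral_add i1 (i3.const_mul _),
    integral_const_mul, integral_const_mul, key]
  ring

/-- The variation of `𝒜[h](hu)` along variations `h'`, `u'` of `h`, `u`. -/
def layerDot (F : ℝ → ℝ) (μ : ℝ) (h h' u u' : ℝ → ℝ) : ℝ → ℝ := fun x =>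
  u' x - μ / 3 * ((h x)⁻¹ * opT F μ (fun y => 3 * (h y * h y) * h' y * opT F μ u y
      + h y ^ 3 * opT F μ u' y) x
    - h' x * ((h x)⁻¹ * (h x)⁻¹) * opT F μ (fun y => h y ^ 3 * opT F μ u y) x)

/-- Let k = Tu, k' = Tu', and let n, n' be the images under T of h³k and of its variation. After
cancellation the left-hand integrand is −h'u² + (2μ/3) h'h⁻¹un + (μ/3)(nu' − n'u). By antisymmetry
of T, ∫ (nu' − n'u) = ∫ 3h²h'k²: the terms with u' cancel, and the rest is h'(−u² + 2μℛ). -/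
theorem integral_layerDot_mul (hF : IsMultiplierFunction F) {h h' u u' : ℝ → ℝ} (hh : Depth h)
    (hh' : Sm ∞ h') (hu : HInf u) (hu' : HInf u') :
    ∫ x, (layerDot F μ h h' u u' x * (h x * u x) - layerA F μ h (fun y => h y * u y) x *
        (h' x * u x + h x * u' x)) =
      ∫ x, h' x * (-u x ^ 2 + 2 * μ * layerR F μ h u x) := by
  have e : (fun z => (h z)⁻¹ * (h z * u z)) = u := by
    ext z; rw [inv_mul_cancel_left₀ (hh.pos z).ne']
  set k := opT F μ u with hk
  set k' := opT F μ u' with hk'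
  set n := opT F μ fun y => h y ^ 3 * k y with hn
  set n' := opT F μ (fun y => 3 * (h y * h y) * h' y * k y + h y ^ 3 * k' y) with hn'
  have kI : HInf k := hInf_opT μ hF hu
  have kI' : HInf k' := hInf_opT μ hF hu'
  have nI : HInf n := hInf_flux hF hh hu
  have mI : HInf fun y => h y ^ 3 * k y := hh.cube_mul kI
  have a1 : Sm ∞ fun y => 3 * (h y * h y) * h' y :=
    ((hh.1.top_mul_top hh.1).const_mul 3).top_mul_top hh'
  have mI' : HInf fun y => 3 * (h y * h y) * h' y * k y + h y ^ 3 * k' y :=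
    (a1.top_mul kI).add (hh.cube_mul kI')
  have nI' : HInf n' := hInf_opT μ hF mI'
  have key1 : ∫ x, n x * u' x = -∫ x, h x ^ 3 * k x * k' x := integral_opT_mul μ hF mI hu'
  have key2 : ∫ x, n' x * u x = -∫ x, (3 * (h x * h x) * h' x * k x + h x ^ 3 * k' x) * k x :=
    integral_opT_mul μ hF mI' hu
  have i1 : Integrable fun x => n x * u' x := HInf.mul_integrable nI hu'
  have i2 : Integrable fun x => n' x * u x := HInf.mul_integrable nI' hu
  have i3 : Integrable fun x => h x ^ 3 * k x * k' x := HInf.mul_integrable mI kI'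
  have i4 : Integrable fun x => (3 * (h x * h x) * h' x * k x + h x ^ 3 * k' x) * k x :=
    HInf.mul_integrable mI' kI
  have i5 : Integrable fun x => h' x * u x * u x := HInf.mul_integrable (hh'.top_mul hu) hu
  have i6 : Integrable fun x => h' x * ((h x)⁻¹ * u x) * n x :=
    HInf.mul_integrable (hh'.top_mul (hh.inv.top_mul hu)) nI
  have e1 : ∫ x, (layerDot F μ h h' u u' x * (h x * u x) - layerA F μ h (fun y => h y * u y) x *
        (h' x * u x + h x * u' x)) =
      ∫ x, (-(h' x * u x * u x) + 2 * μ / 3 * (h' x * ((h x)⁻¹ * u x) * n x)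
        + μ / 3 * (n x * u' x - n' x * u x)) := by
    refine integral_congr_ae (Eventually.of_forall fun x => ?_)
    rw [layerA_eq]
    simp only [layerDot, e, ← hn, ← hk, ← hk', ← hn']
    have := (hh.pos x).ne'
    field_simp
    ring
  have e2 : ∫ x, h' x * (-u x ^ 2 + 2 * μ * layerR F μ h u x) =
      ∫ x, (-(h' x * u x * u x) + 2 * μ / 3 * (h' x * ((h x)⁻¹ * u x) * n x)
        + μ / 3 * ((3 * (h x * h x) * h' x * k x + h x ^ 3 * k' x) * k x
          - h x ^ 3 * k x * k' x)) := by
    refine integral_congr_ae (Eventually.of_forall fun x => ?_)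
    rw [layerR_eq]
    simp only [← hn, ← hk]
    ring
  have j0 : Integrable fun x => -(h' x * u x * u x)
      + 2 * μ / 3 * (h' x * ((h x)⁻¹ * u x) * n x) := i5.neg.add (i6.const_mul _)
  have j1 : Integrable fun x => μ / 3 * (n x * u' x - n' x * u x) := (i1.sub i2).const_mul _
  have j2 : Integrable fun x => μ / 3 * ((3 * (h x * h x) * h' x * k x + h x ^ 3 * k' x) * k x
      - h x ^ 3 * k x * k' x) := (i4.sub i3).const_mul _
  rw [e1, e2, integral_add j0 j1, integral_add j0 j2]
  rw [integral_const_mul, integral_const_mul, integral_sub i1 i2, integral_sub i4 i3, key1, key2]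
  ring

/-- The velocity u = w/h carries part of the variation of h, but the antisymmetrised pairing in
`integral_layerDot_mul` does not see the variation of u. This is why the statement pairs v' with w
and subtracts the pairing of 𝒜[h]w with w': the symmetric part is removed and only h' survives. -/
theorem exists_smDeriv_layerA (hF : IsMultiplierFunction F) (μ : ℝ) {h w : ℝ → ℝ → ℝ} {h' w' : ℝ → ℝ}
    (hh : SmDeriv ∞ I t h h') (hd : Depth (h t)) (hw : SmDeriv 2 I t w w') :
    ∃ v', SmDeriv 2 I t (fun s => layerA F μ (h s) (w s)) v' ∧
      ∫ x, (v' x * w t x - layerA F μ (h t) (w t) x * w' x) =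
        ∫ x, h' x * (-((h t x)⁻¹ * w t x) ^ 2
          + 2 * μ * layerR F μ (h t) (fun y => (h t y)⁻¹ * w t y) x) := by
  have hi := hh.inv hd
  have hu : SmDeriv 2 I t _ _ := hi.mul hw
  have hk := hu.opT hF μ
  have hc0 : SmDeriv ∞ I t _ _ := hh.mul hh
  have hc1 : SmDeriv ∞ I t _ _ := hc0.mul hh
  have hm : SmDeriv 2 I t _ _ := hc1.mul hk
  have hn := hm.opT hF μ
  have hin : SmDeriv 2 I t _ _ := hi.mul hn
  have hv := hu.add (hin.const_mul (-(μ / 3)))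
  set u : ℝ → ℝ := fun y => (h t y)⁻¹ * w t y with hudef
  set u' : ℝ → ℝ := fun x => -1 * (h' x * ((h t x)⁻¹ * (h t x)⁻¹)) * w t x + (h t x)⁻¹ * w' x
    with hu'def
  have hcube : ∀ s, (fun x => h s x * h s x * h s x * opT F μ (fun y => (h s y)⁻¹ * w s y) x) =
      fun x => h s x ^ 3 * opT F μ (fun y => (h s y)⁻¹ * w s y) x := by
    intro s; ext x; ring
  refine ⟨_, hv.congr (Eventually.of_forall fun s => ?_) ?_, ?_⟩
  · rw [layerA_eq]
    simp only [hcube]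
    ext x
    ring
  · rw [layerA_eq]
    simp only [hcube]
    ext x
    ring
  have h0 : ∀ x, h t x ≠ 0 := fun x => (hd.pos x).ne'
  have ew : (fun y => h t y * u y) = w t := by
    ext y
    simp only [hudef]
    rw [mul_inv_cancel_left₀ (h0 y)]
  have key := integral_layerDot_mul (μ := μ) (u := u) (u' := u') hF hd hh.2.1 hu.1 hu.2.1
  rw [ew] at key
  refine Eq.trans (integral_congr_ae (Eventually.of_forall fun x => ?_)) key
  have earg : (fun x => ((h' x * h t x + h t x * h' x) * h t x + h t x * h t x * h' x) *
      opT F μ u x + h t x * h t x * h t x * opT F μ u' x) =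
      fun y => 3 * (h t y * h t y) * h' y * opT F μ u y + h t y ^ 3 * opT F μ u' y := by
    ext y; ring
  have e1 : h' x * u x + h t x * u' x = w' x := by
    simp only [hudef, hu'def]
    have := h0 x
    field_simp
    ring
  have e2 : h t x * u x = w t x := congrFun ew x
  have e3 : u' x = -1 * (h' x * ((h t x)⁻¹ * (h t x)⁻¹)) * w t x + (h t x)⁻¹ * w' x := rfl
  have e4 : (fun x => h t x * h t x * h t x * opT F μ u x) = fun y => h t y ^ 3 * opT F μ u y :=
    hcube t
  simp only [layerDot, e4, earg, e1, e2]
  rw [e3]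
  ring

/-- Invariance of one layer under translations, in infinitesimal form. -/
theorem integral_layerA_mul_deriv (hF : IsMultiplierFunction F) (μ : ℝ) {h u : ℝ → ℝ}
    (hh : Depth h) (hu : HInf u) :
    ∫ x, layerA F μ h (fun y => h y * u y) x * deriv (fun y => h y * u y) x =
      ∫ x, deriv h x * (1 / 2 * u x ^ 2 - μ * layerR F μ h u x) := by
  have hw : HInf fun y => h y * u y := hh.1.top_mul hu
  have hv : HInf (layerA F μ h fun y => h y * u y) := hInf_layerA hF hh hw
  have dh : ∀ x, HasDerivAt h (deriv h x) x := fun x =>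
    ((hh.1.1.differentiable (by simp)) x).hasDerivAt
  have du : ∀ x, HasDerivAt u (deriv u x) x := fun x =>
    ((hu.1.differentiable (by simp)) x).hasDerivAt
  have dw : deriv (fun y => h y * u y) = fun x => deriv h x * u x + h x * deriv u x := by
    ext x; exact ((dh x).mul (du x)).deriv
  have hk := hInf_opT μ hF hu
  have dk : ∀ x, HasDerivAt (opT F μ u) (opT F μ (deriv u) x) x := fun x => by
    rw [opT_deriv μ hF hu]
    exact ((hk.1.differentiable (by simp)) x).hasDerivAt
  have hm : HInf fun y => h y ^ 3 * opT F μ u y := hh.cube_mul hk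
  have dn : ∀ x, HasDerivAt (opT F μ fun y => h y ^ 3 * opT F μ u y)
      (opT F μ (fun y => 3 * (h y * h y) * deriv h y * opT F μ u y
      + h y ^ 3 * opT F μ (deriv u) y) x) x := fun x => by
    have e : (fun y => 3 * (h y * h y) * deriv h y * opT F μ u y + h y ^ 3 * opT F μ (deriv u) y)
        = deriv fun y => h y ^ 3 * opT F μ u y := by
      ext y
      refine Eq.symm (HasDerivAt.deriv ?_)
      convert! ((dh y).pow 3).mul (dk y) using 1
      simp only [Nat.cast_ofNat, Nat.add_one_sub_one, Pi.pow_apply]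
      ring
    rw [e, opT_deriv μ hF hm]
    exact (((hInf_opT μ hF hm).1.differentiable (by simp)) x).hasDerivAt
  have e : (fun z => (h z)⁻¹ * (h z * u z)) = u := by
    ext z; rw [inv_mul_cancel_left₀ (hh.pos z).ne']
  -- T commutes with ∂ₓ, so differentiating in x is the same as varying (h, u) in the direction
  -- (∂ₓh, ∂ₓu).
  have dv : deriv (layerA F μ h fun y => h y * u y) = layerDot F μ h (deriv h) u (deriv u) := by
    ext x
    rw [layerA_eq]
    simp only [e]
    refine HasDerivAt.deriv ?_
    have h1 : HasDerivAt (fun x => u x - μ / 3 * (h x)⁻¹ *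
        opT F μ (fun y => h y ^ 3 * opT F μ u y) x) (deriv u x - (μ / 3 * (-deriv h x / h x ^ 2) *
        opT F μ (fun y => h y ^ 3 * opT F μ u y) x + μ / 3 * (h x)⁻¹ *
        opT F μ (fun y => 3 * (h y * h y) * deriv h y * opT F μ u y
          + h y ^ 3 * opT F μ (deriv u) y) x)) x :=
      (du x).sub ((((dh x).inv (hh.pos x).ne').const_mul (μ / 3)).mul (dn x))
    have e' : ∀ y, (h y)⁻¹ * (h y * u y) = u y := congrFun e
    simp only [e']
    convert! h1 using 1
    simp only [layerDot]
    have := (hh.pos x).ne'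
    field_simp
    ring
  -- With v = 𝒜[h]w and w = hu, the left-hand side is ∫ (∂ₓv w − v ∂ₓw) = −2 ∫ v ∂ₓw after
  -- integration by parts.
  have key := integral_layerDot_mul (μ := μ) hF hh hh.1.deriv hu hu.deriv
  rw [← dv] at key
  have i1 : Integrable fun x => deriv (layerA F μ h fun y => h y * u y) x * (h x * u x) :=
    HInf.mul_integrable hv.deriv hw
  have i2 : Integrable fun x => layerA F μ h (fun y => h y * u y) x *
      deriv (fun y => h y * u y) x := HInf.mul_integrable hv hw.deriv
  have i3 : Integrable fun x => layerA F μ h (fun y => h y * u y) x * (h x * u x) :=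
    HInf.mul_integrable hv hw
  have ibp := integral_mul_deriv_eq_deriv_mul_of_integrable
    (u := layerA F μ h fun y => h y * u y) (v := fun y => h y * u y)
    (fun x _ => ((hv.1.differentiable (by simp)) x).hasDerivAt)
    (fun x _ => ((hw.1.differentiable (by simp)) x).hasDerivAt) i2 i1 i3
  have i2' := i2
  rw [dw] at i2'
  rw [integral_sub i1 i2', ← neg_eq_iff_eq_neg.2 ibp] at key
  rw [dw] at key ⊢
  have e3 : ∫ x, deriv h x * (1 / 2 * u x ^ 2 - μ * layerR F μ h u x) =
      -(1 / 2) * ∫ x, deriv h x * (-u x ^ 2 + 2 * μ * layerR F μ h u x) := by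
    rw [← integral_const_mul]
    refine integral_congr_ae (Eventually.of_forall fun x => ?_)
    ring
  rw [e3, ← key]
  ring

end

section

/-! ### Existence for quadratic forms -/

/-- Multiplication by a bounded function on `L²`. -/
def mulCLM (𝕜 : Type) [RCLike 𝕜] {a : ℝ → 𝕜} (ha : MemLp a ∞ (volume : Measure ℝ)) :
    Lp 𝕜 2 (volume : Measure ℝ) →L[𝕜] Lp 𝕜 2 (volume : Measure ℝ) :=
  (ContinuousLinearMap.mul 𝕜 𝕜).holderL volume ∞ 2 2 (ha.toLp a)

theorem coeFn_mulCLM (𝕜 : Type) [RCLike 𝕜] {a : ℝ → 𝕜} (ha : MemLp a ∞ (volume : Measure ℝ))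
    (f : Lp 𝕜 2 (volume : Measure ℝ)) : mulCLM 𝕜 ha f =ᵐ[volume] fun x => a x * f x := by
  filter_upwards [(ContinuousLinearMap.mul 𝕜 𝕜).coeFn_holder (r := 2) (ha.toLp a) f,
    ha.coeFn_toLp] with x h1 h2
  change ((ContinuousLinearMap.mul 𝕜 𝕜).holder 2 (ha.toLp a) f) x = _
  rw [h1, h2]
  rfl

/-- The complexification of `L²(ℝ, ℝ)`. -/
def complexify : Lp ℝ 2 (volume : Measure ℝ) →L[ℝ] Lp ℂ 2 (volume : Measure ℝ) :=
  Complex.ofRealCLM.compLpL 2 volume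

theorem coeFn_complexify (f : Lp ℝ 2 (volume : Measure ℝ)) :
    complexify f =ᵐ[volume] fun x => (f x : ℂ) :=
  Complex.ofRealCLM.coeFn_compLpL f

theorem ftr_coe (f : Lp ℝ 2 (volume : Measure ℝ)) :
    ftr f = (𝓕 (complexify f) : Lp ℂ 2 (volume : Measure ℝ)) := by
  have h := memLp_ofReal_iff.2 (Lp.memLp f)
  rw [ftr_eq h, show h.toLp _ = complexify f from Lp.ext (h.coeFn_toLp.trans (coeFn_complexify f).symm)]

theorem memLp_top_of_norm_le {𝕜 : Type} [RCLike 𝕜] {a : ℝ → 𝕜} (ha : Measurable a) (C : ℝ)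
    (h : ∀ x, ‖a x‖ ≤ C) : MemLp a ∞ (volume : Measure ℝ) :=
  memLp_top_of_bound ha.aestronglyMeasurable C (Eventually.of_forall h)

/-- The graph of a Fourier multiplier in `L² × L²` is the kernel of a continuous linear map. -/
theorem exists_graph_map {m : ℝ → ℂ} (hm : Measurable m) :
    ∃ N D : Lp ℝ 2 (volume : Measure ℝ) →L[ℝ] Lp ℂ 2 (volume : Measure ℝ),
      ∀ f g : Lp ℝ 2 (volume : Measure ℝ), MultiplierRel m f g ↔ N g = D f := by
  have hpos : ∀ ξ, 0 < 1 + ‖m ξ‖ := fun ξ => by positivity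
  -- The relation ĝ = m f̂ is divided by 1 + |m|, which makes both coefficients bounded even when m
  -- is not.
  have ha : MemLp (fun ξ => (((1 + ‖m ξ‖)⁻¹ : ℝ) : ℂ)) ∞ (volume : Measure ℝ) := by
    refine memLp_top_of_norm_le (Complex.measurable_ofReal.comp
      (measurable_const.add hm.norm).inv) 1 fun ξ => ?_
    rw [Complex.norm_real, Real.norm_of_nonneg (inv_nonneg.2 (hpos ξ).le)]
    exact inv_le_one_of_one_le₀ (by linarith [norm_nonneg (m ξ)])
  have hb : MemLp (fun ξ => (((1 + ‖m ξ‖)⁻¹ : ℝ) : ℂ) * m ξ) ∞ (volume : Measure ℝ) := by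
    refine memLp_top_of_norm_le ((Complex.measurable_ofReal.comp
      (measurable_const.add hm.norm).inv).mul hm) 1 fun ξ => ?_
    rw [norm_mul, Complex.norm_real, Real.norm_of_nonneg (inv_nonneg.2 (hpos ξ).le),
      inv_mul_le_one₀ (hpos ξ)]
    linarith
  let T : Lp ℝ 2 (volume : Measure ℝ) →L[ℝ] Lp ℂ 2 (volume : Measure ℝ) :=
    ((Lp.fourierTransformₗᵢ ℝ ℂ).toContinuousLinearEquiv.toContinuousLinearMap.restrictScalars
      ℝ).comp complexify
  have hT : ∀ f, (T f : ℝ → ℂ) = ftr f := fun f => (ftr_coe f).symm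
  refine ⟨((mulCLM ℂ ha).restrictScalars ℝ).comp T, ((mulCLM ℂ hb).restrictScalars ℝ).comp T,
    fun f g => ?_⟩
  rw [multiplierRel_iff]
  have h1 := coeFn_mulCLM ℂ ha (T g)
  have h2 := coeFn_mulCLM ℂ hb (T f)
  rw [hT] at h1 h2
  have hne : ∀ ξ, (((1 + ‖m ξ‖)⁻¹ : ℝ) : ℂ) ≠ 0 := fun ξ => by
    exact_mod_cast (inv_pos.2 (hpos ξ)).ne'
  constructor
  · rintro ⟨_, _, h⟩
    refine Lp.ext ?_
    filter_upwards [h, h1, h2] with ξ e e1 e2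
    refine e1.trans (Eq.trans ?_ e2.symm)
    rw [e, mul_assoc]
  · intro h
    refine ⟨Lp.memLp f, Lp.memLp g, ?_⟩
    have h3 : (mulCLM ℂ ha (T g) : ℝ → ℂ) = mulCLM ℂ hb (T f) :=
      congrArg (fun z : Lp ℂ 2 (volume : Measure ℝ) => (z : ℝ → ℂ)) h
    filter_upwards [h1, h2] with ξ e1 e2
    rw [h3, e2, mul_assoc] at e1
    exact (mul_left_cancel₀ (hne ξ) e1).symm

/-- Measurable functions bounded above and away from zero. -/
def IsWeight (c : ℝ → ℝ) : Prop :=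
  Measurable c ∧ ∃ l > 0, ∃ u, ∀ x, l ≤ c x ∧ c x ≤ u

theorem IsWeight.pos {c : ℝ → ℝ} (hc : IsWeight c) (x : ℝ) : 0 < c x := by
  obtain ⟨l, hl, u, h⟩ := hc.2
  exact hl.trans_le (h x).1

theorem IsWeight.sqrt {c : ℝ → ℝ} (hc : IsWeight c) : IsWeight fun x => √(c x) := by
  obtain ⟨hm, l, hl, u, h⟩ := hc
  exact ⟨hm.sqrt, √l, Real.sqrt_pos.2 hl, √u, fun x =>
    ⟨Real.sqrt_le_sqrt (h x).1, Real.sqrt_le_sqrt (h x).2⟩⟩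

theorem IsWeight.inv {c : ℝ → ℝ} (hc : IsWeight c) : IsWeight fun x => (c x)⁻¹ := by
  have hp := hc.pos
  obtain ⟨hm, l, hl, u, h⟩ := hc
  have hu : 0 < u := (hp 0).trans_le (h 0).2
  exact ⟨hm.inv, u⁻¹, inv_pos.2 hu, l⁻¹, fun x =>
    ⟨inv_anti₀ (hp x) (h x).2, inv_anti₀ hl (h x).1⟩⟩

theorem IsWeight.memLp_top {c : ℝ → ℝ} (hc : IsWeight c) : MemLp c ∞ (volume : Measure ℝ) := by
  have hp := hc.pos
  obtain ⟨hm, l, hl, u, h⟩ := hc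
  exact memLp_top_of_norm_le hm u fun x => by
    rw [Real.norm_of_nonneg (hp x).le]; exact (h x).2

theorem memLp_mul_top {a f : ℝ → ℝ} (ha : MemLp a ∞ volume) (hf : MemLp f 2 volume) :
    MemLp (fun x => a x * f x) 2 volume := hf.mul' ha

/-- Weak solvability of `c w + ∑ eᵢ Tᵢ* dᵢ Tᵢ (eᵢ w) = v` for Fourier multipliers `Tᵢ`, in the
maximal form domain. -/
theorem exists_weak_solution {ι : Type} [Fintype ι] {c : ℝ → ℝ} {d e : ι → ℝ → ℝ}
    {m : ι → ℝ → ℂ} (hc : IsWeight c) (hd : ∀ i, IsWeight (d i))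
    (he : ∀ i, MemLp (e i) ∞ (volume : Measure ℝ)) (hm : ∀ i, Measurable (m i)) {v : ℝ → ℝ}
    (hv : MemLp v 2 volume) :
    ∃ (w : ℝ → ℝ) (g : ι → ℝ → ℝ), MemLp w 2 volume ∧
      (∀ i, MultiplierRel (m i) (fun x => e i x * w x) (g i)) ∧
      ∀ (w' : ℝ → ℝ) (g' : ι → ℝ → ℝ), MemLp w' 2 volume →
        (∀ i, MultiplierRel (m i) (fun x => e i x * w' x) (g' i)) →
        (∫ x, c x * w x * w' x) + ∑ i, ∫ x, d i x * g i x * g' i x = ∫ x, v x * w' x := by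
  choose N D hND using fun i => exists_graph_map (hm i)
  set L := Lp ℝ 2 (volume : Measure ℝ)
  let H := PiLp 2 fun _ : Option ι => L
  -- The unknowns are rescaled to √c w and √dᵢ gᵢ, so that the form becomes the standard inner
  -- product of a finite power of L².
  have hc' := hc.sqrt.inv
  have hd' := fun i => (hd i).sqrt.inv
  have hA : ∀ i, MemLp (fun x => e i x * (√(c x))⁻¹) ∞ (volume : Measure ℝ) := fun i =>
    hc'.memLp_top.mul' (he i)
  let Λ : ∀ i : ι, H →L[ℝ] Lp ℂ 2 (volume : Measure ℝ) := fun i =>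
    ((N i).comp (mulCLM ℝ (hd' i).memLp_top)).comp (PiLp.proj 2 (fun _ : Option ι => L) (some i)) -
    ((D i).comp (mulCLM ℝ (hA i))).comp (PiLp.proj 2 (fun _ : Option ι => L) none)
  -- The rescaled graph: closed, as an intersection of kernels of continuous maps, hence complete.
  let S : Submodule ℝ H := ⨅ i, LinearMap.ker (Λ i).toLinearMap
  have hS : IsClosed (S : Set H) := by
    rw [Submodule.coe_iInf]
    exact isClosed_iInter fun i => (Λ i).isClosed_ker
  have : CompleteSpace S := hS.completeSpace_coe
  have hmem : ∀ z : H, z ∈ S ↔ ∀ i, MultiplierRel (m i) (fun x => e i x * ((√(c x))⁻¹ * z none x))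
      (fun x => (√(d i x))⁻¹ * z (some i) x) := by
    intro z
    have e1 : ∀ i, (mulCLM ℝ (hA i) (z none) : ℝ → ℝ) =ᵐ[volume]
        fun x => e i x * ((√(c x))⁻¹ * z none x) := fun i => by
      filter_upwards [coeFn_mulCLM ℝ (hA i) (z none)] with x hx
      rw [hx, mul_assoc]
    have e2 : ∀ i, (mulCLM ℝ (hd' i).memLp_top (z (some i)) : ℝ → ℝ) =ᵐ[volume]
        fun x => (√(d i x))⁻¹ * z (some i) x := fun i => coeFn_mulCLM ℝ _ _
    have e3 : ∀ i, Λ i z = 0 ↔ MultiplierRel (m i) (mulCLM ℝ (hA i) (z none))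
        (mulCLM ℝ (hd' i).memLp_top (z (some i))) := by
      intro i
      rw [hND]
      exact sub_eq_zero
    simp only [S, Submodule.mem_iInf, LinearMap.mem_ker]
    refine forall_congr' fun i => (e3 i).trans ⟨fun h => h.congr (e1 i) (e2 i),
      fun h => h.congr (e1 i).symm (e2 i).symm⟩
  have hvc : MemLp (fun x => (√(c x))⁻¹ * v x) 2 volume := memLp_mul_top hc'.memLp_top hv
  -- The functional w' ↦ ∫ vw' is the inner product with (v/√c, 0). Its Riesz representative in S is
  -- the orthogonal projection of this vector.
  let ζ : H := WithLp.toLp 2 fun k => Option.elim k (hvc.toLp _) fun _ => 0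
  let z : H := S.starProjection ζ
  have hz : z ∈ S := S.starProjection_apply_mem ζ
  have horth : ∀ z' ∈ S, inner ℝ z z' = inner ℝ ζ z' := by
    intro z' hz'
    have := S.starProjection_inner_eq_zero ζ z' hz'
    rw [inner_sub_left, sub_eq_zero] at this
    exact this.symm
  have hin : ∀ f g : L, inner ℝ f g = ∫ x, f x * g x := by
    intro f g
    rw [L2.inner_def]
    exact integral_congr_ae (Eventually.of_forall fun x => by simp [mul_comm])
  refine ⟨fun x => (√(c x))⁻¹ * z none x, fun i x => (√(d i x))⁻¹ * z (some i) x,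
    memLp_mul_top hc'.memLp_top (Lp.memLp _), (hmem z).1 hz, fun w' g' hw' hg' => ?_⟩
  have hg2 : ∀ i, MemLp (g' i) 2 volume := fun i => (multiplierRel_iff.1 (hg' i)).2.1
  have hw2 : MemLp (fun x => √(c x) * w' x) 2 volume := memLp_mul_top hc.sqrt.memLp_top hw'
  have hg3 : ∀ i, MemLp (fun x => √(d i x) * g' i x) 2 volume := fun i =>
    memLp_mul_top (hd i).sqrt.memLp_top (hg2 i)
  let z' : H := WithLp.toLp 2 fun k => Option.elim k (hw2.toLp _) fun i => (hg3 i).toLp _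
  have z'none : z' none = hw2.toLp _ := rfl
  have z'some : ∀ i, z' (some i) = (hg3 i).toLp _ := fun i => rfl
  have hcne : ∀ x, √(c x) ≠ 0 := fun x => (hc.sqrt.pos x).ne'
  have hdne : ∀ i x, √(d i x) ≠ 0 := fun i x => ((hd i).sqrt.pos x).ne'
  have hz' : z' ∈ S := by
    rw [hmem]
    refine fun i => (hg' i).congr ?_ ?_
    · filter_upwards [hw2.coeFn_toLp] with x hx
      rw [z'none, hx, inv_mul_cancel_left₀ (hcne x)]
    · filter_upwards [(hg3 i).coeFn_toLp] with x hx
      rw [z'some, hx, inv_mul_cancel_left₀ (hdne i x)]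
  have key := horth z' hz'
  rw [PiLp.inner_apply, PiLp.inner_apply, Fintype.sum_option, Fintype.sum_option] at key
  simp only [hin] at key
  have k1 : ∫ x, z none x * z' none x = ∫ x, c x * ((√(c x))⁻¹ * z none x) * w' x := by
    refine integral_congr_ae ?_
    filter_upwards [hw2.coeFn_toLp] with x hx
    rw [z'none, hx]
    have := Real.mul_self_sqrt (hc.pos x).le
    have h0 := hcne x
    field_simp
    rw [sq, this]
    ring
  have k2 : ∀ i, ∫ x, z (some i) x * z' (some i) x =
      ∫ x, d i x * ((√(d i x))⁻¹ * z (some i) x) * g' i x := by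
    intro i
    refine integral_congr_ae ?_
    filter_upwards [(hg3 i).coeFn_toLp] with x hx
    rw [z'some, hx]
    have := Real.mul_self_sqrt ((hd i).pos x).le
    have h0 := hdne i x
    field_simp
    rw [sq, this]
    ring
  have k3 : ∫ x, ζ none x * z' none x = ∫ x, v x * w' x := by
    refine integral_congr_ae ?_
    filter_upwards [hw2.coeFn_toLp, hvc.coeFn_toLp] with x hx hy
    have : (ζ none : ℝ → ℝ) x = (√(c x))⁻¹ * v x := hy
    rw [z'none, hx, this]
    have h0 := hcne x
    field_simp
  have k4 : ∀ i, ∫ x, ζ (some i) x * z' (some i) x = 0 := by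
    intro i
    refine integral_eq_zero_of_ae ?_
    filter_upwards [Lp.coeFn_zero ℝ 2 (volume : Measure ℝ)] with x hx
    have : (ζ (some i) : ℝ → ℝ) x = 0 := hx
    rw [this]
    simp
  simp only [k1, k2, k3, k4, Finset.sum_const_zero, add_zero] at key
  exact key

end

/-! ### Coercive forms, their inverses, and how the inverses vary -/

section

/-- Symmetric, coercive and (weakly) solvable quadratic forms on a domain in `L²`. -/
structure CoerciveForm (D : (ℝ → ℝ) → Prop) (q : (ℝ → ℝ) → (ℝ → ℝ) → ℝ) (κ : ℝ) : Prop where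
  pos : 0 < κ
  memLp : ∀ {w}, D w → MemLp w 2 volume
  mem : ∀ {w w'} (c : ℝ), D w → D w' → D fun x => w x + c * w' x
  symm : ∀ {w w'}, D w → D w' → q w w' = q w' w
  lin : ∀ {w w' z} (c : ℝ), D w → D w' → D z → q (fun x => w x + c * w' x) z = q w z + c * q w' z
  coercive : ∀ {w}, D w → κ * ∫ x, w x ^ 2 ≤ q w w
  exists_sol : ∀ {v}, MemLp v 2 volume → ∃ w, IsFormSol D q v w

namespace CoerciveForm

variable {D : (ℝ → ℝ) → Prop} {q : (ℝ → ℝ) → (ℝ → ℝ) → ℝ} {κ : ℝ}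

theorem sol_lin (hq : CoerciveForm D q κ) {v v' w w' : ℝ → ℝ} (c : ℝ) (hv : MemLp v 2 volume)
    (hv' : MemLp v' 2 volume) (h : IsFormSol D q v w) (h' : IsFormSol D q v' w') :
    IsFormSol D q (fun x => v x + c * v' x) fun x => w x + c * w' x := by
  refine ⟨hq.mem c h.1 h'.1, fun z hz => ?_⟩
  have i1 : Integrable fun x => v x * z x := hv.integrable_mul (hq.memLp hz)
  have i2 : Integrable fun x => v' x * z x := hv'.integrable_mul (hq.memLp hz)
  rw [hq.lin c h.1 h'.1 hz, h.2 z hz, h'.2 z hz, ← integral_const_mul,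
    ← integral_add i1 (i2.const_mul c)]
  exact integral_congr_ae (Eventually.of_forall fun x => by ring)

/-- Testing the equation with w itself gives κ‖w‖² ≤ ∫ vw; Young's inequality ∫ vw ≤ κ⁻¹‖v‖²/2 +
κ‖w‖²/2 then absorbs the last term. The upper bound makes the remainder quadratic in
`hasDerivAt_integral_mul_formInv_param`. -/
theorem sol_bound (hq : CoerciveForm D q κ) {v w : ℝ → ℝ} (hv : MemLp v 2 volume)
    (h : IsFormSol D q v w) :
    0 ≤ ∫ x, v x * w x ∧ κ * ∫ x, w x ^ 2 ≤ ∫ x, v x * w x ∧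
      ∫ x, v x * w x ≤ κ⁻¹ * ∫ x, v x ^ 2 := by
  have h1 := hq.coercive h.1
  rw [h.2 w h.1] at h1
  have hw := hq.memLp h.1
  have i0 : Integrable fun x => v x * w x := hv.integrable_mul hw
  have i1 := hv.integrable_sq
  have i2 := hw.integrable_sq
  have h0 : 0 ≤ ∫ x, w x ^ 2 := integral_nonneg fun x => sq_nonneg _
  have h2 : ∫ x, v x * w x ≤ ∫ x, (κ⁻¹ / 2 * v x ^ 2 + κ / 2 * w x ^ 2) := by
    refine integral_mono i0 ((i1.const_mul _).add (i2.const_mul _)) fun x => ?_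
    have hk := hq.pos
    have e : κ⁻¹ / 2 * v x ^ 2 + κ / 2 * w x ^ 2 - v x * w x =
        κ⁻¹ / 2 * (v x - κ * w x) ^ 2 := by
      field_simp
      ring
    have : 0 ≤ κ⁻¹ / 2 * (v x - κ * w x) ^ 2 := by positivity
    simp only
    linarith
  rw [integral_add (i1.const_mul _) (i2.const_mul _), integral_const_mul, integral_const_mul] at h2
  have := mul_nonneg hq.pos.le h0
  exact ⟨by linarith, h1, by linarith⟩

theorem sol_unique (hq : CoerciveForm D q κ) {v w w' : ℝ → ℝ} (hv : MemLp v 2 volume)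
    (h : IsFormSol D q v w) (h' : IsFormSol D q v w') : w' =ᵐ[volume] w := by
  have h1 := hq.sol_lin (-1) hv hv h' h
  have hd := hq.memLp h1.1
  have hv0 : MemLp (fun x => v x + -1 * v x) 2 volume := hv.add (hv.const_mul _)
  have h2 := hq.sol_bound hv0 h1
  have e0 : ∫ x, (v x + -1 * v x) * (w' x + -1 * w x) = 0 :=
    integral_eq_zero_of_ae (Eventually.of_forall fun x => by simp)
  rw [e0] at h2
  have h3 : ∫ x, (w' x + -1 * w x) ^ 2 = 0 := by
    refine le_antisymm ?_ (integral_nonneg fun x => sq_nonneg _)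
    by_contra hcon
    push Not at hcon
    have := mul_pos hq.pos hcon
    linarith [h2.2.1]
  rw [integral_eq_zero_iff_of_nonneg (fun x => sq_nonneg _) hd.integrable_sq] at h3
  filter_upwards [h3] with x hx
  have hx' : (w' x + -1 * w x) ^ 2 = 0 := hx
  have := pow_eq_zero_iff (two_ne_zero) |>.1 hx'
  linarith

theorem existsUnique_ae (hq : CoerciveForm D q κ) {v : ℝ → ℝ} (hv : MemLp v 2 volume) :
    ∃ w, IsFormSol D q v w ∧ ∀ w', IsFormSol D q v w' → w' =ᵐ[volume] w := by
  obtain ⟨w, hw⟩ := hq.exists_sol hv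
  exact ⟨w, hw, fun w' hw' => hq.sol_unique hv hw hw'⟩

theorem isFormSol_formInv (hq : CoerciveForm D q κ) {v : ℝ → ℝ} (hv : MemLp v 2 volume) :
    IsFormSol D q v (formInv D q v) := by
  have h := hq.exists_sol hv
  have e : formInv D q v = h.choose := dif_pos h
  rw [e]
  exact h.choose_spec

theorem formInv_ae_eq (hq : CoerciveForm D q κ) {v w : ℝ → ℝ} (hv : MemLp v 2 volume)
    (h : IsFormSol D q v w) : formInv D q v =ᵐ[volume] w :=
  hq.sol_unique hv h (hq.isFormSol_formInv hv)

theorem integrable_mul_formInv (hq : CoerciveForm D q κ) {v : ℝ → ℝ} (hv : MemLp v 2 volume) :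
    Integrable fun x => v x * formInv D q v x :=
  hv.integrable_mul (hq.memLp (hq.isFormSol_formInv hv).1)

/-- Expansion of the quadratic functional `⟨v, 𝒜⁻¹v⟩`. -/
theorem integral_add_mul_formInv (hq : CoerciveForm D q κ) {v φ w : ℝ → ℝ} (c : ℝ)
    (hv : MemLp v 2 volume) (hφ : MemLp φ 2 volume) (h : IsFormSol D q v w) :
    ∫ x, (v x + c * φ x) * formInv D q (fun y => v y + c * φ y) x =
      (∫ x, v x * w x) + 2 * c * (∫ x, w x * φ x)
        + c ^ 2 * ∫ x, φ x * formInv D q φ x := by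
  have hs : MemLp (fun x => v x + c * φ x) 2 volume := hv.add (hφ.const_mul c)
  set z := formInv D q φ
  have hz : IsFormSol D q φ z := hq.isFormSol_formInv hφ
  have h1 := hq.sol_lin c hv hφ h hz
  have hw := hq.memLp h.1
  have hz2 := hq.memLp hz.1
  have e0 : ∫ x, (v x + c * φ x) * formInv D q (fun y => v y + c * φ y) x =
      ∫ x, ((v x * w x + c * (φ x * w x)) + c * (v x * z x) + c ^ 2 * (φ x * z x)) := by
    refine integral_congr_ae ?_
    filter_upwards [hq.formInv_ae_eq hs h1] with x hx
    rw [hx]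
    ring
  have i1 : Integrable fun x => v x * w x := hv.integrable_mul hw
  have i2 : Integrable fun x => φ x * w x := hφ.integrable_mul hw
  have i3 : Integrable fun x => v x * z x := hv.integrable_mul hz2
  have i4 : Integrable fun x => φ x * z x := hφ.integrable_mul hz2
  have j1 : Integrable fun x => v x * w x + c * (φ x * w x) := i1.add (i2.const_mul c)
  have j2 : Integrable fun x => v x * w x + c * (φ x * w x) + c * (v x * z x) :=
    j1.add (i3.const_mul c)
  -- Symmetry of the form: the two cross terms are equal.
  have e1 : ∫ x, v x * z x = ∫ x, φ x * w x := by
    rw [← h.2 z hz.1, hq.symm h.1 hz.1, hz.2 w h.1]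
  have e2 : ∫ x, w x * φ x = ∫ x, φ x * w x :=
    integral_congr_ae (Eventually.of_forall fun x => mul_comm _ _)
  rw [e0, integral_add j2 (i4.const_mul _), integral_add j1 (i3.const_mul _),
    integral_add i1 (i2.const_mul _), integral_const_mul, integral_const_mul, integral_const_mul,
    e1, e2]
  ring

theorem integral_mul_formInv (hq : CoerciveForm D q κ) {v w : ℝ → ℝ} (hv : MemLp v 2 volume)
    (h : IsFormSol D q v w) : ∫ x, v x * formInv D q v x = ∫ x, v x * w x := by
  refine integral_congr_ae ?_
  filter_upwards [hq.formInv_ae_eq hv h] with x hx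
  rw [hx]

theorem hasDerivAt_integral_mul_formInv (hq : CoerciveForm D q κ) {v φ w : ℝ → ℝ}
    (hv : MemLp v 2 volume) (hφ : MemLp φ 2 volume) (h : IsFormSol D q v w) :
    HasDerivAt (fun s : ℝ => ∫ x, (v x + s * φ x) * formInv D q (fun y => v y + s * φ y) x)
      (2 * ∫ x, w x * φ x) 0 := by
  simp only [hq.integral_add_mul_formInv _ hv hφ h]
  have h1 : HasDerivAt (fun s : ℝ => (∫ x, v x * w x) + 2 * s * (∫ x, w x * φ x)
      + s ^ 2 * ∫ x, φ x * formInv D q φ x) (0 + 2 * 1 * (∫ x, w x * φ x)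
      + (2 : ℕ) * (0 : ℝ) ^ (2 - 1) * 1 * ∫ x, φ x * formInv D q φ x) 0 :=
    ((hasDerivAt_const _ _).add (((hasDerivAt_id (0 : ℝ)).const_mul 2).mul_const _)).add
      (((hasDerivAt_id (0 : ℝ)).pow 2).mul_const _)
  convert! h1 using 1
  simp

end CoerciveForm

/-- Dependence of `⟨v, 𝒜⁻¹v⟩` on the operator, at a smooth solution: only the variation of `𝒜w`
with `w` fixed matters, although the form domains may vary. -/
theorem hasDerivAt_integral_mul_formInv_param {D : ℝ → (ℝ → ℝ) → Prop}
    {q : ℝ → (ℝ → ℝ) → (ℝ → ℝ) → ℝ} {κ : ℝ} {b : ℝ → ℝ → ℝ} {b' w : ℝ → ℝ}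
    (hq : ∀ᶠ s in 𝓝 (0 : ℝ), CoerciveForm (D s) (q s) κ) (hw : HInf w)
    (hb : SmDeriv 2 Set.univ 0 b b')
    (hsol : ∀ᶠ s in 𝓝 (0 : ℝ), HInf (b s) ∧ IsFormSol (D s) (q s) (b s) w) :
    HasDerivAt (fun s => ∫ x, b 0 x * formInv (D s) (q s) (b 0) x) (-∫ x, b' x * w x) 0 := by
  set E : ℝ → ℝ := fun s => ∫ x, (b 0 x - b s x) * formInv (D s) (q s) (fun y => b 0 y - b s y) x
    with hE
  have hb0 : HInf (b 0) := hb.1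
  -- The quadratic functional is expanded at b s, where the inverse is known to be w, and not at b
  -- 0. The inverse at b 0 then enters only through the quadratic remainder E.
  have hexp : ∀ᶠ s in 𝓝 (0 : ℝ), ∫ x, b 0 x * formInv (D s) (q s) (b 0) x =
      2 * (∫ x, b 0 x * w x) - (∫ x, b s x * w x) + E s := by
    filter_upwards [hq, hsol] with s h1 h2
    have hr : HInf fun x => b 0 x - b s x := Sm.sub hb0 h2.1
    have h3 := h1.integral_add_mul_formInv 1 h2.1.memLp hr.memLp h2.2
    have e1 : (fun x => b s x + 1 * (b 0 x - b s x)) = b 0 := by ext x; ring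
    have e2 : ∀ x, b s x + 1 * (b 0 x - b s x) = b 0 x := congrFun e1
    rw [e1] at h3
    simp only [e2] at h3
    rw [h3]
    have i1 : Integrable fun x => b 0 x * w x := HInf.mul_integrable hb0 hw
    have i2 : Integrable fun x => b s x * w x := HInf.mul_integrable h2.1 hw
    have e3 : ∫ x, w x * (b 0 x - b s x) = (∫ x, b 0 x * w x) - ∫ x, b s x * w x := by
      rw [← integral_sub i1 i2]
      exact integral_congr_ae (Eventually.of_forall fun x => by ring)
    rw [e3]
    simp only [hE]
    ring
  have hd1 : HasDerivAt (fun s => ∫ x, b s x * w x) (∫ x, b' x * w x) 0 := by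
    rw [← hasDerivWithinAt_univ]
    have h1 : SmDeriv 1 Set.univ 0 _ _ := hb.mul (SmDeriv.const (p := 2) hw)
    simpa using h1.hasDerivWithinAt_integral
  -- By coercivity, |E s / s| is at most κ⁻¹ |s| times the squared L² norm of the difference
  -- quotient of b, which converges.
  have hEd : HasDerivAt E 0 0 := by
    rw [← hasDerivWithinAt_univ, hasDerivWithinAt_iff_tendsto_slope]
    have h1 : SmTo 1 (𝓝[Set.univ \ {(0 : ℝ)}] 0) _ _ := hb.2.mul hb.2
    have h2 := (h1.tendsto_integral.mul (tendsto_sub_punctured (I := Set.univ) (t := 0)).abs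
      ).const_mul κ⁻¹
    simp only [abs_zero, mul_zero] at h2
    refine squeeze_zero_norm' ?_ h2
    have hq' : ∀ᶠ s in 𝓝[Set.univ \ {(0 : ℝ)}] 0, CoerciveForm (D s) (q s) κ :=
      nhdsWithin_le_nhds hq
    have hsol' : ∀ᶠ s in 𝓝[Set.univ \ {(0 : ℝ)}] 0, HInf (b s) ∧
      IsFormSol (D s) (q s) (b s) w := nhdsWithin_le_nhds hsol
    have hE0 : E 0 = 0 := by simp [hE]
    filter_upwards [hq', hsol', eventually_ne_of_punctured] with s h3 h4 h5
    have hr : HInf fun x => b 0 x - b s x := Sm.sub hb0 h4.1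
    have h6 := h3.sol_bound hr.memLp (h3.isFormSol_formInv hr.memLp)
    rw [slope_def_field, hE0, sub_zero, sub_zero, Real.norm_eq_abs, abs_div,
      abs_of_nonneg h6.1, div_le_iff₀ (by simpa using h5.2)]
    refine h6.2.2.trans (le_of_eq ?_)
    have h7 := h5.2
    rw [sub_zero] at h7
    rw [mul_assoc, mul_assoc, ← sq, sq_abs]
    congr 1
    rw [← integral_mul_const]
    refine integral_congr_ae (Eventually.of_forall fun x => ?_)
    simp only
    field_simp
    ring
  have hmain : HasDerivAt (fun s => 2 * (∫ x, b 0 x * w x) - (∫ x, b s x * w x) + E s)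
      (0 - (∫ x, b' x * w x) + 0) 0 :=
    ((hasDerivAt_const _ _).sub hd1).add hEd
  rw [zero_sub, add_zero] at hmain
  exact hmain.congr_of_eventuallyEq hexp

end

/-! ### The forms of one layer and of two layers -/

section

theorem Sm.exists_bound {f : ℝ → ℝ} (hf : Sm ∞ f) : ∃ C, ∀ x, |f x| ≤ C := by
  refine ⟨(eLpNorm f ∞ volume).toReal, fun x => ?_⟩
  have h := enorm_le_eLpNorm_top hf.1.continuous x
  have := ENNReal.toReal_mono hf.memLp.eLpNorm_ne_top h
  simpa using this

theorem Depth.isWeight {h : ℝ → ℝ} (hh : Depth h) : IsWeight h := by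
  obtain ⟨C, hC⟩ := hh.1.exists_bound
  obtain ⟨c, hc, hl⟩ := hh.2
  exact ⟨hh.1.1.continuous.measurable, c, hc, C, fun x => ⟨hl x, (le_abs_self _).trans (hC x)⟩⟩

theorem IsWeight.add {c d : ℝ → ℝ} (hc : IsWeight c) (hd : IsWeight d) :
    IsWeight fun x => c x + d x := by
  obtain ⟨hm, l, hl, u, h⟩ := hc
  obtain ⟨hm', l', hl', u', h'⟩ := hd
  exact ⟨hm.add hm', l + l', by positivity, u + u', fun x =>
    ⟨add_le_add (h x).1 (h' x).1, add_le_add (h x).2 (h' x).2⟩⟩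

theorem IsWeight.const_mul {c : ℝ → ℝ} {a : ℝ} (ha : 0 < a) (hc : IsWeight c) :
    IsWeight fun x => a * c x := by
  obtain ⟨hm, l, hl, u, h⟩ := hc
  exact ⟨hm.const_mul a, a * l, by positivity, a * u, fun x =>
    ⟨mul_le_mul_of_nonneg_left (h x).1 ha.le, mul_le_mul_of_nonneg_left (h x).2 ha.le⟩⟩

theorem IsWeight.cube {c : ℝ → ℝ} (hc : IsWeight c) : IsWeight fun x => c x ^ 3 := by
  have hp := hc.pos
  obtain ⟨hm, l, hl, u, h⟩ := hc
  exact ⟨hm.pow_const 3, l ^ 3, by positivity, u ^ 3, fun x =>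
    ⟨pow_le_pow_left₀ hl.le (h x).1 3, pow_le_pow_left₀ (hp x).le (h x).2 3⟩⟩

section Layer

variable {F : ℝ → ℝ} {μ : ℝ} {h : ℝ → ℝ}

theorem LayerDom.dmul {w : ℝ → ℝ} (hw : LayerDom F μ h w) :
    MultiplierRel (symbD F μ) (fun x => (h x)⁻¹ * w x) (dmul F μ fun x => (h x)⁻¹ * w x) :=
  multiplierRel_dmul μ hw.2

/-- The representative chosen by `dmul` matters only up to null sets, so any witness of the
multiplier relation computes the form. -/
theorem layerForm_eq_of_rel (hh : Depth h) {w w' g g' : ℝ → ℝ} (hw : MemLp w 2 volume)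
    (hw' : MemLp w' 2 volume) (hg : MultiplierRel (symbD F μ) (fun x => (h x)⁻¹ * w x) g)
    (hg' : MultiplierRel (symbD F μ) (fun x => (h x)⁻¹ * w' x) g') :
    layerForm F μ h w w' =
      (∫ x, (h x)⁻¹ * w x * w' x) + ∫ x, μ / 3 * h x ^ 3 * g x * g' x := by
  have m1 := (multiplierRel_iff.1 hg).2.1
  have m2 := (multiplierRel_iff.1 hg').2.1
  have i1 : Integrable fun x => (h x)⁻¹ * w x * w' x :=
    (memLp_mul_top hh.inv.memLp hw).integrable_mul hw'
  have hb : MemLp (fun x => μ / 3 * h x ^ 3) ∞ (volume : Measure ℝ) :=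
    hh.isWeight.cube.memLp_top.const_mul (μ / 3)
  have i2 : Integrable fun x => μ / 3 * h x ^ 3 * g x * g' x :=
    (memLp_mul_top hb m1).integrable_mul m2
  rw [← integral_add i1 i2]
  refine integral_congr_ae ?_
  filter_upwards [(multiplierRel_dmul μ ⟨g, hg⟩).ae_unique hg,
    (multiplierRel_dmul μ ⟨g', hg'⟩).ae_unique hg'] with x h1 h2
  rw [h1, h2]

theorem layerDom_add_const_mul {w w' : ℝ → ℝ} (c : ℝ) (hw : LayerDom F μ h w)
    (hw' : LayerDom F μ h w') :
    LayerDom F μ h (fun x => w x + c * w' x) ∧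
      MultiplierRel (symbD F μ) (fun x => (h x)⁻¹ * (w x + c * w' x)) fun x =>
        dmul F μ (fun x => (h x)⁻¹ * w x) x + c * dmul F μ (fun x => (h x)⁻¹ * w' x) x := by
  have h1 : MultiplierRel (symbD F μ) (fun x => (h x)⁻¹ * (w x + c * w' x)) fun x =>
        dmul F μ (fun x => (h x)⁻¹ * w x) x + c * dmul F μ (fun x => (h x)⁻¹ * w' x) x :=
    (hw.dmul.add (hw'.dmul.const_mul c)).congr
      (Eventually.of_forall fun x => by ring) EventuallyEq.rfl
  exact ⟨⟨hw.1.add (hw'.1.const_mul c), _, h1⟩, h1⟩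

theorem layerForm_lin (hh : Depth h) {w w' z : ℝ → ℝ} (c : ℝ) (hw : LayerDom F μ h w)
    (hw' : LayerDom F μ h w') (hz : LayerDom F μ h z) :
    layerForm F μ h (fun x => w x + c * w' x) z = layerForm F μ h w z + c * layerForm F μ h w' z := by
  have h1 := layerDom_add_const_mul c hw hw'
  have hb : MemLp (fun x => μ / 3 * h x ^ 3) ∞ (volume : Measure ℝ) :=
    hh.isWeight.cube.memLp_top.const_mul (μ / 3)
  have mz := (multiplierRel_iff.1 hz.dmul).2.1
  have i1 : ∀ {w}, LayerDom F μ h w → Integrable fun x => (h x)⁻¹ * w x * z x := fun hw =>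
    (memLp_mul_top hh.inv.memLp hw.1).integrable_mul hz.1
  have i2 : ∀ {w}, LayerDom F μ h w → Integrable fun x => μ / 3 * h x ^ 3 *
      dmul F μ (fun x => (h x)⁻¹ * w x) x * dmul F μ (fun x => (h x)⁻¹ * z x) x := fun hw =>
    (memLp_mul_top hb (multiplierRel_iff.1 hw.dmul).2.1).integrable_mul mz
  rw [layerForm_eq_of_rel hh h1.1.1 hz.1 h1.2 hz.dmul, layerForm_eq_of_rel hh hw.1 hz.1 hw.dmul
    hz.dmul, layerForm_eq_of_rel hh hw'.1 hz.1 hw'.dmul hz.dmul, mul_add, ← integral_const_mul,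
    ← integral_const_mul]
  have e1 : ∫ x, (h x)⁻¹ * (w x + c * w' x) * z x =
      (∫ x, (h x)⁻¹ * w x * z x) + ∫ x, c * ((h x)⁻¹ * w' x * z x) := by
    rw [← integral_add (i1 hw) ((i1 hw').const_mul c)]
    exact integral_congr_ae (Eventually.of_forall fun x => by ring)
  have e2 : ∫ x, μ / 3 * h x ^ 3 * (dmul F μ (fun x => (h x)⁻¹ * w x) x
      + c * dmul F μ (fun x => (h x)⁻¹ * w' x) x) * dmul F μ (fun x => (h x)⁻¹ * z x) x =
      (∫ x, μ / 3 * h x ^ 3 * dmul F μ (fun x => (h x)⁻¹ * w x) x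
        * dmul F μ (fun x => (h x)⁻¹ * z x) x) + ∫ x, c * (μ / 3 * h x ^ 3 *
          dmul F μ (fun x => (h x)⁻¹ * w' x) x * dmul F μ (fun x => (h x)⁻¹ * z x) x) := by
    rw [← integral_add (i2 hw) ((i2 hw').const_mul c)]
    exact integral_congr_ae (Eventually.of_forall fun x => by ring)
  rw [e1, e2]
  ring

theorem layerForm_symm {w w' : ℝ → ℝ} : layerForm F μ h w w' = layerForm F μ h w' w :=
  integral_congr_ae (Eventually.of_forall fun x => by ring)

theorem le_layerForm (hμ : 0 < μ) (hh : Depth h) {κ : ℝ} (hκ : ∀ x, κ ≤ (h x)⁻¹) {w : ℝ → ℝ}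
    (hw : LayerDom F μ h w) : κ * ∫ x, w x ^ 2 ≤ layerForm F μ h w w := by
  rw [layerForm_eq_of_rel hh hw.1 hw.1 hw.dmul hw.dmul, ← integral_const_mul]
  have i1 : Integrable fun x => (h x)⁻¹ * w x * w x :=
    (memLp_mul_top hh.inv.memLp hw.1).integrable_mul hw.1
  have h1 : ∫ x, κ * w x ^ 2 ≤ ∫ x, (h x)⁻¹ * w x * w x := by
    refine integral_mono (hw.1.integrable_sq.const_mul κ) i1 fun x => ?_
    have := mul_le_mul_of_nonneg_right (hκ x) (sq_nonneg (w x))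
    simp only
    nlinarith
  have h2 : 0 ≤ ∫ x, μ / 3 * h x ^ 3 * dmul F μ (fun x => (h x)⁻¹ * w x) x *
      dmul F μ (fun x => (h x)⁻¹ * w x) x := by
    refine integral_nonneg fun x => ?_
    have := hh.pos x
    have e : μ / 3 * h x ^ 3 * dmul F μ (fun x => (h x)⁻¹ * w x) x *
      dmul F μ (fun x => (h x)⁻¹ * w x) x =
      μ / 3 * h x ^ 3 * dmul F μ (fun x => (h x)⁻¹ * w x) x ^ 2 := by ring
    simp only [Pi.zero_apply]
    rw [e]
    positivity
  linarith

theorem coerciveForm_layer (hF : IsMultiplierFunction F) (hμ : 0 < μ) (hh : Depth h) {κ : ℝ}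
    (h0 : 0 < κ) (hκ : ∀ x, κ ≤ (h x)⁻¹) :
    CoerciveForm (LayerDom F μ h) (layerForm F μ h) κ where
  pos := h0
  memLp hw := hw.1
  mem c hw hw' := (layerDom_add_const_mul c hw hw').1
  symm _ _ := layerForm_symm
  lin c hw hw' hz := layerForm_lin hh c hw hw' hz
  coercive hw := le_layerForm hμ hh hκ hw
  exists_sol {v} hv := by
    obtain ⟨w, g, hw, hg, hs⟩ := exists_weak_solution (ι := Unit) (c := fun x => (h x)⁻¹)
      (d := fun _ x => μ / 3 * h x ^ 3) (e := fun _ x => (h x)⁻¹) (m := fun _ => symbD F μ)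
      hh.isWeight.inv (fun _ => hh.isWeight.cube.const_mul (by positivity))
      (fun _ => hh.inv.memLp) (fun _ => (hF.isSymbol_symbD μ).measurable) hv
    refine ⟨w, ⟨hw, _, hg ()⟩, fun w' hw' => ?_⟩
    have := hs w' (fun _ => GreenNaghdi.dmul F μ fun x => (h x)⁻¹ * w' x) hw'.1 fun _ => hw'.dmul
    rw [layerForm_eq_of_rel hh hw hw'.1 (hg ()) hw'.dmul, ← this]
    simp

theorem Depth.exists_le_inv (hh : Depth h) : ∃ κ > 0, ∀ x, κ ≤ (h x)⁻¹ := by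
  obtain ⟨_, l, hl, _, h1⟩ := hh.isWeight.inv
  exact ⟨l, hl, fun x => (h1 x).1⟩

theorem layerDom_of_hInf (hF : IsMultiplierFunction F) (hh : Depth h) {w : ℝ → ℝ} (hw : HInf w) :
    LayerDom F μ h w :=
  ⟨hw.memLp, _, multiplierRel_opT μ hF (hh.inv.top_mul hw)⟩

/-- T can be moved from the second argument onto h³T(h⁻¹w), which lies in H^∞. The function w'
ranges over the whole maximal domain, so no density argument is needed. -/
theorem layerForm_of_hInf (hF : IsMultiplierFunction F) (hh : Depth h) {w w' : ℝ → ℝ}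
    (hw : HInf w) (hw' : LayerDom F μ h w') :
    layerForm F μ h w w' = ∫ x, layerA F μ h w x * w' x := by
  have hu : HInf fun x => (h x)⁻¹ * w x := hh.inv.top_mul hw
  rw [layerForm_eq_of_rel hh hw.memLp hw'.1 (multiplierRel_opT μ hF hu) hw'.dmul]
  set k := opT F μ fun x => (h x)⁻¹ * w x with hk
  have kI : HInf k := hInf_opT μ hF hu
  have mI : HInf fun y => h y ^ 3 * k y := hh.cube_mul kI
  have key := integral_mul_multiplierRel (multiplierRel_opT μ hF mI) hw'.dmul
  have nI := hInf_opT μ hF mI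
  have i1 : Integrable fun x => (h x)⁻¹ * w x * w' x := hu.memLp.integrable_mul hw'.1
  have i2 : Integrable fun x => opT F μ (fun y => h y ^ 3 * k y) x * ((h x)⁻¹ * w' x) :=
    nI.memLp.integrable_mul (memLp_mul_top hh.inv.memLp hw'.1)
  have e1 : ∫ x, μ / 3 * h x ^ 3 * k x * dmul F μ (fun x => (h x)⁻¹ * w' x) x =
      -(μ / 3) * ∫ x, opT F μ (fun y => h y ^ 3 * k y) x * ((h x)⁻¹ * w' x) := by
    rw [key, neg_mul_neg, ← integral_const_mul]
    exact integral_congr_ae (Eventually.of_forall fun x => by ring)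
  rw [e1, ← integral_const_mul, ← integral_add i1 (i2.const_mul _), layerA_eq]
  refine integral_congr_ae (Eventually.of_forall fun x => ?_)
  simp only [← hk]
  ring

theorem isFormSol_layerA (hF : IsMultiplierFunction F) (hh : Depth h) {w : ℝ → ℝ} (hw : HInf w) :
    IsFormSol (LayerDom F μ h) (layerForm F μ h) (layerA F μ h w) w :=
  ⟨layerDom_of_hInf hF hh hw, fun _ hw' => layerForm_of_hInf hF hh hw hw'⟩

end Layer

namespace Params

variable {p : Params} {ζ : ℝ → ℝ}

/-- Coercivity is taken from the lower layer alone, since the upper one only adds a nonnegative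
term; the constant then holds for every γ ≥ 0. For γ = 0 domain and form are those of the lower
layer. For γ > 0 the weak problem has two multipliers, indexed by `Bool`, with `true` for the upper
layer. -/
theorem coerciveForm_A (hp : p.Valid) (h1 : Depth (p.h₁ ζ)) (h2 : Depth (p.h₂ ζ)) {κ : ℝ}
    (h0 : 0 < κ) (hκ : ∀ x, κ ≤ (p.h₂ ζ x)⁻¹) : CoerciveForm (p.ADom ζ) (p.AForm ζ) κ := by
  have c2 := coerciveForm_layer hp.F₂_mult hp.μ_pos h2 h0 hκ
  rcases eq_or_ne p.γ 0 with hγ | hγ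
  · have e1 : p.ADom ζ = LayerDom p.F₂ p.μ (p.h₂ ζ) := by
      ext w
      simp [ADom, hγ]
    have e2 : p.AForm ζ = layerForm p.F₂ p.μ (p.h₂ ζ) := by
      ext w w'
      simp [AForm, hγ]
    rwa [e1, e2]
  have hγ' : 0 < p.γ := lt_of_le_of_ne hp.γ_nonneg hγ.symm
  obtain ⟨κ₁, hκ₁, hκ₁'⟩ := h1.exists_le_inv
  have c1 := coerciveForm_layer hp.F₁_mult hp.μ_pos h1 hκ₁ hκ₁'
  refine ⟨h0, fun hw => c2.memLp hw.2, fun c hw hw' => ⟨fun hg => c1.mem c (hw.1 hg) (hw'.1 hg),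
    c2.mem c hw.2 hw'.2⟩, fun hw hw' => ?_, fun c hw hw' hz => ?_, fun {w} hw => ?_, fun {v} hv => ?_⟩
  · simp only [AForm]
    rw [c1.symm (hw.1 hγ) (hw'.1 hγ), c2.symm hw.2 hw'.2]
  · simp only [AForm]
    rw [c1.lin c (hw.1 hγ) (hw'.1 hγ) (hz.1 hγ), c2.lin c hw.2 hw'.2 hz.2]
    ring
  · have a1 := c1.coercive (hw.1 hγ)
    have a2 := c2.coercive hw.2
    have a3 : 0 ≤ ∫ x, w x ^ 2 := integral_nonneg fun x => sq_nonneg _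
    have a4 := mul_nonneg hp.γ_nonneg ((mul_nonneg hκ₁.le a3).trans a1)
    simp only [AForm]
    linarith
  · have hμ := hp.μ_pos
    obtain ⟨w, g, hw, hg, hs⟩ := exists_weak_solution (ι := Bool)
      (c := fun x => p.γ * (p.h₁ ζ x)⁻¹ + (p.h₂ ζ x)⁻¹)
      (d := fun i x => bif i then p.γ * (p.μ / 3 * p.h₁ ζ x ^ 3) else p.μ / 3 * p.h₂ ζ x ^ 3)
      (e := fun i x => bif i then (p.h₁ ζ x)⁻¹ else (p.h₂ ζ x)⁻¹)
      (m := fun i => bif i then symbD p.F₁ p.μ else symbD p.F₂ p.μ)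
      ((h1.isWeight.inv.const_mul hγ').add h2.isWeight.inv)
      (fun i => by
        cases i
        · exact h2.isWeight.cube.const_mul (by positivity)
        · exact (h1.isWeight.cube.const_mul (by positivity)).const_mul hγ')
      (fun i => by cases i; exacts [h2.inv.memLp, h1.inv.memLp])
      (fun i => by
        cases i
        exacts [(hp.F₂_mult.isSymbol_symbD p.μ).measurable,
          (hp.F₁_mult.isSymbol_symbD p.μ).measurable]) hv
    have d1 : LayerDom p.F₁ p.μ (p.h₁ ζ) w := ⟨hw, _, hg true⟩
    have d2 : LayerDom p.F₂ p.μ (p.h₂ ζ) w := ⟨hw, _, hg false⟩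
    refine ⟨w, ⟨fun _ => d1, d2⟩, fun w' hw' => ?_⟩
    have := hs w' (fun i => bif i then dmul p.F₁ p.μ fun x => (p.h₁ ζ x)⁻¹ * w' x
      else dmul p.F₂ p.μ fun x => (p.h₂ ζ x)⁻¹ * w' x) hw'.2.1 fun i => by
        cases i
        exacts [hw'.2.dmul, (hw'.1 hγ).dmul]
    simp only [AForm]
    rw [layerForm_eq_of_rel h1 hw hw'.2.1 (hg true) (hw'.1 hγ).dmul,
      layerForm_eq_of_rel h2 hw hw'.2.1 (hg false) hw'.2.dmul, ← this]
    simp only [Fintype.univ_bool, Finset.mem_singleton, Bool.true_eq_false, not_false_eq_true,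
      Finset.sum_insert, Finset.sum_singleton, cond_true, cond_false]
    have i1 : Integrable fun x => (p.h₁ ζ x)⁻¹ * w x * w' x :=
      (memLp_mul_top h1.inv.memLp hw).integrable_mul hw'.2.1
    have i2 : Integrable fun x => (p.h₂ ζ x)⁻¹ * w x * w' x :=
      (memLp_mul_top h2.inv.memLp hw).integrable_mul hw'.2.1
    have e1 : ∫ x, (p.γ * (p.h₁ ζ x)⁻¹ + (p.h₂ ζ x)⁻¹) * w x * w' x =
        p.γ * (∫ x, (p.h₁ ζ x)⁻¹ * w x * w' x) + ∫ x, (p.h₂ ζ x)⁻¹ * w x * w' x := by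
      rw [← integral_const_mul, ← integral_add (i1.const_mul _) i2]
      exact integral_congr_ae (Eventually.of_forall fun x => by ring)
    have e2 : ∫ x, p.γ * (p.μ / 3 * p.h₁ ζ x ^ 3) * g true x *
          dmul p.F₁ p.μ (fun x => (p.h₁ ζ x)⁻¹ * w' x) x =
        p.γ * ∫ x, p.μ / 3 * p.h₁ ζ x ^ 3 * g true x *
          dmul p.F₁ p.μ (fun x => (p.h₁ ζ x)⁻¹ * w' x) x := by
      rw [← integral_const_mul]
      exact integral_congr_ae (Eventually.of_forall fun x => by ring)
    rw [e1, e2]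
    ring

theorem isFormSol_A (hp : p.Valid) (h1 : Depth (p.h₁ ζ)) (h2 : Depth (p.h₂ ζ)) {w : ℝ → ℝ}
    (hw : HInf w) : IsFormSol (p.ADom ζ) (p.AForm ζ) (p.A ζ w) w := by
  refine ⟨⟨fun _ => layerDom_of_hInf hp.F₁_mult h1 hw, layerDom_of_hInf hp.F₂_mult h2 hw⟩,
    fun w' hw' => ?_⟩
  have a2 := hInf_layerA (μ := p.μ) hp.F₂_mult h2 hw
  have a1 := hInf_layerA (μ := p.μ) hp.F₁_mult h1 hw
  have i2 : Integrable fun x => layerA p.F₂ p.μ (p.h₂ ζ) w x * w' x :=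
    a2.memLp.integrable_mul hw'.2.1
  have i1 : Integrable fun x => layerA p.F₁ p.μ (p.h₁ ζ) w x * w' x :=
    a1.memLp.integrable_mul hw'.2.1
  have e : ∫ x, p.A ζ w x * w' x = p.γ * (∫ x, layerA p.F₁ p.μ (p.h₁ ζ) w x * w' x)
      + ∫ x, layerA p.F₂ p.μ (p.h₂ ζ) w x * w' x := by
    rw [← integral_const_mul, ← integral_add (i1.const_mul _) i2]
    exact integral_congr_ae (Eventually.of_forall fun x => by simp only [A]; ring)
  rw [e, AForm, layerForm_of_hInf hp.F₂_mult h2 hw hw'.2]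
  rcases eq_or_ne p.γ 0 with hγ | hγ
  · simp [hγ]
  · rw [layerForm_of_hInf hp.F₁_mult h1 hw (hw'.1 hγ)]

theorem hInf_A (hp : p.Valid) (h1 : Depth (p.h₁ ζ)) (h2 : Depth (p.h₂ ζ)) {w : ℝ → ℝ}
    (hw : HInf w) : HInf (p.A ζ w) :=
  Sm.add (Sm.const_mul p.γ (hInf_layerA (μ := p.μ) hp.F₁_mult h1 hw)) (hInf_layerA hp.F₂_mult h2 hw)

end Params

end

section

/-! ### Decay, composition, positivity of the depths -/

theorem Sm.hasDerivAt {p : ℝ≥0∞} {f : ℝ → ℝ} (hf : Sm p f) (x : ℝ) :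
    HasDerivAt f (_root_.deriv f x) x :=
  ((hf.1.differentiable (by simp)) x).hasDerivAt

/-- Both f² and its derivative 2ff' are integrable, so f² tends to 0 at both ends. -/
theorem tendsto_cocompact_of_hInf {f : ℝ → ℝ} (hf : HInf f) :
    Tendsto f (cocompact ℝ) (𝓝 0) := by
  have h0 : Sm 2 f := hf
  have hd : ∀ x, HasDerivAt (fun y => f y * f y) (deriv f x * f x + f x * deriv f x) x :=
    fun x => (h0.hasDerivAt x).mul (h0.hasDerivAt x)
  have i0 : Integrable fun x => f x * f x := HInf.mul_integrable h0 h0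
  have i1 : Integrable fun x => deriv f x * f x + f x * deriv f x :=
    (HInf.mul_integrable h0.deriv h0).add (HInf.mul_integrable h0 h0.deriv)
  have key : ∀ l : Filter ℝ, Tendsto (fun x => f x * f x) l (𝓝 0) → Tendsto f l (𝓝 0) := by
    intro l h
    have h1 := h.sqrt
    simp only [Real.sqrt_zero, Real.sqrt_mul_self_eq_abs] at h1
    exact (tendsto_zero_iff_abs_tendsto_zero f).2 h1
  rw [cocompact_eq_atBot_atTop, tendsto_sup]
  exact ⟨key _ (tendsto_zero_of_hasDerivAt_of_integrableOn_Iic (a := 0) (fun x _ => hd x)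
      i1.integrableOn i0.integrableOn),
    key _ (tendsto_zero_of_hasDerivAt_of_integrableOn_Ioi (a := 0) (fun x _ => hd x)
      i1.integrableOn i0.integrableOn)⟩

/-- Pointwise positivity becomes a uniform lower bound: h tends to a > 0 at infinity, and attains
its minimum on the remaining compact set. -/
theorem depth_of_pos {f h : ℝ → ℝ} {a b : ℝ} (hf : HInf f) (ha : 0 < a)
    (hh : ∀ x, h x = a + b * f x) (h0 : ∀ x, 0 < h x) : Depth h := by
  have hs : Sm ∞ h := ((Sm.const a).add ((Sm.top hf).const_mul b)).congr fun x => (hh x).symm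
  refine ⟨hs, ?_⟩
  have h1 : Tendsto h (cocompact ℝ) (𝓝 (a + b * 0)) := by
    rw [funext hh]
    exact ((tendsto_cocompact_of_hInf hf).const_mul b).const_add a
  obtain ⟨K, hK, hKs⟩ := mem_cocompact.1 (h1.eventually_const_lt (show a / 2 < a + b * 0 by linarith))
  rcases K.eq_empty_or_nonempty with rfl | hne
  · exact ⟨a / 2, by positivity, fun x => (hKs (by simp : x ∈ (∅ : Set ℝ)ᶜ)).le⟩
  · obtain ⟨x₀, _, hm⟩ := hK.exists_isMinOn hne hs.1.continuous.continuousOn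
    refine ⟨min (h x₀) (a / 2), lt_min (h0 x₀) (by positivity), fun x => ?_⟩
    by_cases hx : x ∈ K
    · exact (min_le_left _ _).trans (hm hx)
    · exact (min_le_right _ _).trans (hKs hx).le

theorem Params.Adm.depth₁ {p : Params} {ζ : ℝ → ℝ} (h : p.Adm ζ) : Depth (p.h₁ ζ) :=
  depth_of_pos (b := -p.ε) h.1 one_pos (fun x => by simp [h₁, sub_eq_add_neg]) fun x => (h.2 x).1

theorem Params.Adm.depth₂ {p : Params} {ζ : ℝ → ℝ} (h : p.Adm ζ) (hp : p.Valid) :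
    Depth (p.h₂ ζ) :=
  depth_of_pos (b := p.ε) h.1 (inv_pos.2 hp.δ_pos) (fun _ => rfl) fun x => (h.2 x).2

theorem Depth.eventually_affine {h φ : ℝ → ℝ} (hh : Depth h) (hφ : Sm ∞ φ) :
    ∃ κ > 0, ∀ᶠ s in 𝓝 (0 : ℝ), Depth (fun x => h x + s * φ x) ∧
      ∀ x, κ ≤ (h x + s * φ x)⁻¹ := by
  obtain ⟨c, hc, hl⟩ := hh.2
  obtain ⟨C, hC⟩ := hφ.exists_bound
  obtain ⟨M, hM⟩ := hh.1.exists_bound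
  have hC0 : 0 ≤ C := (abs_nonneg _).trans (hC 0)
  have hM0 : 0 ≤ M := (abs_nonneg _).trans (hM 0)
  refine ⟨(M + C + 1)⁻¹, by positivity, ?_⟩
  -- The second bound keeps h + sφ above c/2; the first keeps it below M + C, which yields a
  -- coercivity constant independent of s.
  have e : ∀ᶠ s in 𝓝 (0 : ℝ), |s| < min 1 (c / (2 * (C + 1))) := by
    have : Tendsto (fun s : ℝ => |s|) (𝓝 0) (𝓝 0) := by
      simpa using (continuous_abs.tendsto (0 : ℝ))
    exact this.eventually_lt_const (by positivity)
  filter_upwards [e] with s hs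
  have h1 : |s| < 1 := hs.trans_le (min_le_left _ _)
  have h2 : |s| * (C + 1) < c / 2 := by
    have := hs.trans_le (min_le_right _ _)
    rw [lt_div_iff₀ (by positivity)] at this
    linarith
  have hb : ∀ x, |s * φ x| ≤ |s| * C := fun x => by
    rw [abs_mul]
    exact mul_le_mul_of_nonneg_left (hC x) (abs_nonneg s)
  have hlow : ∀ x, c / 2 ≤ h x + s * φ x := fun x => by
    have := (abs_le.1 (hb x)).1
    have := abs_nonneg s
    linarith [hl x]
  refine ⟨⟨hh.1.add (hφ.const_mul s), c / 2, by positivity, hlow⟩, fun x => ?_⟩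
  refine inv_anti₀ (by linarith [hlow x]) ?_
  have h3 := (abs_le.1 (hb x)).2
  have h4 := (abs_le.1 (hM x)).2
  nlinarith

/-- Induction on the order for all ψ at once: the chain rule expresses the next derivative by ψ' ∘
f, to which the induction hypothesis applies, and f'. For order 0, f is bounded and ψ is bounded on
compact sets. -/
theorem Sm.comp {f ψ : ℝ → ℝ} (hf : Sm ∞ f) (hψ : ContDiff ℝ ∞ ψ) : Sm ∞ fun x => ψ (f x) := by
  have key : ∀ n : ℕ, ∀ ψ : ℝ → ℝ, ContDiff ℝ ∞ ψ → ∀ k ≤ n,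
      eLpNorm (_root_.iteratedDeriv k fun x => ψ (f x)) ∞ volume < ⊤ := by
    intro n
    induction n with
    | zero =>
      intro ψ hψ k hk
      obtain ⟨C, hC⟩ := hf.exists_bound
      obtain ⟨M, hM⟩ := (isCompact_Icc (a := -C) (b := C)).exists_bound_of_continuousOn
        hψ.continuous.continuousOn
      rw [Nat.le_zero.1 hk, iteratedDeriv_zero]
      exact (memLp_top_of_bound (hψ.continuous.comp hf.1.continuous).aestronglyMeasurable M
        (Eventually.of_forall fun x => hM _ (abs_le.1 (hC x)))).2
    | succ n ih =>
      intro ψ hψ k hk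
      rcases Nat.of_le_succ hk with hk | rfl
      · exact ih ψ hψ k hk
      have hψ' : ContDiff ℝ ∞ (_root_.deriv ψ) := (contDiff_infty_iff_deriv.1 hψ).2
      have e : _root_.deriv (fun x => ψ (f x)) = fun x => _root_.deriv ψ (f x) * _root_.deriv f x := by
        ext x
        exact (((hψ.differentiable (by simp)) (f x)).hasDerivAt.comp x (hf.hasDerivAt x)).deriv
      rw [iteratedDeriv_succ', e]
      refine (eLpNorm_iteratedDeriv_mul_le (p := ∞) (q := ∞) (hψ'.comp hf.1)
        hf.deriv.1 n).trans_lt (ENNReal.sum_lt_top.2 fun i hi => ENNReal.mul_lt_top (by simp) ?_)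
      exact ENNReal.mul_lt_top (ih _ hψ' i (by have := Finset.mem_range.1 hi; omega))
        (hf.deriv.2 _).eLpNorm_lt_top
  exact ⟨hψ.comp hf.1, fun n =>
    ⟨aestronglyMeasurable_iteratedDeriv (hψ.comp hf.1) n, key n ψ hψ n le_rfl⟩⟩

/-! ### Surface tension -/

/-- `y ↦ y / √(1 + κ y²)`. -/
def tilt (κ y : ℝ) : ℝ := y / √(1 + κ * y ^ 2)

variable {κ : ℝ}

theorem one_le_surf (hκ : 0 ≤ κ) (y : ℝ) : 1 ≤ √(1 + κ * y ^ 2) := by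
  rw [Real.one_le_sqrt]
  nlinarith [mul_nonneg hκ (sq_nonneg y)]

theorem hInf_tilt (hκ : 0 ≤ κ) {f : ℝ → ℝ} (hf : HInf f) : HInf fun x => tilt κ (f x) := by
  have hψ : ContDiff ℝ ∞ fun y : ℝ => (√(1 + κ * y ^ 2))⁻¹ := by
    refine (ContDiff.sqrt (by fun_prop) fun y => ?_).inv fun y => ?_
    · nlinarith [mul_nonneg hκ (sq_nonneg y)]
    · exact (zero_lt_one.trans_le (one_le_surf hκ y)).ne'
  exact Sm.congr ((Sm.comp (Sm.top hf) hψ).top_mul hf) fun x => by rw [tilt, div_eq_inv_mul]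

theorem hasDerivAt_tilt (hκ : 0 ≤ κ) (y : ℝ) :
    HasDerivAt (tilt κ) ((√(1 + κ * y ^ 2))⁻¹ ^ 3) y := by
  have h0 : 0 < 1 + κ * y ^ 2 := by nlinarith [mul_nonneg hκ (sq_nonneg y)]
  have hs : 0 < √(1 + κ * y ^ 2) := Real.sqrt_pos.2 h0
  have h1 : HasDerivAt (fun y : ℝ => 1 + κ * y ^ 2) (κ * (2 * y)) y := by
    simpa using! ((hasDerivAt_pow 2 y).const_mul κ).const_add 1
  have h2 := (hasDerivAt_id y).div (h1.sqrt h0.ne') hs.ne'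
  convert! h2 using 1
  have e := Real.sq_sqrt h0.le
  simp only [id]
  field_simp
  rw [show √(1 + κ * y ^ 2) ^ 2 = 1 + κ * y ^ 2 from e]
  ring

/-- The derivative of `tilt` lies between 0 and 1, so the capillary flux inherits its decay from
∂ₓ²ζ, without any differentiability in time of the slope. -/
theorem abs_deriv_tilt_le (hκ : 0 ≤ κ) {f : ℝ → ℝ} (hf : HInf f) (x : ℝ) :
    |deriv (fun y => tilt κ (f y)) x| ≤ |deriv f x| := by
  have h1 := (hasDerivAt_tilt hκ (f x)).comp x (Sm.hasDerivAt hf x)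
  rw [show deriv (fun y => tilt κ (f y)) x = _ from h1.deriv, abs_mul]
  refine mul_le_of_le_one_left (abs_nonneg _) ?_
  have h2 : 0 ≤ (√(1 + κ * f x ^ 2))⁻¹ := by positivity
  rw [abs_of_nonneg (by positivity)]
  exact pow_le_one₀ h2 (inv_le_one_of_one_le₀ (one_le_surf hκ _))

/-- Second-order Taylor bound for y ↦ √(1 + κy²). With a and b its values at x and y, the remainder
is exactly (κ(y−x)² − (b−a)²)/(2a), where a ≥ 1, and the numerator is nonnegative by the
Cauchy–Schwarz inequality 1 + κxy ≤ ab. -/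
theorem surf_bounds (hκ : 0 ≤ κ) (x y : ℝ) :
    |√(1 + κ * y ^ 2) - √(1 + κ * x ^ 2) - κ * tilt κ x * (y - x)| ≤ κ / 2 * (y - x) ^ 2 := by
  have a1 := one_le_surf hκ x
  have b1 := one_le_surf hκ y
  have a2 : √(1 + κ * x ^ 2) ^ 2 = 1 + κ * x ^ 2 := Real.sq_sqrt (by positivity)
  have b2 : √(1 + κ * y ^ 2) ^ 2 = 1 + κ * y ^ 2 := Real.sq_sqrt (by positivity)
  set a := √(1 + κ * x ^ 2)
  set b := √(1 + κ * y ^ 2)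
  have e : b - a - κ * tilt κ x * (y - x) = (κ * (y - x) ^ 2 - (b - a) ^ 2) / (2 * a) := by
    rw [tilt, show √(1 + κ * x ^ 2) = a from rfl]
    field_simp
    nlinarith
  have h1 : (b - a) ^ 2 ≤ κ * (y - x) ^ 2 := by
    have h3 : 1 + κ * (x * y) ≤ a * b := by
      refine le_of_sq_le_sq ?_ (by positivity) |>.trans le_rfl
      rw [mul_pow, a2, b2]
      nlinarith [mul_nonneg hκ (sq_nonneg (x - y))]
    nlinarith
  have h2 : 0 ≤ κ * (y - x) ^ 2 := by positivity
  rw [e, abs_of_nonneg (div_nonneg (by linarith) (by linarith)), div_le_iff₀ (by linarith)]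
  nlinarith [sq_nonneg (b - a)]

theorem integrable_surf (hκ : 0 ≤ κ) {f : ℝ → ℝ} (hf : HInf f) :
    Integrable fun x => √(1 + κ * f x ^ 2) - 1 := by
  have h1 : Integrable fun x => κ / 2 * (f x * f x) := (HInf.mul_integrable hf hf).const_mul _
  refine h1.mono' ?_ (Eventually.of_forall fun x => ?_)
  · have := hf.1.continuous
    exact Continuous.aestronglyMeasurable (by fun_prop)
  · have := surf_bounds hκ 0 (f x)
    simp only [tilt] at this
    simpa [sq] using this

/-- The linear part is differentiated by the product rule in L¹. The remainder E is at most
(κ/2)‖f(s) − f(t)‖², hence o(|s − t|). -/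
theorem hasDerivWithinAt_integral_surf (hκ : 0 ≤ κ) {I : Set ℝ} {t : ℝ} {f : ℝ → ℝ → ℝ} {f' : ℝ → ℝ}
    (hf : SmDeriv 2 I t f f') :
    HasDerivWithinAt (fun s => ∫ x, (√(1 + κ * f s x ^ 2) - 1))
      (∫ x, κ * tilt κ (f t x) * f' x) I t := by
  have hT := hInf_tilt hκ hf.1
  have hl : SmDeriv 1 I t _ _ := (SmDeriv.const (p := 2) (Sm.const_mul κ hT)).mul hf
  have hlin := hl.hasDerivWithinAt_integral
  simp only [zero_mul, zero_add] at hlin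
  set E : ℝ → ℝ := fun s => ∫ x, (√(1 + κ * f s x ^ 2) - √(1 + κ * f t x ^ 2)
    - κ * tilt κ (f t x) * (f s x - f t x)) with hE
  have hEd : HasDerivWithinAt E 0 I t := by
    rw [hasDerivWithinAt_iff_tendsto_slope]
    have h1 : SmTo 1 (𝓝[I \ {t}] t) _ _ := hf.2.mul hf.2
    have h2 := (h1.tendsto_integral.mul (tendsto_sub_punctured (I := I) (t := t)).abs
      ).const_mul (κ / 2)
    simp only [abs_zero, mul_zero] at h2
    refine squeeze_zero_norm' ?_ h2
    have hE0 : E t = 0 := by simp [hE]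
    filter_upwards [eventually_ne_of_punctured, hf.sm_eventually] with s hs hsm
    have hr : Sm 2 fun x => f s x - f t x := hsm.sub hf.1
    have i1 : Integrable fun x => κ / 2 * (f s x - f t x) ^ 2 := by
      simpa only [sq] using (HInf.mul_integrable hr hr).const_mul (κ / 2)
    rw [slope_def_field, hE0, sub_zero, Real.norm_eq_abs, abs_div,
      div_le_iff₀ (abs_pos.2 hs.2)]
    have h3 : |E s| ≤ ∫ x, κ / 2 * (f s x - f t x) ^ 2 :=
      norm_integral_le_of_norm_le (f := fun x => √(1 + κ * f s x ^ 2) - √(1 + κ * f t x ^ 2)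
        - κ * tilt κ (f t x) * (f s x - f t x)) i1 (Eventually.of_forall fun x => surf_bounds hκ _ _)
    refine h3.trans (le_of_eq ?_)
    rw [mul_assoc, mul_assoc, ← sq, sq_abs, integral_const_mul]
    congr 1
    rw [← integral_mul_const]
    refine integral_congr_ae (Eventually.of_forall fun x => ?_)
    have := hs.2
    simp only
    field_simp
  have h4 := (hEd.add hlin).const_add
    ((∫ x, (√(1 + κ * f t x ^ 2) - 1)) - ∫ x, κ * tilt κ (f t x) * f t x)
  rw [zero_add] at h4
  refine hasDerivWithinAt_iff_tendsto_slope.2 ((hasDerivWithinAt_iff_tendsto_slope.1 h4).congr' ?_)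
  have hmain : ∀ s, Sm 2 (f s) → (∫ x, (√(1 + κ * f s x ^ 2) - 1)) =
      ((∫ x, (√(1 + κ * f t x ^ 2) - 1)) - ∫ x, κ * tilt κ (f t x) * f t x)
        + (E s + ∫ x, κ * tilt κ (f t x) * f s x) := by
    intro s hs
    have j1 := integrable_surf hκ hs
    have j2 := integrable_surf hκ hf.1
    have j3 : Integrable fun x => κ * tilt κ (f t x) * f s x :=
      HInf.mul_integrable (Sm.const_mul κ hT) hs
    have j4 : Integrable fun x => κ * tilt κ (f t x) * f t x :=
      HInf.mul_integrable (Sm.const_mul κ hT) hf.1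
    have e : E s = (((∫ x, (√(1 + κ * f s x ^ 2) - 1)) - ∫ x, (√(1 + κ * f t x ^ 2) - 1))
        - ((∫ x, κ * tilt κ (f t x) * f s x) - ∫ x, κ * tilt κ (f t x) * f t x)) := by
      rw [← integral_sub j1 j2, ← integral_sub j3 j4]
      refine Eq.trans ?_ (integral_sub (j1.sub j2) (j3.sub j4))
      exact integral_congr_ae (Eventually.of_forall fun x => by simp only; ring)
    rw [e]
    ring
  filter_upwards [hf.sm_eventually] with s hs
  rw [slope_def_field, slope_def_field]
  have e1 := hmain s hs
  have e2 := hmain t hf.1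
  simp only [Pi.add_apply]
  congr 1
  linarith

end

section

/-! ### Derivatives of the kinetic energy of one layer -/

section Layer

variable {F : ℝ → ℝ} {μ : ℝ}

/-- `½ u² - μ ℛ[h,u]`. -/
def layerK (F : ℝ → ℝ) (μ : ℝ) (h u : ℝ → ℝ) : ℝ → ℝ := fun x =>
  1 / 2 * u x ^ 2 - μ * layerR F μ h u x

theorem hInf_layerK (hF : IsMultiplierFunction F) {h u : ℝ → ℝ} (hh : Depth h) (hu : HInf u) :
    HInf (layerK F μ h u) := by
  have h1 : Sm 2 fun x => 1 / 2 * (u x * u x) := ((Sm.top hu).top_mul hu).const_mul _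
  exact Sm.congr (Sm.sub h1 (Sm.const_mul μ (hInf_layerR (μ := μ) hF hh hu))) fun x => by
    rw [layerK]; ring

theorem opT_neg (hF : IsMultiplierFunction F) {f : ℝ → ℝ} (hf : HInf f) :
    opT F μ (fun x => -f x) = fun x => -opT F μ f x := by
  have h := opT_const_mul μ hF (-1) hf (Sm.const_mul (-1) hf)
  simpa only [neg_one_mul] using h

/-- ℛ is even in u, so the sign in u₁ = −w/h₁ disappears from ℛ^F; by contrast 𝒬 is odd, and the
sign there turns −γ into +γ. -/
theorem layerR_neg (hF : IsMultiplierFunction F) {h u : ℝ → ℝ} (hh : Depth h) (hu : HInf u) :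
    layerR F μ h (fun y => -u y) = layerR F μ h u := by
  rw [layerR_eq, layerR_eq, opT_neg hF hu]
  simp only [mul_neg]
  rw [opT_neg hF (hh.cube_mul (hInf_opT μ hF hu))]
  ext x
  ring

theorem layerQ_neg (hF : IsMultiplierFunction F) {h u : ℝ → ℝ} (hh : Depth h) (hu : HInf u) :
    layerQ F μ h (fun y => -u y) = fun x => -layerQ F μ h u x := by
  rw [layerQ_eq, layerQ_eq, opT_neg hF hu]
  simp only [mul_neg]
  rw [opT_neg hF (hh.cube_mul (hInf_opT μ hF hu))]
  ext x
  ring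

/-- Only the existence of the time derivative is needed: it yields the locally uniform decay of the
flux. -/
theorem exists_smDeriv_layerK (hF : IsMultiplierFunction F) (μ : ℝ) {I : Set ℝ} {t : ℝ}
    {h u : ℝ → ℝ → ℝ} {h' u' : ℝ → ℝ} (hh : SmDeriv ∞ I t h h') (hd : Depth (h t))
    (hu : SmDeriv 2 I t u u') : ∃ k', SmDeriv 2 I t (fun s => layerK F μ (h s) (u s)) k' := by
  have hi := hh.inv hd
  have hk := hu.opT hF μ
  have hhk : SmDeriv 2 I t _ _ := hh.mul hk
  have hsq : SmDeriv 2 I t _ _ := hhk.top.mul hhk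
  have hc0 : SmDeriv ∞ I t _ _ := hh.mul hh
  have hc1 : SmDeriv ∞ I t _ _ := hc0.mul hh
  have hm : SmDeriv 2 I t _ _ := hc1.mul hk
  have hiu : SmDeriv ∞ I t _ _ := hi.mul hu.top
  have hn : SmDeriv 2 I t _ _ := hiu.mul (hm.opT hF μ)
  have huu : SmDeriv 2 I t _ _ := hu.top.mul hu
  have hcube : ∀ s, (fun x => h s x * h s x * h s x * opT F μ (u s) x) =
      fun x => h s x ^ 3 * opT F μ (u s) x := by
    intro s; ext x; ring
  have e : ∀ s, (fun x => 1 / 2 * (u s x * u s x) + (-μ) * (1 / 2 * (h s x * opT F μ (u s) x *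
      (h s x * opT F μ (u s) x)) + 1 / 3 * ((h s x)⁻¹ * u s x *
      opT F μ (fun x => h s x * h s x * h s x * opT F μ (u s) x) x))) =
      layerK F μ (h s) (u s) := by
    intro s
    ext x
    rw [layerK, layerR_eq, hcube]
    ring
  exact ⟨_, ((huu.const_mul (1 / 2)).add (((hsq.const_mul (1 / 2)).add
    (hn.const_mul (1 / 3))).const_mul (-μ))).congr (Eventually.of_forall fun s => e s) (e t)⟩

/-- The variation is taken at fixed flux w, not at fixed velocity, because w is the fixed function
in the expansion of the inverse. -/
theorem smDeriv_layerA_const (hF : IsMultiplierFunction F) (μ : ℝ) {h φ w : ℝ → ℝ}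
    (hh : Depth h) (hφ : Sm ∞ φ) (hw : HInf w) :
    ∃ v', SmDeriv 2 Set.univ 0 (fun s => layerA F μ (fun x => h x + s * φ x) w) v' ∧
      ∫ x, v' x * w x =
        ∫ x, φ x * (-2 * layerK F μ h (fun y => (h y)⁻¹ * w y) x) := by
  have e : (fun x => h x + 0 * φ x) = h := by ext x; ring
  have h0 : Depth (fun x => h x + 0 * φ x) := by rwa [e]
  obtain ⟨v', h1, h2⟩ := exists_smDeriv_layerA hF μ (SmDeriv.affine hh.1 hφ) h0
    (SmDeriv.const (p := 2) hw)
  refine ⟨v', h1, ?_⟩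
  simp only [mul_zero, sub_zero, zero_mul, add_zero] at h2
  rw [h2]
  refine integral_congr_ae (Eventually.of_forall fun x => ?_)
  simp only [layerK]
  ring

theorem hasDerivAt_integral_layerAInv (hF : IsMultiplierFunction F) (hμ : 0 < μ) {h φ w : ℝ → ℝ}
    (hh : Depth h) (hφ : Sm ∞ φ) (hw : HInf w) :
    HasDerivAt (fun s => ∫ x, layerA F μ h w x *
        layerAInv F μ (fun x => h x + s * φ x) (layerA F μ h w) x)
      (2 * ∫ x, layerK F μ h (fun y => (h y)⁻¹ * w y) x * φ x) 0 := by
  obtain ⟨κ, hκ, hev⟩ := hh.eventually_affine hφ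
  obtain ⟨v', h1, h2⟩ := smDeriv_layerA_const hF μ hh hφ hw
  have key := hasDerivAt_integral_mul_formInv_param
    (D := fun s => LayerDom F μ fun x => h x + s * φ x)
    (q := fun s => layerForm F μ fun x => h x + s * φ x) (κ := κ)
    (b := fun s => layerA F μ (fun x => h x + s * φ x) w) (b' := v') (w := w)
    (hev.mono fun s hs => coerciveForm_layer hF hμ hs.1 hκ hs.2) hw h1
    (hev.mono fun s hs => ⟨hInf_layerA hF hs.1 hw, isFormSol_layerA hF hs.1 hw⟩)
  simp only [zero_mul, add_zero] at key
  convert! key using 1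
  rw [h2, ← integral_const_mul, ← integral_neg]
  exact integral_congr_ae (Eventually.of_forall fun x => by ring)

theorem layerQ_momentum {h u : ℝ → ℝ} (hh : Depth h) (x : ℝ) :
    u x + μ * layerQ F μ h u x = layerA F μ h (fun y => h y * u y) x := by
  have e : (fun z => (h z)⁻¹ * (h z * u z)) = u := by
    ext z; rw [inv_mul_cancel_left₀ (hh.pos z).ne']
  rw [layerA_eq, layerQ_eq]
  simp only [e]
  rw [inv_mul_cancel_left₀ (hh.pos x).ne']
  ring

end Layer

/-! ### Both layers -/

section Time

variable {p : Params} {I : Set ℝ} {t : ℝ}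

theorem SmDeriv.depth₁ (p : Params) {ζ : ℝ → ℝ → ℝ} {ζ' : ℝ → ℝ} (h : SmDeriv ∞ I t ζ ζ') :
    SmDeriv ∞ I t (fun s => p.h₁ (ζ s)) fun x => -p.ε * ζ' x := by
  have := (SmDeriv.const (p := ∞) (I := I) (t := t) (Sm.const 1)).add (h.const_mul (-p.ε))
  simp only [zero_add] at this
  have e : ∀ s, (fun x => 1 + -p.ε * ζ s x) = p.h₁ (ζ s) := fun s => by
    ext x; simp only [Params.h₁]; ring
  exact this.congr (Eventually.of_forall e) (e t)

theorem SmDeriv.depth₂ (p : Params) {ζ : ℝ → ℝ → ℝ} {ζ' : ℝ → ℝ} (h : SmDeriv ∞ I t ζ ζ') :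
    SmDeriv ∞ I t (fun s => p.h₂ (ζ s)) fun x => p.ε * ζ' x := by
  have := (SmDeriv.const (p := ∞) (I := I) (t := t) (Sm.const p.δ⁻¹)).add (h.const_mul p.ε)
  simp only [zero_add] at this
  exact this

end Time

namespace Params

variable {p : Params} {ζ w : ℝ → ℝ}

/-- `(½ u₂² - μ ℛ₂[h₂,u₂]) - γ (½ u₁² - μ ℛ₁[h₁,u₁])` with `uᵢ = w / hᵢ`. -/
def K (p : Params) (ζ w : ℝ → ℝ) : ℝ → ℝ := fun x =>
  layerK p.F₂ p.μ (p.h₂ ζ) (fun y => (p.h₂ ζ y)⁻¹ * w y) x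
    - p.γ * layerK p.F₁ p.μ (p.h₁ ζ) (fun y => (p.h₁ ζ y)⁻¹ * w y) x

theorem hInf_K (hp : p.Valid) (h1 : Depth (p.h₁ ζ)) (h2 : Depth (p.h₂ ζ)) (hw : HInf w) :
    HInf (p.K ζ w) :=
  Sm.sub (hInf_layerK hp.F₂_mult h2 (h2.inv.top_mul hw))
    (Sm.const_mul p.γ (hInf_layerK hp.F₁_mult h1 (h1.inv.top_mul hw)))

theorem K_eq (hp : p.Valid) (h1 : Depth (p.h₁ ζ)) (h2 : Depth (p.h₂ ζ)) (hw : HInf w) (x : ℝ) :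
    p.K ζ w x = 1 / 2 * ((p.h₁ ζ x ^ 2 - p.γ * p.h₂ ζ x ^ 2)
      / (p.h₁ ζ x ^ 2 * p.h₂ ζ x ^ 2)) * w x ^ 2 - p.μ * p.R ζ w x := by
  rw [K, R, layerK, layerK, layerR_neg hp.F₁_mult h1 (h1.inv.top_mul hw)]
  have e1 := (h1.pos x).ne'
  have e2 := (h2.pos x).ne'
  field_simp
  ring

theorem A_eq_momentum (hp : p.Valid) (h1 : Depth (p.h₁ ζ)) (h2 : Depth (p.h₂ ζ)) (hw : HInf w) :
    p.A ζ w = p.momentum ζ w := by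
  ext x
  have a1 := layerQ_momentum (F := p.F₁) (μ := p.μ) (u := fun y => (p.h₁ ζ y)⁻¹ * w y) h1 x
  have a2 := layerQ_momentum (F := p.F₂) (μ := p.μ) (u := fun y => (p.h₂ ζ y)⁻¹ * w y) h2 x
  have b1 : (fun y => p.h₁ ζ y * ((p.h₁ ζ y)⁻¹ * w y)) = w := by
    ext y; rw [mul_inv_cancel_left₀ (h1.pos y).ne']
  have b2 : (fun y => p.h₂ ζ y * ((p.h₂ ζ y)⁻¹ * w y)) = w := by
    ext y; rw [mul_inv_cancel_left₀ (h2.pos y).ne']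
  rw [b1] at a1
  rw [b2] at a2
  rw [A, ← a1, ← a2, momentum, Q, layerQ_neg hp.F₁_mult h1 (h1.inv.top_mul hw)]
  have e1 := (h1.pos x).ne'
  have e2 := (h2.pos x).ne'
  field_simp
  ring

theorem exists_smDeriv_K (hp : p.Valid) {I : Set ℝ} {t : ℝ} {ζ w : ℝ → ℝ → ℝ} {ζ' w' : ℝ → ℝ}
    (hζ : SmDeriv 2 I t ζ ζ') (hw : SmDeriv 2 I t w w') (h1 : Depth (p.h₁ (ζ t)))
    (h2 : Depth (p.h₂ (ζ t))) : ∃ k', SmDeriv 2 I t (fun s => p.K (ζ s) (w s)) k' := by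
  have u1 : SmDeriv 2 I t _ _ := ((SmDeriv.depth₁ p hζ.top).inv h1).mul hw
  have u2 : SmDeriv 2 I t _ _ := ((SmDeriv.depth₂ p hζ.top).inv h2).mul hw
  obtain ⟨k1, hk1⟩ := exists_smDeriv_layerK hp.F₁_mult p.μ (SmDeriv.depth₁ p hζ.top) h1 u1
  obtain ⟨k2, hk2⟩ := exists_smDeriv_layerK hp.F₂_mult p.μ (SmDeriv.depth₂ p hζ.top) h2 u2
  have e : ∀ s, (fun x => layerK p.F₂ p.μ (p.h₂ (ζ s)) (fun x => (p.h₂ (ζ s) x)⁻¹ * w s x) x +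
      -p.γ * layerK p.F₁ p.μ (p.h₁ (ζ s)) (fun x => (p.h₁ (ζ s) x)⁻¹ * w s x) x) =
      p.K (ζ s) (w s) := fun s => by ext x; rw [K]; ring
  exact ⟨_, (hk2.add (hk1.const_mul (-p.γ))).congr (Eventually.of_forall e) (e t)⟩

/-- The depths vary by −εζ' and εζ'. These opposite signs produce the difference of the two layers
in `K`. -/
theorem exists_smDeriv_A (hp : p.Valid) {I : Set ℝ} {t : ℝ} {ζ w : ℝ → ℝ → ℝ} {ζ' w' : ℝ → ℝ}
    (hζ : SmDeriv 2 I t ζ ζ') (hw : SmDeriv 2 I t w w') (h1 : Depth (p.h₁ (ζ t)))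
    (h2 : Depth (p.h₂ (ζ t))) :
    ∃ v', SmDeriv 2 I t (fun s => p.A (ζ s) (w s)) v' ∧
      ∫ x, (v' x * w t x - p.A (ζ t) (w t) x * w' x) =
        -(2 * p.ε) * ∫ x, p.K (ζ t) (w t) x * ζ' x := by
  obtain ⟨a1, ha1, i1⟩ := exists_smDeriv_layerA hp.F₁_mult p.μ (SmDeriv.depth₁ p hζ.top) h1 hw
  obtain ⟨a2, ha2, i2⟩ := exists_smDeriv_layerA hp.F₂_mult p.μ (SmDeriv.depth₂ p hζ.top) h2 hw
  refine ⟨_, (ha1.const_mul p.γ).add ha2, ?_⟩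
  have k1 := hInf_layerK (μ := p.μ) hp.F₁_mult h1 (h1.inv.top_mul hw.1)
  have k2 := hInf_layerK (μ := p.μ) hp.F₂_mult h2 (h2.inv.top_mul hw.1)
  have m1 := hInf_layerA (μ := p.μ) hp.F₁_mult h1 hw.1
  have m2 := hInf_layerA (μ := p.μ) hp.F₂_mult h2 hw.1
  have hm : ∀ {v v' : ℝ → ℝ}, Sm 2 v → Sm 2 v' →
      Integrable fun x => v x * w t x - v' x * w' x := fun hv hv' =>
    (HInf.mul_integrable hv hw.1).sub (HInf.mul_integrable hv' hw.2.1)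
  have e1 : ∫ x, ((p.γ * a1 x + a2 x) * w t x - p.A (ζ t) (w t) x * w' x) =
      p.γ * (∫ x, (a1 x * w t x - layerA p.F₁ p.μ (p.h₁ (ζ t)) (w t) x * w' x))
      + ∫ x, (a2 x * w t x - layerA p.F₂ p.μ (p.h₂ (ζ t)) (w t) x * w' x) := by
    rw [← integral_const_mul, ← integral_add ((hm ha1.2.1 m1).const_mul _) (hm ha2.2.1 m2)]
    exact integral_congr_ae (Eventually.of_forall fun x => by simp only [A]; ring)
  have e2 : ∀ (c : ℝ) (F h : ℝ → ℝ), ∫ x, c * ζ' x * (-((h x)⁻¹ * w t x) ^ 2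
      + 2 * p.μ * layerR F p.μ h (fun y => (h y)⁻¹ * w t y) x) =
      -(2 * c) * ∫ x, layerK F p.μ h (fun y => (h y)⁻¹ * w t y) x * ζ' x := by
    intro c F h
    rw [← integral_const_mul]
    exact integral_congr_ae (Eventually.of_forall fun x => by simp only [layerK]; ring)
  have e3 : ∫ x, p.K (ζ t) (w t) x * ζ' x =
      (∫ x, layerK p.F₂ p.μ (p.h₂ (ζ t)) (fun y => (p.h₂ (ζ t) y)⁻¹ * w t y) x * ζ' x)
      - p.γ * ∫ x, layerK p.F₁ p.μ (p.h₁ (ζ t)) (fun y => (p.h₁ (ζ t) y)⁻¹ * w t y) x * ζ' x := by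
    rw [← integral_const_mul, ← integral_sub (HInf.mul_integrable k2 hζ.2.1)
      ((HInf.mul_integrable k1 hζ.2.1).const_mul _)]
    exact integral_congr_ae (Eventually.of_forall fun x => by simp only [K]; ring)
  rw [e1, i1, i2, e2, e2, e3]
  ring

theorem h₁_affine (p : Params) (ζ φ : ℝ → ℝ) (s : ℝ) :
    p.h₁ (fun x => ζ x + s * φ x) = fun x => p.h₁ ζ x + s * (-p.ε * φ x) := by
  ext x; simp only [h₁]; ring

theorem h₂_affine (p : Params) (ζ φ : ℝ → ℝ) (s : ℝ) :
    p.h₂ (fun x => ζ x + s * φ x) = fun x => p.h₂ ζ x + s * (p.ε * φ x) := by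
  ext x; simp only [h₂]; ring

theorem eventually_affine (hp : p.Valid) (h1 : Depth (p.h₁ ζ)) (h2 : Depth (p.h₂ ζ)) {φ : ℝ → ℝ}
    (hφ : Sm ∞ φ) : ∃ κ > 0, ∀ᶠ s in 𝓝 (0 : ℝ),
      CoerciveForm (p.ADom fun x => ζ x + s * φ x) (p.AForm fun x => ζ x + s * φ x) κ ∧
      Depth (p.h₁ fun x => ζ x + s * φ x) ∧ Depth (p.h₂ fun x => ζ x + s * φ x) := by
  obtain ⟨_, _, hev1⟩ := h1.eventually_affine (hφ.const_mul (-p.ε))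
  obtain ⟨κ, hκ, hev2⟩ := h2.eventually_affine (hφ.const_mul p.ε)
  refine ⟨κ, hκ, ?_⟩
  filter_upwards [hev1, hev2] with s a1 a2
  rw [← h₁_affine] at a1
  have d1 := a1.1
  have d2 := a2.1
  have hb := a2.2
  rw [← h₂_affine] at d2
  exact ⟨coerciveForm_A hp d1 d2 hκ fun x => by
    have := hb x
    rwa [← congrFun (h₂_affine p ζ φ s) x] at this, d1, d2⟩

theorem hasDerivAt_integral_AInv (hp : p.Valid) (h1 : Depth (p.h₁ ζ)) (h2 : Depth (p.h₂ ζ))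
    {φ : ℝ → ℝ} (hζ : HInf ζ) (hφ : HInf φ) (hw : HInf w) :
    HasDerivAt (fun s => ∫ x, p.A ζ w x * p.AInv (fun x => ζ x + s * φ x) (p.A ζ w) x)
      (2 * ∫ x, p.ε * p.K ζ w x * φ x) 0 := by
  obtain ⟨κ, hκ, hev⟩ := eventually_affine hp h1 h2 (Sm.top hφ)
  have e : (fun x => ζ x + 0 * φ x) = ζ := by ext x; ring
  obtain ⟨v', h3, h4⟩ := exists_smDeriv_A (p := p) (ζ := fun s x => ζ x + s * φ x)
    (w := fun _ => w) hp (SmDeriv.affine (p := 2) hζ hφ) (SmDeriv.const hw)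
    (by simpa only [e] using h1) (by simpa only [e] using h2)
  have key := hasDerivAt_integral_mul_formInv_param
    (D := fun s => p.ADom fun x => ζ x + s * φ x)
    (q := fun s => p.AForm fun x => ζ x + s * φ x) (κ := κ)
    (b := fun s => p.A (fun x => ζ x + s * φ x) w) (b' := v') (w := w)
    (hev.mono fun s hs => hs.1) hw h3
    (hev.mono fun s hs => ⟨hInf_A hp hs.2.1 hs.2.2 hw, isFormSol_A hp hs.2.1 hs.2.2 hw⟩)
  simp only [zero_mul, add_zero, mul_zero, sub_zero] at key h4
  convert! key using 1
  rw [h4, ← integral_const_mul, neg_mul, neg_neg, ← integral_const_mul]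
  exact integral_congr_ae (Eventually.of_forall fun x => by ring)

end Params

end

section

/-! ### Functional derivatives of the two-variable Hamiltonian -/

theorem integral_mul_deriv_hInf {f g : ℝ → ℝ} (hf : HInf f) (hg : HInf g) :
    ∫ x, f x * deriv g x = -∫ x, deriv f x * g x :=
  integral_mul_deriv_eq_deriv_mul_of_integrable (fun x _ => Sm.hasDerivAt hf x)
    (fun x _ => Sm.hasDerivAt hg x) (HInf.mul_integrable hf (Sm.deriv hg))
    (HInf.mul_integrable (Sm.deriv hf) hg) (HInf.mul_integrable hf hg)

/-- The fundamental lemma of the calculus of variations; smoothness upgrades equality almost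
everywhere to equality. This identifies the unspecified gradients of `IsHamSol` and `IsHam4Sol` with
the explicit ones. -/
theorem IsVarDeriv.unique {J : (ℝ → ℝ) → ℝ} {f g g' : ℝ → ℝ} (h : IsVarDeriv J f g)
    (h' : IsVarDeriv J f g') : g = g' := by
  have c := h.1.continuous
  have c' := h'.1.continuous
  refine (Continuous.ae_eq_iff_eq volume c c').1 ?_
  refine ae_eq_of_integral_contDiff_smul_eq c.locallyIntegrable c'.locallyIntegrable
    fun φ hφ hc => ?_
  have := (h.2 φ hφ hc).unique (h'.2 φ hφ hc)
  simpa only [smul_eq_mul, mul_comm] using this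

namespace Params

variable {p : Params} {ζ w : ℝ → ℝ}

theorem Valid.surf_nonneg (hp : p.Valid) : 0 ≤ p.μ * p.ε ^ 2 :=
  mul_nonneg hp.μ_pos.le (sq_nonneg _)

theorem hInf_slope (hp : p.Valid) (hζ : HInf ζ) : HInf (p.slope ζ) :=
  hInf_tilt hp.surf_nonneg (Sm.deriv hζ)

/-- Twice the potential energy. -/
def pot (p : Params) (ζ : ℝ → ℝ) : ℝ :=
  (p.γ + p.δ) * (∫ x, ζ x * ζ x) + 2 * (p.γ + p.δ) * p.iBo / (p.μ * p.ε ^ 2)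
    * ∫ x, (√(1 + p.μ * p.ε ^ 2 * deriv ζ x ^ 2) - 1)

/-- Functional derivative of the potential energy. -/
def gradPot (p : Params) (ζ : ℝ → ℝ) : ℝ → ℝ := fun x =>
  (p.γ + p.δ) * ζ x - (p.γ + p.δ) * p.iBo * deriv (p.slope ζ) x

theorem hInf_gradPot (hp : p.Valid) (hζ : HInf ζ) : HInf (p.gradPot ζ) :=
  Sm.sub (Sm.const_mul _ hζ) (Sm.const_mul _ (Sm.deriv (hInf_slope hp hζ)))

/-- The capillary variation ∫ με² p.slope(ζ) ∂ₓζ' is integrated by parts; the factor με² cancels the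
one in the energy. -/
theorem hasDerivWithinAt_pot (hp : p.Valid) {I : Set ℝ} {t : ℝ} {ζ : ℝ → ℝ → ℝ} {ζ' : ℝ → ℝ}
    (hζ : SmDeriv 2 I t ζ ζ') :
    HasDerivWithinAt (fun s => p.pot (ζ s)) (2 * ∫ x, p.gradPot (ζ t) x * ζ' x) I t := by
  have h1 : SmDeriv 1 I t _ _ := hζ.mul hζ
  have h2 := hasDerivWithinAt_integral_surf hp.surf_nonneg hζ.deriv
  refine ((h1.hasDerivWithinAt_integral.const_mul (p.γ + p.δ)).add
    (h2.const_mul (2 * (p.γ + p.δ) * p.iBo / (p.μ * p.ε ^ 2)))).congr_deriv ?_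
  have hS := hInf_slope hp hζ.1
  have e2 : ∫ x, p.μ * p.ε ^ 2 * tilt (p.μ * p.ε ^ 2) (deriv (ζ t) x) * deriv ζ' x =
      -(p.μ * p.ε ^ 2) * ∫ x, deriv (p.slope (ζ t)) x * ζ' x := by
    have := integral_mul_deriv_hInf hS hζ.2.1
    rw [neg_mul, ← mul_neg, ← this, ← integral_const_mul]
    exact integral_congr_ae (Eventually.of_forall fun x => by simp only [slope, tilt]; ring)
  have e1 : ∫ x, (ζ' x * ζ t x + ζ t x * ζ' x) = 2 * ∫ x, ζ t x * ζ' x := by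
    rw [← integral_const_mul]
    exact integral_congr_ae (Eventually.of_forall fun x => by ring)
  have e3 : ∫ x, p.gradPot (ζ t) x * ζ' x = (p.γ + p.δ) * (∫ x, ζ t x * ζ' x)
      - (p.γ + p.δ) * p.iBo * ∫ x, deriv (p.slope (ζ t)) x * ζ' x := by
    rw [← integral_const_mul, ← integral_const_mul, ← integral_sub
      ((HInf.mul_integrable hζ.1 hζ.2.1).const_mul _)
      ((HInf.mul_integrable (Sm.deriv hS) hζ.2.1).const_mul _)]
    exact integral_congr_ae (Eventually.of_forall fun x => by simp only [gradPot]; ring)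
  rw [e1, e2, e3]
  have := hp.μ_pos.ne'
  have := hp.ε_pos.ne'
  field_simp
  ring

theorem integrable_pot (hp : p.Valid) (hζ : HInf ζ) :
    Integrable fun x => (p.γ + p.δ) * ζ x ^ 2 + 2 * (p.γ + p.δ) * p.iBo / (p.μ * p.ε ^ 2)
        * (√(1 + p.μ * p.ε ^ 2 * deriv ζ x ^ 2) - 1) := by
  have h1 := HInf.mul_integrable hζ hζ
  simp only [← sq] at h1
  exact (h1.const_mul _).add ((integrable_surf hp.surf_nonneg (Sm.deriv hζ)).const_mul _)

theorem integral_pot (hp : p.Valid) (hζ : HInf ζ) :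
    ∫ x, ((p.γ + p.δ) * ζ x ^ 2 + 2 * (p.γ + p.δ) * p.iBo / (p.μ * p.ε ^ 2)
        * (√(1 + p.μ * p.ε ^ 2 * deriv ζ x ^ 2) - 1)) = p.pot ζ := by
  have h1 := HInf.mul_integrable hζ hζ
  simp only [← sq] at h1
  rw [integral_add (h1.const_mul _)
    ((integrable_surf hp.surf_nonneg (Sm.deriv hζ)).const_mul _), integral_const_mul,
    integral_const_mul, pot]
  simp only [sq]

theorem hamiltonian_eq (hp : p.Valid) (hζ : HInf ζ) {v : ℝ → ℝ}
    (hv : Integrable fun x => v x * p.AInv ζ v x) :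
    p.hamiltonian ζ v = 1 / 2 * (p.pot ζ + ∫ x, v x * p.AInv ζ v x) := by
  rw [hamiltonian, integral_add (integrable_pot hp hζ) hv, integral_pot hp hζ]

theorem exists_coerciveForm_A (hp : p.Valid) (hζ : p.Adm ζ) :
    ∃ κ, CoerciveForm (p.ADom ζ) (p.AForm ζ) κ := by
  obtain ⟨κ, h0, hκ⟩ := (hζ.depth₂ hp).exists_le_inv
  exact ⟨κ, coerciveForm_A hp hζ.depth₁ (hζ.depth₂ hp) h0 hκ⟩

theorem AInv_A (hp : p.Valid) (hζ : p.Adm ζ) (hw : HInf w) :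
    p.AInv ζ (p.A ζ w) =ᵐ[volume] w := by
  obtain ⟨κ, hq⟩ := exists_coerciveForm_A hp hζ
  exact hq.formInv_ae_eq (hInf_A hp hζ.depth₁ (hζ.depth₂ hp) hw).memLp
    (isFormSol_A hp hζ.depth₁ (hζ.depth₂ hp) hw)

theorem hamiltonian_A (hp : p.Valid) (hζ : p.Adm ζ) (hw : HInf w) :
    p.hamiltonian ζ (p.A ζ w) = 1 / 2 * (p.pot ζ + ∫ x, p.A ζ w x * w x) := by
  obtain ⟨κ, hq⟩ := exists_coerciveForm_A hp hζ
  have hA := hInf_A hp hζ.depth₁ (hζ.depth₂ hp) hw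
  rw [hamiltonian_eq hp hζ.1 (hq.integrable_mul_formInv hA.memLp), AInv,
    hq.integral_mul_formInv hA.memLp (isFormSol_A hp hζ.depth₁ (hζ.depth₂ hp) hw)]

theorem isVarDeriv_hamiltonian_v (hp : p.Valid) (hζ : p.Adm ζ) (hw : HInf w) :
    IsVarDeriv (fun η => p.hamiltonian ζ η) (p.A ζ w) w := by
  refine ⟨hw.1, fun φ hφ hc => ?_⟩
  obtain ⟨κ, hq⟩ := exists_coerciveForm_A hp hζ
  have hA := hInf_A hp hζ.depth₁ (hζ.depth₂ hp) hw
  have hφ2 : HInf φ := Sm.of_hasCompactSupport hφ hc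
  have e : ∀ s : ℝ, p.hamiltonian ζ (fun x => p.A ζ w x + s * φ x) = 1 / 2 * (p.pot ζ +
      ∫ x, (p.A ζ w x + s * φ x) * p.AInv ζ (fun y => p.A ζ w y + s * φ y) x) := fun s =>
    hamiltonian_eq hp hζ.1 (hq.integrable_mul_formInv (Sm.add hA (Sm.const_mul s hφ2)).memLp)
  simp only [e]
  have h := ((hq.hasDerivAt_integral_mul_formInv hA.memLp hφ2.memLp
    (isFormSol_A hp hζ.depth₁ (hζ.depth₂ hp) hw)).const_add (p.pot ζ)).const_mul (1 / 2)
  refine h.congr_deriv ?_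
  ring

/-- Functional derivative of the Hamiltonian with respect to `ζ`, at `v = 𝒜[εζ]w`. -/
def grad (p : Params) (ζ w : ℝ → ℝ) : ℝ → ℝ := fun x => p.gradPot ζ x + p.ε * p.K ζ w x

theorem hInf_grad (hp : p.Valid) (hζ : p.Adm ζ) (hw : HInf w) : HInf (p.grad ζ w) :=
  Sm.add (hInf_gradPot hp hζ.1) (Sm.const_mul _ (hInf_K hp hζ.depth₁ (hζ.depth₂ hp) hw))

theorem grad_eq (hp : p.Valid) (hζ : p.Adm ζ) (hw : HInf w) : p.grad ζ w = fun x =>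
    (p.γ + p.δ) * ζ x - (p.γ + p.δ) * p.iBo * deriv (p.slope ζ) x
      + p.ε / 2 * ((p.h₁ ζ x ^ 2 - p.γ * p.h₂ ζ x ^ 2)
          / (p.h₁ ζ x ^ 2 * p.h₂ ζ x ^ 2)) * w x ^ 2
      - p.μ * p.ε * p.R ζ w x := by
  ext x
  rw [grad, gradPot, K_eq hp hζ.depth₁ (hζ.depth₂ hp) hw]
  ring

theorem integral_grad_mul (hp : p.Valid) (hζ : p.Adm ζ) (hw : HInf w) {φ : ℝ → ℝ} (hφ : HInf φ) :
    ∫ x, p.grad ζ w x * φ x = (∫ x, p.gradPot ζ x * φ x) + ∫ x, p.ε * p.K ζ w x * φ x := by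
  rw [← integral_add (HInf.mul_integrable (hInf_gradPot hp hζ.1) hφ) (HInf.mul_integrable
    (Sm.const_mul _ (hInf_K hp hζ.depth₁ (hζ.depth₂ hp) hw)) hφ)]
  exact integral_congr_ae (Eventually.of_forall fun x => by simp only [grad]; ring)

theorem isVarDeriv_hamiltonian_ζ (hp : p.Valid) (hζ : p.Adm ζ) (hw : HInf w) :
    IsVarDeriv (fun η => p.hamiltonian η (p.A ζ w)) ζ (p.grad ζ w) := by
  refine ⟨(hInf_grad hp hζ hw).1, fun φ hφ hc => ?_⟩
  have hφ2 : HInf φ := Sm.of_hasCompactSupport hφ hc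
  have h1 := hζ.depth₁
  have h2 := hζ.depth₂ hp
  have hA := hInf_A hp h1 h2 hw
  obtain ⟨κ, _, hev⟩ := eventually_affine hp h1 h2 (Sm.top hφ2)
  have hpot := hasDerivWithinAt_pot hp (SmDeriv.affine (p := 2) hζ.1 hφ2)
  rw [hasDerivWithinAt_univ] at hpot
  simp only [zero_mul, add_zero] at hpot
  have h := (hpot.add (hasDerivAt_integral_AInv hp h1 h2 hζ.1 hφ2 hw)).const_mul (1 / 2)
  refine (h.congr_of_eventuallyEq ?_).congr_deriv ?_
  · filter_upwards [hev] with s hs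
    exact hamiltonian_eq hp (Sm.add hζ.1 (Sm.const_mul s hφ2))
      (hs.1.integrable_mul_formInv hA.memLp)
  · rw [integral_grad_mul hp hζ hw hφ2]
    ring

theorem integral_layerA_self {F : ℝ → ℝ} {μ : ℝ} (hF : IsMultiplierFunction F) {h u : ℝ → ℝ}
    (hh : Depth h) (hu : HInf u) :
    Integrable (fun x => h x * u x ^ 2
      + μ * (1 / 3) * h x * (h x * deriv (fmul F μ u) x) ^ 2) ∧
    ∫ x, layerA F μ h (fun y => h y * u y) x * (h x * u x) = ∫ x, h x * u x ^ 2
      + μ * (1 / 3) * h x * (h x * deriv (fmul F μ u) x) ^ 2 := by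
  have hk := hInf_opT μ hF hu
  have e : ∀ x, h x * u x * u x + μ / 3 * h x ^ 3 * opT F μ u x * opT F μ u x =
      h x * u x ^ 2 + μ * (1 / 3) * h x * (h x * deriv (fmul F μ u) x) ^ 2 := fun x => by
    simp only [opT]; ring
  rw [integral_layerA_mul (μ := μ) hF hh hu hu, ← funext e]
  refine ⟨?_, rfl⟩
  have i1 : Integrable fun x => h x * u x * u x := HInf.mul_integrable (hh.1.top_mul hu) hu
  have i2 : Integrable fun x => μ / 3 * (h x ^ 3 * opT F μ u x * opT F μ u x) :=
    (HInf.mul_integrable (hh.cube_mul hk) hk).const_mul _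
  refine (i1.add i2).congr (Eventually.of_forall fun x => ?_)
  simp only [Pi.add_apply]
  ring

theorem integral_layerA_div {F : ℝ → ℝ} {μ : ℝ} (hF : IsMultiplierFunction F) {h w : ℝ → ℝ}
    (hh : Depth h) (hw : HInf w) :
    Integrable (fun x => h x * (w x / h x) ^ 2
      + μ * (1 / 3) * h x * (h x * deriv (fmul F μ fun y => w y / h y) x) ^ 2) ∧
    ∫ x, layerA F μ h w x * w x = ∫ x, h x * (w x / h x) ^ 2
      + μ * (1 / 3) * h x * (h x * deriv (fmul F μ fun y => w y / h y) x) ^ 2 := by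
  have hu : HInf fun y => w y / h y :=
    Sm.congr (hh.inv.top_mul hw) fun x => by rw [div_eq_inv_mul]
  have e' : ∀ y, h y * (w y / h y) = w y := fun y => mul_div_cancel₀ _ (hh.pos y).ne'
  have key := integral_layerA_self (μ := μ) hF hh hu
  simp only [e'] at key
  exact key

theorem hamiltonian_A_eq (hp : p.Valid) (hζ : p.Adm ζ) (hw : HInf w) :
    p.hamiltonian ζ (p.A ζ w) =
        1 / 2 * ∫ x, (p.γ + p.δ) * ζ x ^ 2
          + 2 * (p.γ + p.δ) * p.iBo / (p.μ * p.ε ^ 2)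
              * (√(1 + p.μ * p.ε ^ 2 * deriv ζ x ^ 2) - 1)
          + p.γ * p.h₁ ζ x * (-w x / p.h₁ ζ x) ^ 2
          + p.h₂ ζ x * (w x / p.h₂ ζ x) ^ 2
          + p.μ * (p.γ / 3) * p.h₁ ζ x *
              (p.h₁ ζ x * deriv (fmul p.F₁ p.μ fun y => -w y / p.h₁ ζ y) x) ^ 2
          + p.μ * (1 / 3) * p.h₂ ζ x *
              (p.h₂ ζ x * deriv (fmul p.F₂ p.μ fun y => w y / p.h₂ ζ y) x) ^ 2 := by
  have h1 := hζ.depth₁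
  have h2 := hζ.depth₂ hp
  obtain ⟨j1, k1⟩ := integral_layerA_div (μ := p.μ) hp.F₁_mult h1 hw
  obtain ⟨j2, k2⟩ := integral_layerA_div (μ := p.μ) hp.F₂_mult h2 hw
  have hu : HInf fun y => w y / p.h₁ ζ y :=
    Sm.congr (h1.inv.top_mul hw) fun x => by rw [div_eq_inv_mul]
  have en : deriv (fmul p.F₁ p.μ fun y => -w y / p.h₁ ζ y) =
      fun x => -deriv (fmul p.F₁ p.μ fun y => w y / p.h₁ ζ y) x := by
    have := opT_neg (μ := p.μ) hp.F₁_mult hu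
    simpa only [opT, neg_div] using this
  have i1 : Integrable fun x => layerA p.F₁ p.μ (p.h₁ ζ) w x * w x :=
    HInf.mul_integrable (hInf_layerA hp.F₁_mult h1 hw) hw
  have i2 : Integrable fun x => layerA p.F₂ p.μ (p.h₂ ζ) w x * w x :=
    HInf.mul_integrable (hInf_layerA hp.F₂_mult h2 hw) hw
  have eA : ∫ x, p.A ζ w x * w x = p.γ * (∫ x, layerA p.F₁ p.μ (p.h₁ ζ) w x * w x)
      + ∫ x, layerA p.F₂ p.μ (p.h₂ ζ) w x * w x := by
    rw [← integral_const_mul, ← integral_add (i1.const_mul _) i2]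
    exact integral_congr_ae (Eventually.of_forall fun x => by simp only [A]; ring)
  rw [hamiltonian_A hp hζ hw, eA, k1, k2, ← integral_pot hp hζ.1, ← integral_const_mul,
    ← integral_add (j1.const_mul _) j2]
  congr 1
  refine (integral_add (integrable_pot hp hζ.1) ((j1.const_mul _).add j2)).symm.trans
    (integral_congr_ae (Eventually.of_forall fun x => ?_))
  simp only [en, Pi.add_apply]
  ring

/-! ### Equivalence of the two-equation system with the Hamiltonian system -/

theorem hInf_R (hp : p.Valid) (hζ : p.Adm ζ) (hw : HInf w) : HInf (p.R ζ w) := by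
  have h1 := hζ.depth₁
  have h2 := hζ.depth₂ hp
  exact Sm.sub (hInf_layerR hp.F₂_mult h2 (h2.inv.top_mul hw))
    (Sm.const_mul _ (hInf_layerR hp.F₁_mult h1 (Sm.neg (h1.inv.top_mul hw))))

theorem neg_deriv_grad (hp : p.Valid) (hζ : p.Adm ζ) (hw : HInf w) (x : ℝ) :
    -(p.γ + p.δ) * deriv ζ x
        - p.ε / 2 * deriv (fun y =>
            (p.h₁ ζ y ^ 2 - p.γ * p.h₂ ζ y ^ 2)
              / (p.h₁ ζ y * p.h₂ ζ y) ^ 2 * w y ^ 2) x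
        + p.μ * p.ε * deriv (p.R ζ w) x
        + (p.γ + p.δ) * p.iBo * iteratedDeriv 2 (p.slope ζ) x = -deriv (p.grad ζ w) x := by
  have h1 := hζ.depth₁
  have h2 := hζ.depth₂ hp
  have hK := Sm.hasDerivAt (hInf_K hp h1 h2 hw) x
  have hR := Sm.hasDerivAt (hInf_R hp hζ hw) x
  have hS := Sm.hasDerivAt (Sm.deriv (hInf_slope hp hζ.1)) x
  have hZ := Sm.hasDerivAt hζ.1 x
  have e : (fun y => (p.h₁ ζ y ^ 2 - p.γ * p.h₂ ζ y ^ 2)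
      / (p.h₁ ζ y * p.h₂ ζ y) ^ 2 * w y ^ 2) = fun y => 2 * (p.K ζ w y + p.μ * p.R ζ w y) := by
    ext y
    rw [K_eq hp h1 h2 hw]
    ring
  have d1 : deriv (fun y => (p.h₁ ζ y ^ 2 - p.γ * p.h₂ ζ y ^ 2)
      / (p.h₁ ζ y * p.h₂ ζ y) ^ 2 * w y ^ 2) x = 2 * (deriv (p.K ζ w) x + p.μ * deriv (p.R ζ w) x) := by
    rw [e]
    exact ((hK.add (hR.const_mul p.μ)).const_mul 2).deriv
  have d2 : deriv (p.grad ζ w) x = (p.γ + p.δ) * deriv ζ x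
      - (p.γ + p.δ) * p.iBo * deriv (deriv (p.slope ζ)) x + p.ε * deriv (p.K ζ w) x :=
    (((hZ.const_mul _).sub (hS.const_mul _)).add (hK.const_mul _)).deriv
  rw [d1, d2, iteratedDeriv_succ, iteratedDeriv_one]
  ring

/-- The common normal form of the two-equation system: time derivatives of ζ and 𝒜w equal to minus
the space derivatives of w and `grad`. -/
theorem isGNSol_iff (hp : p.Valid) {I : Set ℝ} {ζ w : ℝ → ℝ → ℝ}
    (h : ∀ t ∈ I, p.Adm (ζ t) ∧ HInf (w t)) :
    p.IsGNSol I ζ w ↔ ∀ t ∈ I, ∀ x,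
      HasDerivWithinAt (fun s => ζ s x) (-deriv (w t) x) I t ∧
      HasDerivWithinAt (fun s => p.A (ζ s) (w s) x) (-deriv (p.grad (ζ t) (w t)) x) I t := by
  refine forall₂_congr fun t ht => forall_congr' fun x => and_congr_right fun _ => ?_
  rw [neg_deriv_grad hp (h t ht).1 (h t ht).2]
  have e : ∀ s ∈ I, p.momentum (ζ s) (w s) x = p.A (ζ s) (w s) x := fun s hs => by
    rw [A_eq_momentum hp (h s hs).1.depth₁ ((h s hs).1.depth₂ hp) (h s hs).2]
  exact ⟨fun h1 => h1.congr (fun s hs => (e s hs).symm) (e t ht).symm,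
    fun h1 => h1.congr e (e t ht)⟩

theorem isGNSol_iff_isHamSol (hp : p.Valid) {I : Set ℝ} {ζ w : ℝ → ℝ → ℝ}
    (h : ∀ t ∈ I, p.Adm (ζ t) ∧ HInf (w t)) :
    p.IsGNSol I ζ w ↔ p.IsHamSol I ζ fun t => p.A (ζ t) (w t) := by
  rw [isGNSol_iff hp h]
  constructor
  · intro H
    exact ⟨fun t => p.grad (ζ t) (w t), w, fun t ht =>
      ⟨isVarDeriv_hamiltonian_ζ hp (h t ht).1 (h t ht).2,
        isVarDeriv_hamiltonian_v hp (h t ht).1 (h t ht).2, H t ht⟩⟩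
  · rintro ⟨gζ, gv, H⟩ t ht x
    obtain ⟨a, b, c⟩ := H t ht
    rw [← a.unique (isVarDeriv_hamiltonian_ζ hp (h t ht).1 (h t ht).2),
      ← b.unique (isVarDeriv_hamiltonian_v hp (h t ht).1 (h t ht).2)]
    exact c x

end Params

end

section

/-! ### Conservation laws -/

section Conservation

variable {I : Set ℝ} {t : ℝ}

/-- At an isolated time of I every derivative statement holds, while the equations do not determine
the derivative; this case is always split off. -/
theorem hasDerivWithinAt_of_eq_bot {f : ℝ → ℝ} {f' : ℝ} (h : 𝓝[I \ {t}] t = ⊥) :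
    HasDerivWithinAt f f' I t := by
  rw [hasDerivWithinAt_iff_tendsto_slope, h]
  exact tendsto_bot

/-- At a non-isolated time the abstract H^∞ derivative is pinned down by the pointwise evolution
equation. -/
theorem SmDeriv.eq_of_hasDerivWithinAt [NeBot (𝓝[I \ {t}] t)] {f : ℝ → ℝ → ℝ} {f' g : ℝ → ℝ}
    (hf : SmDeriv ∞ I t f f') (h : ∀ x, HasDerivWithinAt (fun s => f s x) (g x) I t) : f' = g :=
  funext fun x => tendsto_nhds_unique
    (hasDerivWithinAt_iff_tendsto_slope.1 (hf.hasDerivWithinAt_apply x))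
    (hasDerivWithinAt_iff_tendsto_slope.1 (h x))

theorem SmDeriv.hasDerivWithinAt_intervalIntegral {f : ℝ → ℝ → ℝ} {f' : ℝ → ℝ}
    (hf : SmDeriv ∞ I t f f') (a b : ℝ) :
    HasDerivWithinAt (fun s => ∫ x in a..b, f s x) (∫ x in a..b, f' x) I t := by
  rw [hasDerivWithinAt_iff_tendsto_slope, Metric.tendsto_nhds]
  intro e he
  have h0 : 0 < e / (|b - a| + 1) := by positivity
  filter_upwards [hf.2.2.forall_abs_lt h0, hf.sm_eventually] with s h1 h2
  have c : ∀ {g : ℝ → ℝ}, Sm ∞ g → IntervalIntegrable g volume a b := fun hg =>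
    hg.1.continuous.intervalIntegrable _ _
  rw [slope_def_field, ← intervalIntegral.integral_sub (c h2) (c hf.1),
    ← intervalIntegral.integral_div, Real.dist_eq,
    ← intervalIntegral.integral_sub (((c h2).sub (c hf.1)).div_const _) (c hf.2.1)]
  have h3 := intervalIntegral.norm_integral_le_of_norm_le_const (a := a) (b := b)
    (f := fun x => (f s x - f t x) / (s - t) - f' x) (C := e / (|b - a| + 1))
    fun x _ => (h1 x).le
  refine h3.trans_lt ?_
  rw [div_mul_eq_mul_div, div_lt_iff₀ (by positivity)]
  nlinarith

/-- A conserved density whose flux has, in the limit, the same value at both ends of the line. -/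
theorem hasDerivWithinAt_integral_zero (hI : I.OrdConnected) {q G : ℝ → ℝ → ℝ}
    (hq : ∀ t ∈ I, ∃ q', SmDeriv ∞ I t q q') (hG : ∀ t ∈ I, ContDiff ℝ ∞ (G t))
    (heq : ∀ t ∈ I, ∀ x, HasDerivWithinAt (fun s => q s x) (-deriv (G t) x) I t)
    (hint : ∀ t ∈ I, Integrable (q t) volume)
    (hlim : TendstoLocallyUniformlyOn (fun x t => G t x - G t (-x)) 0 atTop I) (ht : t ∈ I) :
    HasDerivWithinAt (fun s => ∫ x, q s x) 0 I t := by
  have hm : ∀ R : ℝ, ∀ τ ∈ I, HasDerivWithinAt (fun s => ∫ x in (-R)..R, q s x)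
      (-(G τ R - G τ (-R))) I τ := by
    intro R τ hτ
    rcases eq_or_neBot (𝓝[I \ {τ}] τ) with h | h
    · exact hasDerivWithinAt_of_eq_bot h
    obtain ⟨q', hq'⟩ := hq τ hτ
    have e := hq'.eq_of_hasDerivWithinAt (heq τ hτ)
    refine (hq'.hasDerivWithinAt_intervalIntegral (-R) R).congr_deriv ?_
    have hd : Continuous (deriv (G τ)) := (contDiff_infty_iff_deriv.1 (hG τ hτ)).2.continuous
    rw [e, intervalIntegral.integral_neg, intervalIntegral.integral_deriv_eq_sub
      (fun x _ => ((hG τ hτ).differentiable (by simp)) x) (hd.intervalIntegrable _ _)]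
  have hconst : ∀ s ∈ I, ∫ x, q s x = ∫ x, q t x := by
    intro s hs
    have hJ : Set.uIcc t s ⊆ I := hI.uIcc_subset ht hs
    have hu := (tendstoLocallyUniformlyOn_iff_tendstoUniformlyOn_of_compact
      (isCompact_uIcc (a := t) (b := s))).1 (hlim.mono hJ)
    rw [Metric.tendstoUniformlyOn_iff] at hu
    have hlimit : ∀ τ ∈ I, Tendsto (fun R : ℝ => ∫ x in (-R)..R, q τ x) atTop (𝓝 (∫ x, q τ x)) :=
      fun τ hτ => intervalIntegral_tendsto_integral (hint τ hτ) tendsto_neg_atTop_atBot tendsto_id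
    -- The density is time differentiable in L^∞ only, so the integral over ℝ cannot be
    -- differentiated directly. On [−R, R] the mean value inequality bounds the change between t and
    -- s by |s − t| times the largest flux imbalance, which tends to 0 as R grows.
    have h1 : Tendsto (fun R : ℝ => (∫ x in (-R)..R, q s x) - ∫ x in (-R)..R, q t x) atTop
      (𝓝 ((∫ x, q s x) - ∫ x, q t x)) := (hlimit s hs).sub (hlimit t ht)
    have h2 : Tendsto (fun R : ℝ => (∫ x in (-R)..R, q s x) - ∫ x in (-R)..R, q t x) atTop
        (𝓝 0) := by
      rw [Metric.tendsto_nhds]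
      intro e he
      have h0 : 0 < e / (|s - t| + 1) := by positivity
      filter_upwards [hu _ h0] with R hR
      have h3 := (convex_uIcc t s).norm_image_sub_le_of_norm_hasDerivWithin_le
        (f := fun s => ∫ x in (-R)..R, q s x) (C := e / (|s - t| + 1))
        (fun τ hτ => (hm R τ (hJ hτ)).mono hJ) (fun τ hτ => by
          have := hR τ hτ
          rw [Pi.zero_apply, dist_comm, Real.dist_eq, sub_zero] at this
          rw [norm_neg]
          exact this.le) Set.left_mem_uIcc Set.right_mem_uIcc
      rw [Real.dist_eq, sub_zero]
      refine h3.trans_lt ?_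
      rw [Real.norm_eq_abs, div_mul_eq_mul_div, div_lt_iff₀ (by positivity)]
      nlinarith
    exact sub_eq_zero.1 (tendsto_nhds_unique h1 h2)
  exact (hasDerivWithinAt_const t I (∫ x, q t x)).congr hconst rfl

/-- Decay at infinity, locally uniformly in time. -/
def Decay (I : Set ℝ) (G : ℝ → ℝ → ℝ) : Prop :=
  ∀ t ∈ I, ∀ e > 0, ∃ R, ∀ᶠ s in 𝓝[I] t, ∀ x, R ≤ |x| → |G s x| < e

/-- f(t) decays at infinity, and f(s) is uniformly close to it for s near t. -/
theorem Decay.of_smDeriv {f : ℝ → ℝ → ℝ} (hf : ∀ t ∈ I, ∃ f', SmDeriv 2 I t f f') :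
    Decay I f := by
  intro t ht e he
  obtain ⟨f', hf'⟩ := hf t ht
  have h1 := (tendsto_cocompact_of_hInf hf'.1).abs
  rw [abs_zero, ← Metric.cobounded_eq_cocompact] at h1
  obtain ⟨R, -, hR⟩ := (hasBasis_cobounded_norm.eventually_iff).1
    (h1.eventually_lt_const (half_pos he))
  refine ⟨R, ?_⟩
  -- `SmDeriv` speaks of the punctured neighbourhood; the point s = t is restored separately.
  rw [← Set.insert_eq_of_mem ht, ← Set.insert_sdiff_singleton, nhdsWithin_insert, eventually_sup]
  refine ⟨eventually_pure.2 fun x hx => (hR hx).trans (half_lt_self he), ?_⟩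
  filter_upwards [hf'.top.tendsto.2.forall_abs_lt (half_pos he)] with s hs x hx
  have h2 : |f t x| < e / 2 := hR hx
  have h3 := abs_add_le (f s x - f t x) (f t x)
  rw [sub_add_cancel] at h3
  linarith [hs x]

theorem Decay.mono {G H : ℝ → ℝ → ℝ} (hH : Decay I H) (h : ∀ s ∈ I, ∀ x, |G s x| ≤ |H s x|) :
    Decay I G := by
  intro t ht e he
  obtain ⟨R, hR⟩ := hH t ht e he
  refine ⟨R, ?_⟩
  filter_upwards [hR, self_mem_nhdsWithin] with s h1 h2 x hx
  exact (h s h2 x).trans_lt (h1 x hx)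

theorem Decay.add {G H : ℝ → ℝ → ℝ} (hG : Decay I G) (hH : Decay I H) :
    Decay I fun s x => G s x + H s x := by
  intro t ht e he
  obtain ⟨R, hR⟩ := hG t ht _ (half_pos he)
  obtain ⟨S, hS⟩ := hH t ht _ (half_pos he)
  refine ⟨max R S, ?_⟩
  filter_upwards [hR, hS] with s h1 h2 x hx
  have h3 := abs_add_le (G s x) (H s x)
  linarith [h1 x ((le_max_left _ _).trans hx), h2 x ((le_max_right _ _).trans hx)]

theorem Decay.const_mul (c : ℝ) {G : ℝ → ℝ → ℝ} (hG : Decay I G) :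
    Decay I fun s x => c * G s x := by
  intro t ht e he
  obtain ⟨R, hR⟩ := hG t ht (e / (|c| + 1)) (by positivity)
  refine ⟨R, ?_⟩
  filter_upwards [hR] with s h1 x hx
  have h2 := h1 x hx
  rw [lt_div_iff₀ (by positivity)] at h2
  rw [abs_mul]
  nlinarith [abs_nonneg (G s x), abs_nonneg c]

theorem Decay.tendstoLocallyUniformlyOn {G : ℝ → ℝ → ℝ} (hG : Decay I G) :
    TendstoLocallyUniformlyOn (fun x t => G t x - G t (-x)) 0 atTop I := by
  rw [Metric.tendstoLocallyUniformlyOn_iff]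
  intro e he t ht
  obtain ⟨R, hR⟩ := hG t ht _ (half_pos he)
  refine ⟨_, hR, ?_⟩
  filter_upwards [eventually_ge_atTop R] with x hx s hs
  have h1 := hs x (hx.trans (le_abs_self x))
  have h2 := hs (-x) (by rw [abs_neg]; exact hx.trans (le_abs_self x))
  rw [Pi.zero_apply, dist_comm, Real.dist_eq, sub_zero]
  have h3 := abs_sub (G s x) (G s (-x))
  linarith

end Conservation

namespace Params

variable {p : Params}

theorem decay_deriv_slope (hp : p.Valid) {I : Set ℝ} {ζ : ℝ → ℝ → ℝ}
    (hζ : ∀ t ∈ I, ∃ ζ', SmDeriv 2 I t ζ ζ') :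
    Decay I fun s => deriv (p.slope (ζ s)) := by
  have h2 : Decay I fun s => deriv (deriv (ζ s)) := Decay.of_smDeriv fun t ht => by
    obtain ⟨ζ', h⟩ := hζ t ht
    exact ⟨_, h.deriv.deriv⟩
  refine h2.mono fun s hs x => ?_
  obtain ⟨ζ', h⟩ := hζ s hs
  exact abs_deriv_tilt_le hp.surf_nonneg (Sm.deriv h.1) x

section GN

variable {I : Set ℝ} {ζ w : ℝ → ℝ → ℝ}

theorem decay_grad (hp : p.Valid) (hA : ∀ t ∈ I, p.Adm (ζ t))
    (hζ : ∀ t ∈ I, ∃ ζ', SmDeriv 2 I t ζ ζ') (hw : ∀ t ∈ I, ∃ w', SmDeriv 2 I t w w') :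
    Decay I fun s => p.grad (ζ s) (w s) := by
  have hK : Decay I fun s => p.K (ζ s) (w s) := Decay.of_smDeriv fun t ht => by
    obtain ⟨ζ', h1⟩ := hζ t ht
    obtain ⟨w', h2⟩ := hw t ht
    exact exists_smDeriv_K hp h1 h2 (hA t ht).depth₁ ((hA t ht).depth₂ hp)
  have h := (((Decay.of_smDeriv hζ).const_mul (p.γ + p.δ)).add
    ((decay_deriv_slope hp hζ).const_mul (-((p.γ + p.δ) * p.iBo)))).add (hK.const_mul p.ε)
  refine h.mono fun s _ x => le_of_eq ?_
  simp only [grad, gradPot]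
  ring_nf

/-- Along the solution the energy is half of the potential term plus ∫ vw, so no inverse has to be
differentiated in time. The identity of `exists_smDeriv_A` turns its derivative into ∫ (δH/δζ) ∂ₜζ +
∫ w ∂ₜv, which is −∫ ∂ₓ(w δH/δζ) = 0. -/
theorem hasDerivWithinAt_energy (hp : p.Valid) (hA : ∀ t ∈ I, p.Adm (ζ t))
    (hζ : ∀ t ∈ I, ∃ ζ', SmDeriv 2 I t ζ ζ') (hw : ∀ t ∈ I, ∃ w', SmDeriv 2 I t w w')
    (hsol : p.IsGNSol I ζ w) {t : ℝ} (ht : t ∈ I) :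
    HasDerivWithinAt (fun s => p.hamiltonian (ζ s) (p.A (ζ s) (w s))) 0 I t := by
  rcases eq_or_neBot (𝓝[I \ {t}] t) with h | h
  · exact hasDerivWithinAt_of_eq_bot h
  have hwI : ∀ t ∈ I, HInf (w t) := fun t ht => (hw t ht).choose_spec.1
  have hs := (isGNSol_iff hp fun t ht => ⟨hA t ht, hwI t ht⟩).1 hsol t ht
  obtain ⟨ζ', h1⟩ := hζ t ht
  obtain ⟨w', h2⟩ := hw t ht
  obtain ⟨v', h3, h4⟩ := exists_smDeriv_A hp h1 h2 (hA t ht).depth₁ ((hA t ht).depth₂ hp)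
  have eζ := h1.top.eq_of_hasDerivWithinAt fun x => (hs x).1
  have ev := h3.top.eq_of_hasDerivWithinAt fun x => (hs x).2
  have hvw : SmDeriv 1 I t _ _ := h3.mul h2
  have hH := ((hasDerivWithinAt_pot hp h1).add hvw.hasDerivWithinAt_integral).const_mul (1 / 2)
  refine (hH.congr (fun s hs => hamiltonian_A hp (hA s hs) (hwI s hs))
    (hamiltonian_A hp (hA t ht) (hwI t ht))).congr_deriv ?_
  have hv := hInf_A hp (hA t ht).depth₁ ((hA t ht).depth₂ hp) h2.1
  have hg := hInf_grad hp (hA t ht) h2.1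
  have i1 := HInf.mul_integrable h3.2.1 h2.1
  have i2 := HInf.mul_integrable hv h2.2.1
  rw [integral_sub i1 i2] at h4
  have e1 := integral_grad_mul hp (hA t ht) h2.1 h1.2.1
  have e2 : ∫ x, p.ε * p.K (ζ t) (w t) x * ζ' x = p.ε * ∫ x, p.K (ζ t) (w t) x * ζ' x := by
    rw [← integral_const_mul]
    exact integral_congr_ae (Eventually.of_forall fun x => by ring)
  have e3 : (∫ x, p.grad (ζ t) (w t) x * ζ' x) + ∫ x, v' x * w t x = 0 := by
    have := integral_mul_deriv_hInf hg h2.1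
    have a1 : ∫ x, p.grad (ζ t) (w t) x * ζ' x = -∫ x, p.grad (ζ t) (w t) x * deriv (w t) x := by
      rw [eζ, ← integral_neg]
      exact integral_congr_ae (Eventually.of_forall fun x => by ring)
    have a2 : ∫ x, v' x * w t x = -∫ x, deriv (p.grad (ζ t) (w t)) x * w t x := by
      rw [ev, ← integral_neg]
      exact integral_congr_ae (Eventually.of_forall fun x => by ring)
    rw [a1, a2, this]
    ring
  rw [integral_add i1 i2]
  rw [e1, e2] at e3
  linarith

/-- After integration by parts the integrand is ∂ₓζ ∂ₓ²ζ / √(1 + με²|∂ₓζ|²), an exact derivative up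
to the factor με². -/
theorem integral_deriv_mul_deriv_slope (hp : p.Valid) {ζ : ℝ → ℝ} (hζ : HInf ζ) :
    ∫ x, deriv (p.slope ζ) x * deriv ζ x = 0 := by
  have hd := Sm.deriv hζ
  have hS := hInf_slope hp hζ
  have h0 : p.μ * p.ε ^ 2 ≠ 0 := mul_ne_zero hp.μ_pos.ne' (pow_ne_zero 2 hp.ε_pos.ne')
  have hder : ∀ x, HasDerivAt (fun x => √(1 + p.μ * p.ε ^ 2 * deriv ζ x ^ 2) - 1)
      (p.μ * p.ε ^ 2 * (p.slope ζ x * deriv (deriv ζ) x)) x := fun x => by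
    have hpos : 0 < 1 + p.μ * p.ε ^ 2 * deriv ζ x ^ 2 := by
      have := mul_nonneg hp.surf_nonneg (sq_nonneg (deriv ζ x))
      linarith
    have h1 := (((((hd.hasDerivAt x).pow 2).const_mul (p.μ * p.ε ^ 2)).const_add 1).sqrt
      hpos.ne').sub_const 1
    refine h1.congr_deriv ?_
    have := (Real.sqrt_pos.2 hpos).ne'
    simp only [slope, Nat.cast_ofNat, Pi.pow_apply]
    field_simp
    ring
  have h1 : ∫ x, p.slope ζ x * deriv (deriv ζ) x = 0 := by
    have := integral_eq_zero_of_hasDerivAt_of_integrable hder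
      ((HInf.mul_integrable hS hd.deriv).const_mul _) (integrable_surf hp.surf_nonneg hd)
    rw [integral_const_mul] at this
    exact (mul_eq_zero.1 this).resolve_left h0
  have h2 := integral_mul_deriv_hInf hS hd
  linarith

/-- Invariance of the Hamiltonian under translations. The potential part is invariant by itself and
contributes 0; each layer contributes `integral_layerA_mul_deriv`. -/
theorem integral_grad_mul_deriv (hp : p.Valid) {ζ w : ℝ → ℝ} (hζ : p.Adm ζ) (hw : HInf w) :
    ∫ x, p.grad ζ w x * deriv ζ x = ∫ x, p.A ζ w x * deriv w x := by
  have h1 := hζ.depth₁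
  have h2 := hζ.depth₂ hp
  have hd : HInf (deriv ζ) := Sm.deriv hζ.1
  have dw : HInf (deriv w) := Sm.deriv hw
  have u1 := h1.inv.top_mul hw
  have u2 := h2.inv.top_mul hw
  have key1 := integral_layerA_mul_deriv hp.F₁_mult p.μ h1 u1
  have key2 := integral_layerA_mul_deriv hp.F₂_mult p.μ h2 u2
  have b1 : (fun y => p.h₁ ζ y * ((p.h₁ ζ y)⁻¹ * w y)) = w := by
    ext y; rw [mul_inv_cancel_left₀ (h1.pos y).ne']
  have b2 : (fun y => p.h₂ ζ y * ((p.h₂ ζ y)⁻¹ * w y)) = w := by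
    ext y; rw [mul_inv_cancel_left₀ (h2.pos y).ne']
  rw [b1] at key1
  rw [b2] at key2
  have d1 : ∀ x, deriv (p.h₁ ζ) x = -(p.ε * deriv ζ x) := fun x =>
    (((Sm.hasDerivAt hζ.1 x).const_mul p.ε).const_sub 1).deriv
  have d2 : ∀ x, deriv (p.h₂ ζ) x = p.ε * deriv ζ x := fun x =>
    (((Sm.hasDerivAt hζ.1 x).const_mul p.ε).const_add p.δ⁻¹).deriv
  have k1 := hInf_layerK (μ := p.μ) hp.F₁_mult h1 u1
  have k2 := hInf_layerK (μ := p.μ) hp.F₂_mult h2 u2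
  have m1 := hInf_layerA (μ := p.μ) hp.F₁_mult h1 hw
  have m2 := hInf_layerA (μ := p.μ) hp.F₂_mult h2 hw
  have hS : HInf (deriv (p.slope ζ)) := Sm.deriv (hInf_slope hp hζ.1)
  have e0 : ∫ x, p.gradPot ζ x * deriv ζ x = 0 := by
    have a1 : ∫ x, ζ x * deriv ζ x = 0 := by
      have h3 := integral_mul_deriv_hInf hζ.1 hζ.1
      have h4 : ∫ x, deriv ζ x * ζ x = ∫ x, ζ x * deriv ζ x :=
        integral_congr_ae (Eventually.of_forall fun x => by ring)
      linarith
    have a2 : ∫ x, p.gradPot ζ x * deriv ζ x = (p.γ + p.δ) * (∫ x, ζ x * deriv ζ x)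
        - (p.γ + p.δ) * p.iBo * ∫ x, deriv (p.slope ζ) x * deriv ζ x := by
      rw [← integral_const_mul, ← integral_const_mul, ← integral_sub
        ((HInf.mul_integrable hζ.1 hd).const_mul _) ((HInf.mul_integrable hS hd).const_mul _)]
      exact integral_congr_ae (Eventually.of_forall fun x => by simp only [gradPot]; ring)
    rw [a2, a1, integral_deriv_mul_deriv_slope hp hζ.1]
    ring
  have e1 : ∫ x, p.ε * p.K ζ w x * deriv ζ x =
      (∫ x, deriv (p.h₂ ζ) x * (1 / 2 * ((p.h₂ ζ x)⁻¹ * w x) ^ 2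
        - p.μ * layerR p.F₂ p.μ (p.h₂ ζ) (fun y => (p.h₂ ζ y)⁻¹ * w y) x)) + p.γ *
      ∫ x, deriv (p.h₁ ζ) x * (1 / 2 * ((p.h₁ ζ x)⁻¹ * w x) ^ 2
        - p.μ * layerR p.F₁ p.μ (p.h₁ ζ) (fun y => (p.h₁ ζ y)⁻¹ * w y) x) := by
    have j1 : Integrable fun x => deriv (p.h₁ ζ) x * (1 / 2 * ((p.h₁ ζ x)⁻¹ * w x) ^ 2
        - p.μ * layerR p.F₁ p.μ (p.h₁ ζ) (fun y => (p.h₁ ζ y)⁻¹ * w y) x) := by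
      simp only [d1]
      exact HInf.mul_integrable (Sm.neg (Sm.const_mul _ hd)) k1
    have j2 : Integrable fun x => deriv (p.h₂ ζ) x * (1 / 2 * ((p.h₂ ζ x)⁻¹ * w x) ^ 2
        - p.μ * layerR p.F₂ p.μ (p.h₂ ζ) (fun y => (p.h₂ ζ y)⁻¹ * w y) x) := by
      simp only [d2]
      exact HInf.mul_integrable (Sm.const_mul _ hd) k2
    rw [← integral_const_mul, ← integral_add j2 (j1.const_mul _)]
    refine integral_congr_ae (Eventually.of_forall fun x => ?_)
    simp only [d1, d2, K, layerK]
    ring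
  rw [integral_grad_mul hp hζ hw hd, e0, e1, ← key1, ← key2, zero_add, ← integral_const_mul,
    ← integral_add (HInf.mul_integrable m2 dw) ((HInf.mul_integrable m1 dw).const_mul _)]
  exact integral_congr_ae (Eventually.of_forall fun x => by simp only [A]; ring)

theorem hasDerivWithinAt_impulse (hp : p.Valid) (hA : ∀ t ∈ I, p.Adm (ζ t))
    (hζ : ∀ t ∈ I, ∃ ζ', SmDeriv 2 I t ζ ζ') (hw : ∀ t ∈ I, ∃ w', SmDeriv 2 I t w w')
    (hsol : p.IsGNSol I ζ w) {t : ℝ} (ht : t ∈ I) :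
    Integrable (fun x => ζ t x * p.A (ζ t) (w t) x) volume ∧
      HasDerivWithinAt (fun s => ∫ x, ζ s x * p.A (ζ s) (w s) x) 0 I t := by
  have hwI : ∀ t ∈ I, HInf (w t) := fun t ht => (hw t ht).choose_spec.1
  have hv := hInf_A hp (hA t ht).depth₁ ((hA t ht).depth₂ hp) (hwI t ht)
  refine ⟨HInf.mul_integrable (hA t ht).1 hv, ?_⟩
  rcases eq_or_neBot (𝓝[I \ {t}] t) with h | h
  · exact hasDerivWithinAt_of_eq_bot h
  have hs := (isGNSol_iff hp fun t ht => ⟨hA t ht, hwI t ht⟩).1 hsol t ht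
  obtain ⟨ζ', h1⟩ := hζ t ht
  obtain ⟨w', h2⟩ := hw t ht
  obtain ⟨v', h3, -⟩ := exists_smDeriv_A hp h1 h2 (hA t ht).depth₁ ((hA t ht).depth₂ hp)
  have eζ := h1.top.eq_of_hasDerivWithinAt fun x => (hs x).1
  have ev := h3.top.eq_of_hasDerivWithinAt fun x => (hs x).2
  have hvw : SmDeriv 1 I t _ _ := h1.mul h3
  refine hvw.hasDerivWithinAt_integral.congr_deriv ?_
  have hg := hInf_grad hp (hA t ht) h2.1
  rw [integral_add (HInf.mul_integrable h1.2.1 hv) (HInf.mul_integrable h1.1 h3.2.1)]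
  have a1 : ∫ x, ζ' x * p.A (ζ t) (w t) x = -∫ x, p.A (ζ t) (w t) x * deriv (w t) x := by
    rw [eζ, ← integral_neg]
    exact integral_congr_ae (Eventually.of_forall fun x => by ring)
  have a2 : ∫ x, ζ t x * v' x = -∫ x, ζ t x * deriv (p.grad (ζ t) (w t)) x := by
    rw [ev, ← integral_neg]
    exact integral_congr_ae (Eventually.of_forall fun x => by ring)
  have a3 : ∫ x, deriv (ζ t) x * p.grad (ζ t) (w t) x = ∫ x, p.grad (ζ t) (w t) x * deriv (ζ t) x :=
    integral_congr_ae (Eventually.of_forall fun x => by ring)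
  rw [a1, a2, integral_mul_deriv_hInf h1.1 hg, a3, integral_grad_mul_deriv hp (hA t ht) h2.1]
  ring

theorem hasDerivWithinAt_mass (hp : p.Valid) (hI : I.OrdConnected) (hA : ∀ t ∈ I, p.Adm (ζ t))
    (hζ : ∀ t ∈ I, ∃ ζ', SmDeriv 2 I t ζ ζ') (hw : ∀ t ∈ I, ∃ w', SmDeriv 2 I t w w')
    (hsol : p.IsGNSol I ζ w) (hint : ∀ t ∈ I, Integrable (ζ t) volume) {t : ℝ} (ht : t ∈ I) :
    HasDerivWithinAt (fun s => ∫ x, ζ s x) 0 I t := by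
  have hwI : ∀ t ∈ I, HInf (w t) := fun t ht => (hw t ht).choose_spec.1
  have hs := (isGNSol_iff hp fun t ht => ⟨hA t ht, hwI t ht⟩).1 hsol
  exact hasDerivWithinAt_integral_zero hI (G := w)
    (fun t ht => (hζ t ht).imp fun _ h => h.top) (fun t ht => (hwI t ht).1)
    (fun t ht x => (hs t ht x).1) hint (Decay.of_smDeriv hw).tendstoLocallyUniformlyOn ht

theorem hasDerivWithinAt_velocity_mass (hp : p.Valid) (hI : I.OrdConnected)
    (hA : ∀ t ∈ I, p.Adm (ζ t))
    (hζ : ∀ t ∈ I, ∃ ζ', SmDeriv 2 I t ζ ζ') (hw : ∀ t ∈ I, ∃ w', SmDeriv 2 I t w w')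
    (hsol : p.IsGNSol I ζ w) (hint : ∀ t ∈ I, Integrable (p.momentum (ζ t) (w t)) volume)
    {t : ℝ} (ht : t ∈ I) :
    HasDerivWithinAt (fun s => ∫ x, p.momentum (ζ s) (w s) x) 0 I t := by
  have hwI : ∀ t ∈ I, HInf (w t) := fun t ht => (hw t ht).choose_spec.1
  have hs := (isGNSol_iff hp fun t ht => ⟨hA t ht, hwI t ht⟩).1 hsol
  have e : ∀ s ∈ I, p.A (ζ s) (w s) = p.momentum (ζ s) (w s) := fun s hs =>
    A_eq_momentum hp (hA s hs).depth₁ ((hA s hs).depth₂ hp) (hwI s hs)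
  have h := hasDerivWithinAt_integral_zero hI (q := fun s => p.A (ζ s) (w s))
    (G := fun s => p.grad (ζ s) (w s)) (fun t ht => by
      obtain ⟨ζ', h1⟩ := hζ t ht
      obtain ⟨w', h2⟩ := hw t ht
      obtain ⟨v', h3, -⟩ := exists_smDeriv_A hp h1 h2 (hA t ht).depth₁ ((hA t ht).depth₂ hp)
      exact ⟨v', h3.top⟩) (fun t ht => (hInf_grad hp (hA t ht) (hwI t ht)).1)
    (fun t ht x => (hs t ht x).2) (fun t ht => by rw [e t ht]; exact hint t ht)
    (decay_grad hp hA hζ hw).tendstoLocallyUniformlyOn ht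
  exact h.congr (fun s hs => by rw [e s hs]) (by rw [e t ht])

end GN

end Params

end

section

/-! ### One layer in the four-equation form -/

section Layer

variable {F : ℝ → ℝ} {μ : ℝ} {h u : ℝ → ℝ}

theorem Depth.exists_coerciveForm (hF : IsMultiplierFunction F) (hμ : 0 < μ) (hh : Depth h) :
    ∃ κ, CoerciveForm (LayerDom F μ h) (layerForm F μ h) κ := by
  obtain ⟨κ, h0, hκ⟩ := hh.exists_le_inv
  exact ⟨κ, coerciveForm_layer hF hμ hh h0 hκ⟩

theorem hInf_layerV (hF : IsMultiplierFunction F) (hh : Depth h) (hu : HInf u) :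
    HInf (layerA F μ h fun y => h y * u y) :=
  hInf_layerA hF hh (hh.1.top_mul hu)

theorem layerAInv_layerA (hF : IsMultiplierFunction F) (hμ : 0 < μ) (hh : Depth h) (hu : HInf u) :
    layerAInv F μ h (layerA F μ h fun y => h y * u y) =ᵐ[volume] fun y => h y * u y := by
  obtain ⟨κ, hq⟩ := hh.exists_coerciveForm hF hμ
  exact hq.formInv_ae_eq (hInf_layerV hF hh hu).memLp (isFormSol_layerA hF hh (hh.1.top_mul hu))

theorem integrable_mul_layerAInv (hF : IsMultiplierFunction F) (hμ : 0 < μ) (hh : Depth h)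
    {v : ℝ → ℝ} (hv : HInf v) : Integrable fun x => v x * layerAInv F μ h v x := by
  obtain ⟨κ, hq⟩ := hh.exists_coerciveForm hF hμ
  exact hq.integrable_mul_formInv hv.memLp

theorem hasDerivAt_layerAInv_depth (hF : IsMultiplierFunction F) (hμ : 0 < μ) (hh : Depth h)
    (hu : HInf u) {φ : ℝ → ℝ} (hφ : Sm ∞ φ) :
    HasDerivAt (fun s => ∫ x, layerA F μ h (fun y => h y * u y) x *
        layerAInv F μ (fun x => h x + s * φ x) (layerA F μ h fun y => h y * u y) x)
      (2 * ∫ x, layerK F μ h u x * φ x) 0 := by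
  have e : (fun z => (h z)⁻¹ * (h z * u z)) = u := by
    ext z; rw [inv_mul_cancel_left₀ (hh.pos z).ne']
  have := hasDerivAt_integral_layerAInv hF hμ hh hφ (hh.1.top_mul hu)
  rwa [e] at this

theorem eventually_integrable_layerAInv (hF : IsMultiplierFunction F) (hμ : 0 < μ) (hh : Depth h)
    {φ v : ℝ → ℝ} (hφ : Sm ∞ φ) (hv : HInf v) : ∀ᶠ s in 𝓝 (0 : ℝ),
      Integrable fun x => v x * layerAInv F μ (fun x => h x + s * φ x) v x := by
  obtain ⟨κ, _, hev⟩ := hh.eventually_affine hφ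
  exact hev.mono fun s hs => integrable_mul_layerAInv hF hμ hs.1 hv

theorem hasDerivAt_layerAInv_velocity (hF : IsMultiplierFunction F) (hμ : 0 < μ) (hh : Depth h)
    (hu : HInf u) {φ : ℝ → ℝ} (hφ : HInf φ) :
    HasDerivAt (fun s => ∫ x, (layerA F μ h (fun y => h y * u y) x + s * φ x) *
        layerAInv F μ h (fun x => layerA F μ h (fun y => h y * u y) x + s * φ x) x)
      (2 * ∫ x, h x * u x * φ x) 0 := by
  obtain ⟨κ, hq⟩ := hh.exists_coerciveForm hF hμ
  exact hq.hasDerivAt_integral_mul_formInv (hInf_layerV hF hh hu).memLp hφ.memLp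
    (isFormSol_layerA hF hh (hh.1.top_mul hu))

end Layer

theorem hasDerivAt_integral_quadratic {B X Y : ℝ → ℝ} (hB : Integrable B) (hX : Integrable X)
    (hY : Integrable Y) :
    HasDerivAt (fun s : ℝ => ∫ x, (B x + s * X x + s ^ 2 * Y x)) (∫ x, X x) 0 := by
  have e : ∀ s : ℝ, ∫ x, (B x + s * X x + s ^ 2 * Y x) =
      (∫ x, B x) + s * (∫ x, X x) + s ^ 2 * ∫ x, Y x := fun s => by
    rw [integral_add (f := fun x => B x + s * X x) (hB.add (hX.const_mul s)) (hY.const_mul _), integral_add hB (hX.const_mul s),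
      integral_const_mul, integral_const_mul]
  simp only [e]
  have h := (((hasDerivAt_id (0 : ℝ)).mul_const (∫ x, X x)).const_add (∫ x, B x)).add
    (((hasDerivAt_id (0 : ℝ)).pow 2).mul_const (∫ x, Y x))
  convert! h using 1
  simp

/-- The pressure P₁ is merely smooth, with no decay; compact support of the variation supplies
integrability. -/
theorem integrable_mul_test {g φ : ℝ → ℝ} (hg : Continuous g) (hφ : Continuous φ)
    (hc : HasCompactSupport φ) : Integrable fun x => g x * φ x :=
  (hg.mul hφ).integrable_of_hasCompactSupport hc.mul_left

namespace Params

variable {p : Params} {ζ u₁ u₂ P₁ : ℝ → ℝ} {c₀ c₁ c₂ : ℝ}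

theorem v₁_eq (h1 : Depth (p.h₁ ζ)) (u : ℝ → ℝ) :
    p.v₁ ζ u = layerA p.F₁ p.μ (p.h₁ ζ) fun x => p.h₁ ζ x * u x :=
  funext fun x => layerQ_momentum h1 x

theorem v₂_eq (h2 : Depth (p.h₂ ζ)) (u : ℝ → ℝ) :
    p.v₂ ζ u = layerA p.F₂ p.μ (p.h₂ ζ) fun x => p.h₂ ζ x * u x :=
  funext fun x => layerQ_momentum h2 x

theorem hasDerivAt_h₁ (hζ : HInf ζ) (x : ℝ) : HasDerivAt (p.h₁ ζ) (-(p.ε * deriv ζ x)) x :=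
  ((Sm.hasDerivAt hζ x).const_mul p.ε).const_sub 1

theorem hasDerivAt_h₂ (hζ : HInf ζ) (x : ℝ) : HasDerivAt (p.h₂ ζ) (p.ε * deriv ζ x) x :=
  ((Sm.hasDerivAt hζ x).const_mul p.ε).const_add p.δ⁻¹

theorem hInf_deriv_h₂ (hζ : HInf ζ) : HInf (deriv (p.h₂ ζ)) :=
  Sm.congr (Sm.const_mul p.ε (Sm.deriv hζ)) fun x => (hasDerivAt_h₂ hζ x).deriv.symm

/-- The part of `density4` without derivatives. -/
def poly4 (p : Params) (c₀ c₁ c₂ : ℝ) (P₁ h₁ h₂ : ℝ → ℝ) : ℝ → ℝ := fun x =>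
  1 / p.ε ^ 2 * ((p.γ + p.δ) / (1 - p.γ)) * p.pot4 c₀ c₁ c₂ h₁ h₂ x
    + 2 / p.ε * (h₁ x + h₂ x - (1 + p.δ⁻¹)) * P₁ x

/-- At the actual depths h₁ + h₂ = 1 + δ⁻¹, so the multiplier term vanishes identically whatever the
growth of P₁. -/
theorem integrable_poly4 (h : Integrable (p.pot4 c₀ c₁ c₂ (p.h₁ ζ) (p.h₂ ζ)) volume) :
    Integrable (p.poly4 c₀ c₁ c₂ P₁ (p.h₁ ζ) (p.h₂ ζ)) :=
  (h.const_mul (1 / p.ε ^ 2 * ((p.γ + p.δ) / (1 - p.γ)))).congr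
    (Eventually.of_forall fun x => by simp only [poly4, h₁, h₂]; ring)

theorem poly4_affine₁ (h₁ h₂ φ : ℝ → ℝ) (s x : ℝ) :
    p.poly4 c₀ c₁ c₂ P₁ (fun x => h₁ x + s * φ x) h₂ x = p.poly4 c₀ c₁ c₂ P₁ h₁ h₂ x
      + s * ((2 * (1 / p.ε ^ 2 * ((p.γ + p.δ) / (1 - p.γ)) * (-(p.γ * h₁ x) - c₁ / 2)
        + 1 / p.ε * P₁ x)) * φ x)
      + s ^ 2 * (-(1 / p.ε ^ 2 * ((p.γ + p.δ) / (1 - p.γ)) * p.γ) * φ x * φ x) := by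
  simp only [poly4, pot4]
  ring

theorem poly4_affine₂ (h₁ h₂ φ : ℝ → ℝ) (s x : ℝ) :
    p.poly4 c₀ c₁ c₂ P₁ h₁ (fun x => h₂ x + s * φ x) x = p.poly4 c₀ c₁ c₂ P₁ h₁ h₂ x
      + s * ((2 * (1 / p.ε ^ 2 * ((p.γ + p.δ) / (1 - p.γ)) * (h₂ x - c₂ / 2)
        + 1 / p.ε * P₁ x)) * φ x)
      + s ^ 2 * (1 / p.ε ^ 2 * ((p.γ + p.δ) / (1 - p.γ)) * φ x * φ x) := by
  simp only [poly4, pot4]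
  ring

theorem hamiltonian4_eq {h₁ h₂ v₁ v₂ : ℝ → ℝ} (i0 : Integrable (p.poly4 c₀ c₁ c₂ P₁ h₁ h₂))
    (is : Integrable fun x => √(1 + p.μ * deriv h₂ x ^ 2) - 1)
    (i1 : Integrable fun x => v₁ x * layerAInv p.F₁ p.μ h₁ v₁ x)
    (i2 : Integrable fun x => v₂ x * layerAInv p.F₂ p.μ h₂ v₂ x) :
    p.hamiltonian4 c₀ c₁ c₂ P₁ h₁ h₂ v₁ v₂ = 1 / 2 * ((∫ x, p.poly4 c₀ c₁ c₂ P₁ h₁ h₂ x)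
      + 2 * (p.γ + p.δ) * p.iBo / (p.μ * p.ε ^ 2) * (∫ x, (√(1 + p.μ * deriv h₂ x ^ 2) - 1))
      + p.γ * (∫ x, v₁ x * layerAInv p.F₁ p.μ h₁ v₁ x)
      + ∫ x, v₂ x * layerAInv p.F₂ p.μ h₂ v₂ x) := by
  have is' := is.const_mul (2 * (p.γ + p.δ) * p.iBo / (p.μ * p.ε ^ 2))
  have i1' := i1.const_mul p.γ
  have key : ∫ x, (p.poly4 c₀ c₁ c₂ P₁ h₁ h₂ x
      + 2 * (p.γ + p.δ) * p.iBo / (p.μ * p.ε ^ 2) * (√(1 + p.μ * deriv h₂ x ^ 2) - 1)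
      + p.γ * (v₁ x * layerAInv p.F₁ p.μ h₁ v₁ x) + v₂ x * layerAInv p.F₂ p.μ h₂ v₂ x) = _ :=
    integral_add ((i0.add is').add i1') i2
  have key2 : ∫ x, (p.poly4 c₀ c₁ c₂ P₁ h₁ h₂ x
      + 2 * (p.γ + p.δ) * p.iBo / (p.μ * p.ε ^ 2) * (√(1 + p.μ * deriv h₂ x ^ 2) - 1)
      + p.γ * (v₁ x * layerAInv p.F₁ p.μ h₁ v₁ x)) = _ := integral_add (i0.add is') i1'
  have key3 : ∫ x, (p.poly4 c₀ c₁ c₂ P₁ h₁ h₂ x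
      + 2 * (p.γ + p.δ) * p.iBo / (p.μ * p.ε ^ 2) * (√(1 + p.μ * deriv h₂ x ^ 2) - 1)) = _ :=
    integral_add i0 is'
  rw [key2, key3, integral_const_mul, integral_const_mul] at key
  rw [← key, hamiltonian4]
  congr 1
  refine integral_congr_ae (Eventually.of_forall fun x => ?_)
  simp only [density4, poly4]
  ring

theorem hamiltonian4_eq_hamiltonian4u (hp : p.Valid) (hζ : p.Adm ζ) (hu₁ : HInf u₁)
    (hu₂ : HInf u₂) (hC : Integrable (p.pot4 c₀ c₁ c₂ (p.h₁ ζ) (p.h₂ ζ)) volume) :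
    p.hamiltonian4 c₀ c₁ c₂ P₁ (p.h₁ ζ) (p.h₂ ζ) (p.v₁ ζ u₁) (p.v₂ ζ u₂) =
      p.hamiltonian4u c₀ c₁ c₂ P₁ (p.h₁ ζ) (p.h₂ ζ) u₁ u₂ := by
  have h1 := hζ.depth₁
  have h2 := hζ.depth₂ hp
  have i0 := integrable_poly4 (P₁ := P₁) hC
  have is := integrable_surf hp.μ_pos.le (hInf_deriv_h₂ (p := p) hζ.1)
  obtain ⟨j1, k1⟩ := integral_layerA_self (μ := p.μ) hp.F₁_mult h1 hu₁
  obtain ⟨j2, k2⟩ := integral_layerA_self (μ := p.μ) hp.F₂_mult h2 hu₂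
  have l1 : ∀ {F h u : ℝ → ℝ}, IsMultiplierFunction F → Depth h → HInf u →
      ∫ x, layerA F p.μ h (fun y => h y * u y) x *
        layerAInv F p.μ h (layerA F p.μ h fun y => h y * u y) x =
      ∫ x, layerA F p.μ h (fun y => h y * u y) x * (h x * u x) := fun hF hh hu =>
    integral_congr_ae (by
      filter_upwards [layerAInv_layerA hF hp.μ_pos hh hu] with x hx
      rw [hx])
  rw [v₁_eq h1, v₂_eq h2, hamiltonian4_eq i0 is
    (integrable_mul_layerAInv hp.F₁_mult hp.μ_pos h1 (hInf_layerV hp.F₁_mult h1 hu₁))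
    (integrable_mul_layerAInv hp.F₂_mult hp.μ_pos h2 (hInf_layerV hp.F₂_mult h2 hu₂)),
    l1 hp.F₁_mult h1 hu₁, l1 hp.F₂_mult h2 hu₂, k1, k2, ← integral_const_mul, ← integral_const_mul,
    ← integral_add i0 (is.const_mul _), hamiltonian4u]
  congr 1
  have a1 := integral_add (i0.add (is.const_mul (2 * (p.γ + p.δ) * p.iBo / (p.μ * p.ε ^ 2))))
    (j1.const_mul p.γ)
  have a2 := integral_add ((i0.add (is.const_mul (2 * (p.γ + p.δ) * p.iBo / (p.μ * p.ε ^ 2)))).add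
    (j1.const_mul p.γ)) j2
  simp only [Pi.add_apply] at a1 a2
  rw [← a1, ← a2]
  refine integral_congr_ae (Eventually.of_forall fun x => ?_)
  simp only [density4, poly4]
  ring

/-- Functional derivative of the four-variable Hamiltonian with respect to `h₁`. -/
def grad4₁ (p : Params) (c₁ : ℝ) (ζ u₁ P₁ : ℝ → ℝ) : ℝ → ℝ := fun x =>
  1 / p.ε ^ 2 * ((p.γ + p.δ) / (1 - p.γ)) * (-(p.γ * p.h₁ ζ x) - c₁ / 2)
    + 1 / p.ε * P₁ x + p.γ * layerK p.F₁ p.μ (p.h₁ ζ) u₁ x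

/-- Functional derivative of the four-variable Hamiltonian with respect to `h₂`. -/
def grad4₂ (p : Params) (c₂ : ℝ) (ζ u₂ P₁ : ℝ → ℝ) : ℝ → ℝ := fun x =>
  1 / p.ε ^ 2 * ((p.γ + p.δ) / (1 - p.γ)) * (p.h₂ ζ x - c₂ / 2)
    + 1 / p.ε * P₁ x
    - (p.γ + p.δ) * p.iBo / p.ε ^ 2 * deriv (fun y => tilt p.μ (deriv (p.h₂ ζ) y)) x
    + layerK p.F₂ p.μ (p.h₂ ζ) u₂ x

theorem contDiff_grad4₁ (hp : p.Valid) (hζ : p.Adm ζ) (hu₁ : HInf u₁) (hP : ContDiff ℝ ∞ P₁) :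
    ContDiff ℝ ∞ (p.grad4₁ c₁ ζ u₁ P₁) := by
  have h1 := hζ.depth₁.1.1
  have h3 := (hInf_layerK (μ := p.μ) hp.F₁_mult hζ.depth₁ hu₁).1
  unfold grad4₁
  fun_prop

theorem contDiff_grad4₂ (hp : p.Valid) (hζ : p.Adm ζ) (hu₂ : HInf u₂) (hP : ContDiff ℝ ∞ P₁) :
    ContDiff ℝ ∞ (p.grad4₂ c₂ ζ u₂ P₁) := by
  have h1 := (hζ.depth₂ hp).1.1
  have h3 := (hInf_layerK (μ := p.μ) hp.F₂_mult (hζ.depth₂ hp) hu₂).1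
  have h4 := (Sm.deriv (hInf_tilt hp.μ_pos.le (hInf_deriv_h₂ (p := p) hζ.1))).1
  unfold grad4₂
  fun_prop

/-- The energy splits into four integrals, and each variation touches only some of them. The
polynomial part is exactly quadratic in s, the capillary part sees only h₂, and each kinetic part
sees only its own layer. -/
theorem isGradient4 (hp : p.Valid) (hζ : p.Adm ζ) (hu₁ : HInf u₁) (hu₂ : HInf u₂)
    (hP : ContDiff ℝ ∞ P₁) (hC : Integrable (p.pot4 c₀ c₁ c₂ (p.h₁ ζ) (p.h₂ ζ)) volume) :
    p.IsGradient4 c₀ c₁ c₂ P₁ (p.h₁ ζ) (p.h₂ ζ) (p.v₁ ζ u₁) (p.v₂ ζ u₂)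
      (p.grad4₁ c₁ ζ u₁ P₁) (p.grad4₂ c₂ ζ u₂ P₁)
      (fun x => p.γ * (p.h₁ ζ x * u₁ x)) (fun x => p.h₂ ζ x * u₂ x) := by
  have h1 := hζ.depth₁
  have h2 := hζ.depth₂ hp
  have c1 := h1.1.1.continuous
  have c2 := h2.1.1.continuous
  have cP := hP.continuous
  have i0 := integrable_poly4 (P₁ := P₁) hC
  have dh := hInf_deriv_h₂ (p := p) hζ.1
  have is := integrable_surf hp.μ_pos.le dh
  have hv1 := hInf_layerV (μ := p.μ) hp.F₁_mult h1 hu₁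
  have hv2 := hInf_layerV (μ := p.μ) hp.F₂_mult h2 hu₂
  have i1 := integrable_mul_layerAInv hp.F₁_mult hp.μ_pos h1 hv1
  have i2 := integrable_mul_layerAInv hp.F₂_mult hp.μ_pos h2 hv2
  rw [v₁_eq h1, v₂_eq h2]
  refine ⟨⟨contDiff_grad4₁ hp hζ hu₁ hP, fun φ hφ hc => ?_⟩,
    ⟨contDiff_grad4₂ hp hζ hu₂ hP, fun φ hφ hc => ?_⟩,
    ⟨contDiff_const.mul (h1.1.1.mul hu₁.1), fun φ hφ hc => ?_⟩,
    ⟨h2.1.1.mul hu₂.1, fun φ hφ hc => ?_⟩⟩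
  · have hφ2 : HInf φ := Sm.of_hasCompactSupport hφ hc
    have iX := integrable_mul_test (g := fun x => 2 * (1 / p.ε ^ 2 * ((p.γ + p.δ) / (1 - p.γ)) *
      (-(p.γ * p.h₁ ζ x) - c₁ / 2) + 1 / p.ε * P₁ x)) (by fun_prop) hφ.continuous hc
    have iY := integrable_mul_test (g := fun x =>
      -(1 / p.ε ^ 2 * ((p.γ + p.δ) / (1 - p.γ)) * p.γ) * φ x)
      (continuous_const.mul hφ.continuous) hφ.continuous hc
    have hd := ((((hasDerivAt_integral_quadratic i0 iX iY).add_const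
      (2 * (p.γ + p.δ) * p.iBo / (p.μ * p.ε ^ 2)
        * (∫ x, (√(1 + p.μ * deriv (p.h₂ ζ) x ^ 2) - 1)))).add
      ((hasDerivAt_layerAInv_depth hp.F₁_mult hp.μ_pos h1 hu₁ (Sm.top hφ2)).const_mul p.γ)).add_const
      (∫ x, layerA p.F₂ p.μ (p.h₂ ζ) (fun y => p.h₂ ζ y * u₂ y) x *
        layerAInv p.F₂ p.μ (p.h₂ ζ) (layerA p.F₂ p.μ (p.h₂ ζ) fun y => p.h₂ ζ y * u₂ y) x)).const_mul
      (1 / 2)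
    refine (hd.congr_of_eventuallyEq ?_).congr_deriv ?_
    · filter_upwards [eventually_integrable_layerAInv hp.F₁_mult hp.μ_pos h1 (Sm.top hφ2) hv1]
        with s hs
      have e := funext (poly4_affine₁ (p := p) (P₁ := P₁) (c₀ := c₀) (c₁ := c₁) (c₂ := c₂)
        (p.h₁ ζ) (p.h₂ ζ) φ s)
      rw [hamiltonian4_eq (by
        rw [e]; exact (i0.add (iX.const_mul s)).add (iY.const_mul (s ^ 2))) is hs i2, e]
      rfl
    · have iK : Integrable fun x => layerK p.F₁ p.μ (p.h₁ ζ) u₁ x * φ x :=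
        HInf.mul_integrable (hInf_layerK hp.F₁_mult h1 hu₁) hφ2
      rw [← integral_const_mul, ← integral_const_mul, ← integral_add iX ((iK.const_mul _).const_mul _),
        ← integral_const_mul]
      refine integral_congr_ae (Eventually.of_forall fun x => ?_)
      simp only [grad4₁]
      ring
  · have hφ2 : HInf φ := Sm.of_hasCompactSupport hφ hc
    have iX := integrable_mul_test (g := fun x => 2 * (1 / p.ε ^ 2 * ((p.γ + p.δ) / (1 - p.γ)) *
      (p.h₂ ζ x - c₂ / 2) + 1 / p.ε * P₁ x)) (by fun_prop) hφ.continuous hc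
    have iY := integrable_mul_test (g := fun x =>
      1 / p.ε ^ 2 * ((p.γ + p.δ) / (1 - p.γ)) * φ x)
      (continuous_const.mul hφ.continuous) hφ.continuous hc
    have hS := hInf_tilt hp.μ_pos.le dh
    have hsurf := hasDerivWithinAt_integral_surf hp.μ_pos.le
      (SmDeriv.affine (p := 2) dh (Sm.deriv hφ2))
    rw [hasDerivWithinAt_univ] at hsurf
    simp only [zero_mul, add_zero] at hsurf
    have hd := ((((hasDerivAt_integral_quadratic i0 iX iY).add
      (hsurf.const_mul (2 * (p.γ + p.δ) * p.iBo / (p.μ * p.ε ^ 2)))).add_const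
      (p.γ * ∫ x, layerA p.F₁ p.μ (p.h₁ ζ) (fun y => p.h₁ ζ y * u₁ y) x *
        layerAInv p.F₁ p.μ (p.h₁ ζ) (layerA p.F₁ p.μ (p.h₁ ζ) fun y => p.h₁ ζ y * u₁ y) x)).add
      (hasDerivAt_layerAInv_depth hp.F₂_mult hp.μ_pos h2 hu₂ (Sm.top hφ2))).const_mul
      (1 / 2)
    refine (hd.congr_of_eventuallyEq ?_).congr_deriv ?_
    · filter_upwards [eventually_integrable_layerAInv hp.F₂_mult hp.μ_pos h2 (Sm.top hφ2) hv2]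
        with s hs
      have e := funext (poly4_affine₂ (p := p) (P₁ := P₁) (c₀ := c₀) (c₁ := c₁) (c₂ := c₂)
        (p.h₁ ζ) (p.h₂ ζ) φ s)
      have e2 : deriv (fun x => p.h₂ ζ x + s * φ x) =
          fun x => deriv (p.h₂ ζ) x + s * deriv φ x := funext fun x =>
        ((Sm.hasDerivAt h2.1 x).add ((Sm.hasDerivAt hφ2 x).const_mul s)).deriv
      rw [hamiltonian4_eq (by
        rw [e]; exact (i0.add (iX.const_mul s)).add (iY.const_mul (s ^ 2))) (by
        rw [e2]; exact integrable_surf hp.μ_pos.le (Sm.add dh (Sm.const_mul s (Sm.deriv hφ2)))) i1 hs,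
        e, e2]
      rfl
    · have iK : Integrable fun x => layerK p.F₂ p.μ (p.h₂ ζ) u₂ x * φ x :=
        HInf.mul_integrable (hInf_layerK hp.F₂_mult h2 hu₂) hφ2
      have iS : Integrable fun x => deriv (fun y => tilt p.μ (deriv (p.h₂ ζ) y)) x * φ x :=
        HInf.mul_integrable (Sm.deriv hS) hφ2
      have e3 : ∫ x, p.μ * tilt p.μ (deriv (p.h₂ ζ) x) * deriv φ x =
          -p.μ * ∫ x, deriv (fun y => tilt p.μ (deriv (p.h₂ ζ) y)) x * φ x := by
        have := integral_mul_deriv_hInf hS hφ2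
        rw [neg_mul, ← mul_neg, ← this, ← integral_const_mul]
        exact integral_congr_ae (Eventually.of_forall fun x => by ring)
      have e4 : 2 * (p.γ + p.δ) * p.iBo / (p.μ * p.ε ^ 2) * (-p.μ *
          ∫ x, deriv (fun y => tilt p.μ (deriv (p.h₂ ζ) y)) x * φ x) =
          ∫ x, -(2 * ((p.γ + p.δ) * p.iBo / p.ε ^ 2)) *
            (deriv (fun y => tilt p.μ (deriv (p.h₂ ζ) y)) x * φ x) := by
        rw [integral_const_mul]
        have := hp.μ_pos.ne'
        have := hp.ε_pos.ne'
        field_simp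
      have a1 := integral_add iX (iS.const_mul (-(2 * ((p.γ + p.δ) * p.iBo / p.ε ^ 2))))
      have a2 := integral_add (iX.add (iS.const_mul (-(2 * ((p.γ + p.δ) * p.iBo / p.ε ^ 2)))))
        (iK.const_mul 2)
      simp only [Pi.add_apply] at a2
      rw [e3, e4, ← integral_const_mul (2 : ℝ), ← a1, ← a2, ← integral_const_mul]
      refine integral_congr_ae (Eventually.of_forall fun x => ?_)
      simp only [grad4₂]
      ring
  · have hφ2 : HInf φ := Sm.of_hasCompactSupport hφ hc
    have hd := (((hasDerivAt_layerAInv_velocity hp.F₁_mult hp.μ_pos h1 hu₁ hφ2).const_mul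
      p.γ).const_add ((∫ x, p.poly4 c₀ c₁ c₂ P₁ (p.h₁ ζ) (p.h₂ ζ) x)
      + 2 * (p.γ + p.δ) * p.iBo / (p.μ * p.ε ^ 2)
        * (∫ x, (√(1 + p.μ * deriv (p.h₂ ζ) x ^ 2) - 1)))).add_const
      (∫ x, layerA p.F₂ p.μ (p.h₂ ζ) (fun y => p.h₂ ζ y * u₂ y) x *
        layerAInv p.F₂ p.μ (p.h₂ ζ) (layerA p.F₂ p.μ (p.h₂ ζ) fun y => p.h₂ ζ y * u₂ y) x)
    refine ((hd.const_mul (1 / 2)).congr_of_eventuallyEq (Eventually.of_forall fun s => ?_)).congr_deriv ?_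
    · exact hamiltonian4_eq i0 is (integrable_mul_layerAInv hp.F₁_mult hp.μ_pos h1
        (Sm.add hv1 (Sm.const_mul s hφ2))) i2
    · rw [← integral_const_mul, ← integral_const_mul, ← integral_const_mul]
      exact integral_congr_ae (Eventually.of_forall fun x => by ring)
  · have hφ2 : HInf φ := Sm.of_hasCompactSupport hφ hc
    have hd := (hasDerivAt_layerAInv_velocity hp.F₂_mult hp.μ_pos h2 hu₂ hφ2).const_add
      ((∫ x, p.poly4 c₀ c₁ c₂ P₁ (p.h₁ ζ) (p.h₂ ζ) x)
      + 2 * (p.γ + p.δ) * p.iBo / (p.μ * p.ε ^ 2)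
        * (∫ x, (√(1 + p.μ * deriv (p.h₂ ζ) x ^ 2) - 1)) + p.γ *
      (∫ x, layerA p.F₁ p.μ (p.h₁ ζ) (fun y => p.h₁ ζ y * u₁ y) x *
        layerAInv p.F₁ p.μ (p.h₁ ζ) (layerA p.F₁ p.μ (p.h₁ ζ) fun y => p.h₁ ζ y * u₁ y) x))
    refine ((hd.const_mul (1 / 2)).congr_of_eventuallyEq (Eventually.of_forall fun s => ?_)).congr_deriv ?_
    · exact hamiltonian4_eq i0 is i1 (integrable_mul_layerAInv hp.F₂_mult hp.μ_pos h2
        (Sm.add hv2 (Sm.const_mul s hφ2)))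
    · ring

end Params

end

section

/-! ### Dynamics in the four-equation form -/

/-- The pressure need not decay: only the difference of its values at x and −x enters the balance of
fluxes. -/
theorem Decay.tendstoLocallyUniformlyOn_add {I : Set ℝ} {G P : ℝ → ℝ → ℝ} (hG : Decay I G)
    (hP : TendstoLocallyUniformlyOn (fun x t => P t x - P t (-x)) 0 atTop I) (c : ℝ) :
    TendstoLocallyUniformlyOn (fun x t => (G t x + c * P t x) - (G t (-x) + c * P t (-x)))
      0 atTop I := by
  have hG' := hG.tendstoLocallyUniformlyOn
  rw [Metric.tendstoLocallyUniformlyOn_iff] at hG' hP ⊢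
  intro e he t ht
  obtain ⟨A, hA, h1⟩ := hG' _ (half_pos he) t ht
  obtain ⟨B, hB, h2⟩ := hP (e / 2 / (|c| + 1)) (by positivity) t ht
  refine ⟨A ∩ B, inter_mem hA hB, ?_⟩
  filter_upwards [h1, h2] with x a b s hs
  have a' := a s hs.1
  have b' := b s hs.2
  rw [Pi.zero_apply, dist_comm, Real.dist_eq, sub_zero] at a' b' ⊢
  rw [lt_div_iff₀ (by positivity)] at b'
  have h3 := abs_add_le (G s x - G s (-x)) (c * (P s x - P s (-x)))
  rw [abs_mul] at h3
  have h4 : G s x + c * P s x - (G s (-x) + c * P s (-x)) =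
      (G s x - G s (-x)) + c * (P s x - P s (-x)) := by ring
  rw [h4]
  nlinarith [abs_nonneg (P s x - P s (-x))]

namespace Params

variable {p : Params}

section Flux

variable {ζ u₁ u₂ P₁ : ℝ → ℝ} {c₁ c₂ : ℝ}

theorem deriv_layerK {F h u : ℝ → ℝ} {μ : ℝ} (hF : IsMultiplierFunction F) (hh : Depth h)
    (hu : HInf u) (x : ℝ) : deriv (layerK F μ h u) x =
      1 / 2 * deriv (fun y => u y ^ 2) x - μ * deriv (layerR F μ h u) x := by
  have h1 : DifferentiableAt ℝ (fun y => u y ^ 2) x := ((Sm.hasDerivAt hu x).pow 2).differentiableAt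
  exact ((h1.hasDerivAt.const_mul (1 / 2)).sub
    ((Sm.hasDerivAt (hInf_layerR (μ := μ) hF hh hu) x).const_mul μ)).deriv

theorem neg_deriv_grad4₁ (hp : p.Valid) (hγ : 0 < p.γ) (hζ : p.Adm ζ) (hu₁ : HInf u₁)
    (hP : ContDiff ℝ ∞ P₁) (x : ℝ) :
    -((p.γ + p.δ) / (1 - p.γ)) * deriv ζ x - p.ε / 2 * deriv (fun y => u₁ y ^ 2) x
        + p.μ * p.ε * deriv (layerR p.F₁ p.μ (p.h₁ ζ) u₁) x - p.γ⁻¹ * deriv P₁ x =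
      -(p.ε * (p.γ⁻¹ * deriv (p.grad4₁ c₁ ζ u₁ P₁) x)) := by
  have hK := Sm.hasDerivAt (hInf_layerK (μ := p.μ) hp.F₁_mult hζ.depth₁ hu₁) x
  have hP' := ((hP.differentiable (by simp)) x).hasDerivAt
  have hd : deriv (p.grad4₁ c₁ ζ u₁ P₁) x = _ :=
    (((((((hasDerivAt_h₁ (p := p) hζ.1 x).const_mul p.γ).neg).sub_const (c₁ / 2)).const_mul
      (1 / p.ε ^ 2 * ((p.γ + p.δ) / (1 - p.γ)))).add (hP'.const_mul (1 / p.ε))).add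
      (hK.const_mul p.γ)).deriv
  rw [hd, deriv_layerK hp.F₁_mult hζ.depth₁ hu₁]
  have := hp.ε_pos.ne'
  have := hγ.ne'
  rw [← sub_eq_zero]
  -- The identity is affine in this quotient, which is kept as one symbol so that `field_simp` does
  -- not try to clear 1 − γ.
  generalize (p.γ + p.δ) / (1 - p.γ) = a
  field_simp
  ring

/-- Since ∂ₓh₂ = ε∂ₓζ, the surface terms written with h₂ and with ζ agree up to one factor ε. -/
theorem tilt_deriv_h₂ (hζ : HInf ζ) :
    (fun y => tilt p.μ (deriv (p.h₂ ζ) y)) = fun y => p.ε * p.slope ζ y := by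
  ext y
  rw [(hasDerivAt_h₂ hζ y).deriv, tilt, slope, mul_pow, ← mul_assoc]
  ring

theorem neg_deriv_grad4₂ (hp : p.Valid) (hζ : p.Adm ζ) (hu₂ : HInf u₂)
    (hP : ContDiff ℝ ∞ P₁) (x : ℝ) :
    -((p.γ + p.δ) / (1 - p.γ)) * deriv ζ x - p.ε / 2 * deriv (fun y => u₂ y ^ 2) x
        + p.μ * p.ε * deriv (layerR p.F₂ p.μ (p.h₂ ζ) u₂) x - deriv (p.P₂ ζ P₁) x =
      -(p.ε * deriv (p.grad4₂ c₂ ζ u₂ P₁) x) := by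
  have hK := Sm.hasDerivAt (hInf_layerK (μ := p.μ) hp.F₂_mult (hζ.depth₂ hp) hu₂) x
  have hS := Sm.hasDerivAt (Sm.deriv (hInf_slope hp hζ.1)) x
  have hP' := ((hP.differentiable (by simp)) x).hasDerivAt
  have e : deriv (fun y => tilt p.μ (deriv (p.h₂ ζ) y)) = fun y => p.ε * deriv (p.slope ζ) y := by
    rw [tilt_deriv_h₂ hζ.1]
    ext y
    exact ((Sm.hasDerivAt (hInf_slope hp hζ.1) y).const_mul p.ε).deriv
  have hd : deriv (p.grad4₂ c₂ ζ u₂ P₁) x = 1 / p.ε ^ 2 * ((p.γ + p.δ) / (1 - p.γ)) *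
      (p.ε * deriv ζ x) + 1 / p.ε * deriv P₁ x - (p.γ + p.δ) * p.iBo / p.ε ^ 2 *
      (p.ε * deriv (deriv (p.slope ζ)) x) + deriv (layerK p.F₂ p.μ (p.h₂ ζ) u₂) x := by
    refine HasDerivAt.deriv ?_
    unfold grad4₂
    rw [e]
    exact ((((((hasDerivAt_h₂ (p := p) hζ.1 x).sub_const (c₂ / 2)).const_mul
      (1 / p.ε ^ 2 * ((p.γ + p.δ) / (1 - p.γ)))).add (hP'.const_mul (1 / p.ε))).sub
      ((hS.const_mul p.ε).const_mul _)).add hK)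
  have hP2 : deriv (p.P₂ ζ P₁) x =
      deriv P₁ x - (p.γ + p.δ) * p.iBo * deriv (deriv (p.slope ζ)) x :=
    (hP'.sub (hS.const_mul _)).deriv
  rw [hd, hP2, deriv_layerK hp.F₂_mult (hζ.depth₂ hp) hu₂]
  have := hp.ε_pos.ne'
  generalize (p.γ + p.δ) / (1 - p.γ) = a
  field_simp
  ring

end Flux

section Dynamics

variable {I : Set ℝ} {ζ u₁ u₂ P₁ : ℝ → ℝ → ℝ}

theorem isGN4Sol_iff_isHam4Sol (hp : p.Valid) (hγ : 0 < p.γ) {c₀ c₁ c₂ : ℝ}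
    (h : ∀ t ∈ I, p.Adm (ζ t) ∧ HInf (u₁ t) ∧ HInf (u₂ t) ∧ ContDiff ℝ ∞ (P₁ t) ∧
      Integrable (p.pot4 c₀ c₁ c₂ (p.h₁ (ζ t)) (p.h₂ (ζ t))) volume) :
    p.IsGN4Sol I ζ u₁ u₂ P₁ ↔
      p.IsHam4Sol c₀ c₁ c₂ I P₁ (fun t => p.h₁ (ζ t)) (fun t => p.v₁ (ζ t) (u₁ t))
        (fun t => p.h₂ (ζ t)) (fun t => p.v₂ (ζ t) (u₂ t)) := by
  have key : ∀ t ∈ I, ∀ x,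
      -(p.ε * deriv (fun y => p.h₁ (ζ t) y * u₁ t y) x) =
        -(p.ε * (p.γ⁻¹ * deriv (fun y => p.γ * (p.h₁ (ζ t) y * u₁ t y)) x)) := by
    intro t ht x
    obtain ⟨hA, hu₁, -⟩ := h t ht
    rw [((Sm.hasDerivAt (hA.depth₁.1.top_mul hu₁) x).const_mul p.γ).deriv,
      inv_mul_cancel_left₀ hγ.ne']
  constructor
  · intro H
    refine ⟨fun t => p.grad4₁ c₁ (ζ t) (u₁ t) (P₁ t), fun t => p.grad4₂ c₂ (ζ t) (u₂ t) (P₁ t),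
      fun t x => p.γ * (p.h₁ (ζ t) x * u₁ t x), fun t x => p.h₂ (ζ t) x * u₂ t x, fun t ht => ?_⟩
    obtain ⟨hA, hu₁, hu₂, hP, hC⟩ := h t ht
    refine ⟨isGradient4 hp hA hu₁ hu₂ hP hC, fun x => ?_⟩
    obtain ⟨a, b, c, d⟩ := H t ht x
    rw [key t ht] at a
    rw [neg_deriv_grad4₁ (c₁ := c₁) hp hγ hA hu₁ hP] at c
    rw [neg_deriv_grad4₂ (c₂ := c₂) hp hA hu₂ hP] at d
    exact ⟨a, c, b, d⟩
  · rintro ⟨g₁, g₂, k₁, k₂, H⟩ t ht x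
    obtain ⟨hA, hu₁, hu₂, hP, hC⟩ := h t ht
    obtain ⟨⟨G1, G2, K1, K2⟩, H'⟩ := H t ht
    obtain ⟨E1, E2, D1, D2⟩ := isGradient4 hp hA hu₁ hu₂ hP hC
    obtain ⟨a, b, c, d⟩ := H' x
    rw [K1.unique D1] at a
    rw [G1.unique E1] at b
    rw [K2.unique D2] at c
    rw [G2.unique E2] at d
    rw [key t ht, neg_deriv_grad4₁ (c₁ := c₁) hp hγ hA hu₁ hP,
      neg_deriv_grad4₂ (c₂ := c₂) hp hA hu₂ hP]
    exact ⟨a, c, b, d⟩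

theorem exists_smDeriv_layerV {F : ℝ → ℝ} (hF : IsMultiplierFunction F) (μ : ℝ) {t : ℝ}
    {h u : ℝ → ℝ → ℝ} {h' u' : ℝ → ℝ} (hh : SmDeriv ∞ I t h h') (hd : Depth (h t))
    (hu : SmDeriv 2 I t u u') :
    ∃ v', SmDeriv 2 I t (fun s => layerA F μ (h s) fun x => h s x * u s x) v' := by
  have hw : SmDeriv 2 I t _ _ := hh.mul hu
  obtain ⟨v', hv, -⟩ := exists_smDeriv_layerA hF μ hh hd hw
  exact ⟨v', hv⟩

theorem hasDerivWithinAt_velocity_mass₁ (hp : p.Valid) (hI : I.OrdConnected)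
    (hA : ∀ t ∈ I, p.Adm (ζ t) ∧ ContDiff ℝ ∞ (P₁ t))
    (hζ : ∀ t ∈ I, ∃ ζ', SmDeriv 2 I t ζ ζ') (hu₁ : ∀ t ∈ I, ∃ u', SmDeriv 2 I t u₁ u')
    (hsol : p.IsGN4Sol I ζ u₁ u₂ P₁)
    (hP : TendstoLocallyUniformlyOn (fun x t => P₁ t x - P₁ t (-x)) 0 atTop I)
    (hint : ∀ t ∈ I, Integrable (p.v₁ (ζ t) (u₁ t)) volume) {t : ℝ} (ht : t ∈ I) :
    HasDerivWithinAt (fun s => ∫ x, p.v₁ (ζ s) (u₁ s) x) 0 I t := by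
  have e : ∀ s ∈ I, p.v₁ (ζ s) (u₁ s) = layerA p.F₁ p.μ (p.h₁ (ζ s)) fun x =>
    p.h₁ (ζ s) x * u₁ s x := fun s hs => v₁_eq (hA s hs).1.depth₁ _
  have huI : ∀ t ∈ I, HInf (u₁ t) := fun t ht => (hu₁ t ht).choose_spec.1
  -- Apart from the pressure, the flux is a combination of ζ and the kinetic term, both decaying
  -- locally uniformly in time. The constant term of the gradient is dropped, as only differences of
  -- the flux matter.
  have hK : Decay I fun s => layerK p.F₁ p.μ (p.h₁ (ζ s)) (u₁ s) := Decay.of_smDeriv fun t ht => by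
    obtain ⟨ζ', h1⟩ := hζ t ht
    obtain ⟨u', h2⟩ := hu₁ t ht
    exact exists_smDeriv_layerK hp.F₁_mult p.μ (SmDeriv.depth₁ p h1.top) (hA t ht).1.depth₁ h2
  have hD := ((Decay.of_smDeriv hζ).const_mul ((p.γ + p.δ) / (1 - p.γ))).add (hK.const_mul p.ε)
  refine hasDerivWithinAt_integral_zero hI (G := fun s x => (p.γ + p.δ) / (1 - p.γ) * ζ s x
    + p.ε * layerK p.F₁ p.μ (p.h₁ (ζ s)) (u₁ s) x + p.γ⁻¹ * P₁ s x) (fun t ht => ?_)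
    (fun t ht => ?_) (fun t ht x => ?_) hint (hD.tendstoLocallyUniformlyOn_add hP _) ht
  · obtain ⟨ζ', h1⟩ := hζ t ht
    obtain ⟨u', h2⟩ := hu₁ t ht
    obtain ⟨v', h3⟩ := exists_smDeriv_layerV hp.F₁_mult p.μ (SmDeriv.depth₁ p h1.top)
      (hA t ht).1.depth₁ h2
    refine ⟨v', h3.top.congr ?_ (e t ht).symm⟩
    filter_upwards [eventually_ne_of_punctured] with s hs using (e s hs.1).symm
  · have h1 := (hA t ht).1.1.1
    have h2 := (hInf_layerK (μ := p.μ) hp.F₁_mult (hA t ht).1.depth₁ (huI t ht)).1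
    have h3 := (hA t ht).2
    fun_prop
  · refine (hsol t ht x).2.2.1.congr_deriv ?_
    have hK' := Sm.hasDerivAt (hInf_layerK (μ := p.μ) hp.F₁_mult (hA t ht).1.depth₁ (huI t ht)) x
    have hP' := (((hA t ht).2.differentiable (by simp)) x).hasDerivAt
    have hd := ((((Sm.hasDerivAt (hA t ht).1.1 x).const_mul ((p.γ + p.δ) / (1 - p.γ))).add
      (hK'.const_mul p.ε)).add (hP'.const_mul p.γ⁻¹)).deriv
    refine Eq.trans ?_ (congrArg Neg.neg hd).symm
    rw [deriv_layerK hp.F₁_mult (hA t ht).1.depth₁ (huI t ht)]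
    ring

theorem hasDerivWithinAt_velocity_mass₂ (hp : p.Valid) (hI : I.OrdConnected)
    (hA : ∀ t ∈ I, p.Adm (ζ t) ∧ ContDiff ℝ ∞ (P₁ t))
    (hζ : ∀ t ∈ I, ∃ ζ', SmDeriv 2 I t ζ ζ') (hu₂ : ∀ t ∈ I, ∃ u', SmDeriv 2 I t u₂ u')
    (hsol : p.IsGN4Sol I ζ u₁ u₂ P₁)
    (hP : TendstoLocallyUniformlyOn (fun x t => P₁ t x - P₁ t (-x)) 0 atTop I)
    (hint : ∀ t ∈ I, Integrable (p.v₂ (ζ t) (u₂ t)) volume) {t : ℝ} (ht : t ∈ I) :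
    HasDerivWithinAt (fun s => ∫ x, p.v₂ (ζ s) (u₂ s) x) 0 I t := by
  have e : ∀ s ∈ I, p.v₂ (ζ s) (u₂ s) = layerA p.F₂ p.μ (p.h₂ (ζ s)) fun x =>
    p.h₂ (ζ s) x * u₂ s x := fun s hs => v₂_eq ((hA s hs).1.depth₂ hp) _
  have huI : ∀ t ∈ I, HInf (u₂ t) := fun t ht => (hu₂ t ht).choose_spec.1
  have hK : Decay I fun s => layerK p.F₂ p.μ (p.h₂ (ζ s)) (u₂ s) := Decay.of_smDeriv fun t ht => by
    obtain ⟨ζ', h1⟩ := hζ t ht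
    obtain ⟨u', h2⟩ := hu₂ t ht
    exact exists_smDeriv_layerK hp.F₂_mult p.μ (SmDeriv.depth₂ p h1.top) ((hA t ht).1.depth₂ hp) h2
  have hD := (((Decay.of_smDeriv hζ).const_mul ((p.γ + p.δ) / (1 - p.γ))).add
    (hK.const_mul p.ε)).add ((decay_deriv_slope hp hζ).const_mul (-((p.γ + p.δ) * p.iBo)))
  refine hasDerivWithinAt_integral_zero hI (G := fun s x => (p.γ + p.δ) / (1 - p.γ) * ζ s x
    + p.ε * layerK p.F₂ p.μ (p.h₂ (ζ s)) (u₂ s) x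
    + -((p.γ + p.δ) * p.iBo) * deriv (p.slope (ζ s)) x + 1 * P₁ s x) (fun t ht => ?_)
    (fun t ht => ?_) (fun t ht x => ?_) hint (hD.tendstoLocallyUniformlyOn_add hP _) ht
  · obtain ⟨ζ', h1⟩ := hζ t ht
    obtain ⟨u', h2⟩ := hu₂ t ht
    obtain ⟨v', h3⟩ := exists_smDeriv_layerV hp.F₂_mult p.μ (SmDeriv.depth₂ p h1.top)
      ((hA t ht).1.depth₂ hp) h2
    refine ⟨v', h3.top.congr ?_ (e t ht).symm⟩
    filter_upwards [eventually_ne_of_punctured] with s hs using (e s hs.1).symm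
  · have h1 := (hA t ht).1.1.1
    have h2 := (hInf_layerK (μ := p.μ) hp.F₂_mult ((hA t ht).1.depth₂ hp) (huI t ht)).1
    have h3 := (hA t ht).2
    have h4 := (Sm.deriv (hInf_slope hp (hA t ht).1.1)).1
    fun_prop
  · refine (hsol t ht x).2.2.2.congr_deriv ?_
    have hK' := Sm.hasDerivAt (hInf_layerK (μ := p.μ) hp.F₂_mult ((hA t ht).1.depth₂ hp)
      (huI t ht)) x
    have hP' := (((hA t ht).2.differentiable (by simp)) x).hasDerivAt
    have hS := Sm.hasDerivAt (Sm.deriv (hInf_slope hp (hA t ht).1.1)) x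
    have hP2 : deriv (p.P₂ (ζ t) (P₁ t)) x =
        deriv (P₁ t) x - (p.γ + p.δ) * p.iBo * deriv (deriv (p.slope (ζ t))) x :=
      (hP'.sub (hS.const_mul _)).deriv
    have hd := (((((Sm.hasDerivAt (hA t ht).1.1 x).const_mul ((p.γ + p.δ) / (1 - p.γ))).add
      (hK'.const_mul p.ε)).add (hS.const_mul (-((p.γ + p.δ) * p.iBo)))).add
      (hP'.const_mul 1)).deriv
    refine Eq.trans ?_ (congrArg Neg.neg hd).symm
    rw [hP2, deriv_layerK hp.F₂_mult ((hA t ht).1.depth₂ hp) (huI t ht)]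
    ring

end Dynamics

end Params

end

end GreenNaghdi

end

/-! ### Hamiltonian structure and conservation laws of both forms -/

theorem mainTheorem7 (p : GreenNaghdi.Params) (hp : p.Valid) :
    -- The operators of the two-equation form: `A` maps `H^∞` to itself, its inverse is well defined
    -- on `L²`, and `v = A[εζ]w` is the evolved quantity of the system.
    (∀ ζ, p.Adm ζ →
      (∀ v, MemLp v 2 volume →
        ∃ w, GreenNaghdi.IsFormSol (p.ADom ζ) (p.AForm ζ) v w ∧
          ∀ w', GreenNaghdi.IsFormSol (p.ADom ζ) (p.AForm ζ) v w' → w' =ᵐ[volume] w) ∧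
      (∀ w, GreenNaghdi.HInf w →
        GreenNaghdi.HInf (p.A ζ w) ∧
        p.A ζ w = p.momentum ζ w ∧
        p.AInv ζ (p.A ζ w) =ᵐ[volume] w)) ∧
    -- Value and functional derivatives of the Hamiltonian at `(ζ, v)`, `v = A[εζ]w`.
    (∀ ζ w, p.Adm ζ → GreenNaghdi.HInf w →
      (p.hamiltonian ζ (p.A ζ w) =
        1 / 2 * ∫ x, (p.γ + p.δ) * ζ x ^ 2
          + 2 * (p.γ + p.δ) * p.iBo / (p.μ * p.ε ^ 2)
              * (√(1 + p.μ * p.ε ^ 2 * deriv ζ x ^ 2) - 1)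
          + p.γ * p.h₁ ζ x * (-w x / p.h₁ ζ x) ^ 2
          + p.h₂ ζ x * (w x / p.h₂ ζ x) ^ 2
          + p.μ * (p.γ / 3) * p.h₁ ζ x *
              (p.h₁ ζ x * deriv (GreenNaghdi.fmul p.F₁ p.μ fun y => -w y / p.h₁ ζ y) x) ^ 2
          + p.μ * (1 / 3) * p.h₂ ζ x *
              (p.h₂ ζ x * deriv (GreenNaghdi.fmul p.F₂ p.μ fun y => w y / p.h₂ ζ y) x) ^ 2) ∧
      GreenNaghdi.IsVarDeriv (fun η => p.hamiltonian ζ η) (p.A ζ w) w ∧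
      GreenNaghdi.IsVarDeriv (fun η => p.hamiltonian η (p.A ζ w)) ζ (fun x =>
        (p.γ + p.δ) * ζ x - (p.γ + p.δ) * p.iBo * deriv (p.slope ζ) x
          + p.ε / 2 * ((p.h₁ ζ x ^ 2 - p.γ * p.h₂ ζ x ^ 2)
              / (p.h₁ ζ x ^ 2 * p.h₂ ζ x ^ 2)) * w x ^ 2
          - p.μ * p.ε * p.R ζ w x)) ∧
    -- The two-equation system is the Hamiltonian system in the variables `(ζ, v)`, `v = A[εζ]w`.
    (∀ (I : Set ℝ) (ζ w : ℝ → ℝ → ℝ),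
      (∀ t ∈ I, p.Adm (ζ t) ∧ GreenNaghdi.HInf (w t)) →
      (p.IsGNSol I ζ w ↔ p.IsHamSol I ζ (fun t => p.A (ζ t) (w t)))) ∧
    -- Conservation of energy, horizontal impulse, mass and horizontal velocity mass.
    (∀ (I : Set ℝ) (ζ w : ℝ → ℝ → ℝ), I.OrdConnected →
      (∀ t ∈ I, p.Adm (ζ t)) →
      GreenNaghdi.HInfDifferentiableOn I ζ → GreenNaghdi.HInfDifferentiableOn I w →
      p.IsGNSol I ζ w →
      (∀ t ∈ I, HasDerivWithinAt (fun s => p.hamiltonian (ζ s) (p.A (ζ s) (w s))) 0 I t) ∧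
      (∀ t ∈ I, Integrable (fun x => ζ t x * p.A (ζ t) (w t) x) volume ∧
        HasDerivWithinAt (fun s => ∫ x, ζ s x * p.A (ζ s) (w s) x) 0 I t) ∧
      ((∀ t ∈ I, Integrable (ζ t) volume) →
        ∀ t ∈ I, HasDerivWithinAt (fun s => ∫ x, ζ s x) 0 I t) ∧
      ((∀ t ∈ I, Integrable (p.momentum (ζ t) (w t)) volume) →
        ∀ t ∈ I, HasDerivWithinAt (fun s => ∫ x, p.momentum (ζ s) (w s) x) 0 I t)) ∧
    -- The four-equation form.
    (0 < p.γ → p.γ ≠ 1 →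
      (∀ ζ, p.Adm ζ →
        (∀ v, MemLp v 2 volume →
          (∃ w, GreenNaghdi.IsFormSol (GreenNaghdi.LayerDom p.F₁ p.μ (p.h₁ ζ))
              (GreenNaghdi.layerForm p.F₁ p.μ (p.h₁ ζ)) v w ∧
            ∀ w', GreenNaghdi.IsFormSol (GreenNaghdi.LayerDom p.F₁ p.μ (p.h₁ ζ))
              (GreenNaghdi.layerForm p.F₁ p.μ (p.h₁ ζ)) v w' → w' =ᵐ[volume] w) ∧
          (∃ w, GreenNaghdi.IsFormSol (GreenNaghdi.LayerDom p.F₂ p.μ (p.h₂ ζ))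
              (GreenNaghdi.layerForm p.F₂ p.μ (p.h₂ ζ)) v w ∧
            ∀ w', GreenNaghdi.IsFormSol (GreenNaghdi.LayerDom p.F₂ p.μ (p.h₂ ζ))
              (GreenNaghdi.layerForm p.F₂ p.μ (p.h₂ ζ)) v w' → w' =ᵐ[volume] w)) ∧
        (∀ u, GreenNaghdi.HInf u →
          GreenNaghdi.HInf (p.v₁ ζ u) ∧ GreenNaghdi.HInf (p.v₂ ζ u) ∧
          p.v₁ ζ u = GreenNaghdi.layerA p.F₁ p.μ (p.h₁ ζ) (fun x => p.h₁ ζ x * u x) ∧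
          p.v₂ ζ u = GreenNaghdi.layerA p.F₂ p.μ (p.h₂ ζ) (fun x => p.h₂ ζ x * u x) ∧
          GreenNaghdi.layerAInv p.F₁ p.μ (p.h₁ ζ) (p.v₁ ζ u) =ᵐ[volume]
            (fun x => p.h₁ ζ x * u x) ∧
          GreenNaghdi.layerAInv p.F₂ p.μ (p.h₂ ζ) (p.v₂ ζ u) =ᵐ[volume]
            (fun x => p.h₂ ζ x * u x))) ∧
      (∀ (c₀ c₁ c₂ : ℝ) (ζ u₁ u₂ P₁ : ℝ → ℝ),
        p.Adm ζ → GreenNaghdi.HInf u₁ → GreenNaghdi.HInf u₂ → ContDiff ℝ ∞ P₁ →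
        Integrable (p.pot4 c₀ c₁ c₂ (p.h₁ ζ) (p.h₂ ζ)) volume →
        p.hamiltonian4 c₀ c₁ c₂ P₁ (p.h₁ ζ) (p.h₂ ζ) (p.v₁ ζ u₁) (p.v₂ ζ u₂) =
          p.hamiltonian4u c₀ c₁ c₂ P₁ (p.h₁ ζ) (p.h₂ ζ) u₁ u₂ ∧
        p.IsGradient4 c₀ c₁ c₂ P₁ (p.h₁ ζ) (p.h₂ ζ) (p.v₁ ζ u₁) (p.v₂ ζ u₂)
          (fun x => 1 / p.ε ^ 2 * ((p.γ + p.δ) / (1 - p.γ)) * (-(p.γ * p.h₁ ζ x) - c₁ / 2)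
            + 1 / p.ε * P₁ x + p.γ / 2 * u₁ x ^ 2
            - p.γ * p.μ * GreenNaghdi.layerR p.F₁ p.μ (p.h₁ ζ) u₁ x)
          (fun x => 1 / p.ε ^ 2 * ((p.γ + p.δ) / (1 - p.γ)) * (p.h₂ ζ x - c₂ / 2)
            + 1 / p.ε * P₁ x
            - (p.γ + p.δ) * p.iBo / p.ε ^ 2 * deriv (fun y =>
                deriv (p.h₂ ζ) y / √(1 + p.μ * deriv (p.h₂ ζ) y ^ 2)) x
            + 1 / 2 * u₂ x ^ 2
            - p.μ * GreenNaghdi.layerR p.F₂ p.μ (p.h₂ ζ) u₂ x)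
          (fun x => p.γ * (p.h₁ ζ x * u₁ x))
          (fun x => p.h₂ ζ x * u₂ x)) ∧
      (∀ (c₀ c₁ c₂ : ℝ) (I : Set ℝ) (ζ u₁ u₂ P₁ : ℝ → ℝ → ℝ),
        (∀ t ∈ I, p.Adm (ζ t) ∧ GreenNaghdi.HInf (u₁ t) ∧ GreenNaghdi.HInf (u₂ t) ∧
          ContDiff ℝ ∞ (P₁ t) ∧
          Integrable (p.pot4 c₀ c₁ c₂ (p.h₁ (ζ t)) (p.h₂ (ζ t))) volume) →
        (p.IsGN4Sol I ζ u₁ u₂ P₁ ↔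
          p.IsHam4Sol c₀ c₁ c₂ I P₁ (fun t => p.h₁ (ζ t)) (fun t => p.v₁ (ζ t) (u₁ t))
            (fun t => p.h₂ (ζ t)) (fun t => p.v₂ (ζ t) (u₂ t)))) ∧
      -- The horizontal velocity mass of each layer, in the absence of a pressure imbalance.
      (∀ (I : Set ℝ) (ζ u₁ u₂ P₁ : ℝ → ℝ → ℝ), I.OrdConnected →
        (∀ t ∈ I, p.Adm (ζ t) ∧ ContDiff ℝ ∞ (P₁ t)) →
        GreenNaghdi.HInfDifferentiableOn I ζ →
        GreenNaghdi.HInfDifferentiableOn I u₁ → GreenNaghdi.HInfDifferentiableOn I u₂ →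
        p.IsGN4Sol I ζ u₁ u₂ P₁ →
        TendstoLocallyUniformlyOn (fun x t => P₁ t x - P₁ t (-x)) 0 atTop I →
        ((∀ t ∈ I, Integrable (p.v₁ (ζ t) (u₁ t)) volume) →
          ∀ t ∈ I, HasDerivWithinAt (fun s => ∫ x, p.v₁ (ζ s) (u₁ s) x) 0 I t) ∧
        ((∀ t ∈ I, Integrable (p.v₂ (ζ t) (u₂ t)) volume) →
          ∀ t ∈ I, HasDerivWithinAt (fun s => ∫ x, p.v₂ (ζ s) (u₂ s) x) 0 I t))) := by
  refine ⟨fun ζ hζ => ⟨fun v hv => ?_, fun w hw => ?_⟩, fun ζ w hζ hw => ⟨?_, ?_, ?_⟩,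
    fun I ζ w h => GreenNaghdi.Params.isGNSol_iff_isHamSol hp h,
    fun I ζ w hI hA hζ hw hsol => ?_, fun hγ _ => ⟨fun ζ hζ => ⟨fun v hv => ⟨?_, ?_⟩,
      fun u hu => ?_⟩, fun c₀ c₁ c₂ ζ u₁ u₂ P₁ hζ hu₁ hu₂ hP hC => ⟨?_, ?_⟩,
      fun c₀ c₁ c₂ I ζ u₁ u₂ P₁ h => GreenNaghdi.Params.isGN4Sol_iff_isHam4Sol hp hγ h,
      fun I ζ u₁ u₂ P₁ hI hA hζ hu₁ hu₂ hsol hP => ?_⟩⟩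
  · obtain ⟨κ, hq⟩ := GreenNaghdi.Params.exists_coerciveForm_A hp hζ
    exact hq.existsUnique_ae hv
  · exact ⟨GreenNaghdi.Params.hInf_A hp hζ.depth₁ (hζ.depth₂ hp) hw,
      GreenNaghdi.Params.A_eq_momentum hp hζ.depth₁ (hζ.depth₂ hp) hw,
      GreenNaghdi.Params.AInv_A hp hζ hw⟩
  · exact GreenNaghdi.Params.hamiltonian_A_eq hp hζ hw
  · exact GreenNaghdi.Params.isVarDeriv_hamiltonian_v hp hζ hw
  · rw [← GreenNaghdi.Params.grad_eq hp hζ hw]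
    exact GreenNaghdi.Params.isVarDeriv_hamiltonian_ζ hp hζ hw
  · have hζ' := fun t (ht : t ∈ I) => hζ.exists_smDeriv ht
    have hw' := fun t (ht : t ∈ I) => hw.exists_smDeriv ht
    exact ⟨fun t ht => GreenNaghdi.Params.hasDerivWithinAt_energy hp hA hζ' hw' hsol ht,
      fun t ht => GreenNaghdi.Params.hasDerivWithinAt_impulse hp hA hζ' hw' hsol ht,
      fun hint t ht => GreenNaghdi.Params.hasDerivWithinAt_mass hp hI hA hζ' hw' hsol hint ht,
      fun hint t ht =>
        GreenNaghdi.Params.hasDerivWithinAt_velocity_mass hp hI hA hζ' hw' hsol hint ht⟩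
  · obtain ⟨κ, hq⟩ := hζ.depth₁.exists_coerciveForm hp.F₁_mult hp.μ_pos
    exact hq.existsUnique_ae hv
  · obtain ⟨κ, hq⟩ := (hζ.depth₂ hp).exists_coerciveForm hp.F₂_mult hp.μ_pos
    exact hq.existsUnique_ae hv
  · have h1 := hζ.depth₁
    have h2 := hζ.depth₂ hp
    rw [GreenNaghdi.Params.v₁_eq h1, GreenNaghdi.Params.v₂_eq h2]
    exact ⟨GreenNaghdi.hInf_layerV hp.F₁_mult h1 hu, GreenNaghdi.hInf_layerV hp.F₂_mult h2 hu,
      rfl, rfl, GreenNaghdi.layerAInv_layerA hp.F₁_mult hp.μ_pos h1 hu,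
      GreenNaghdi.layerAInv_layerA hp.F₂_mult hp.μ_pos h2 hu⟩
  · exact GreenNaghdi.Params.hamiltonian4_eq_hamiltonian4u hp hζ hu₁ hu₂ hC
  · convert! GreenNaghdi.Params.isGradient4 hp hζ hu₁ hu₂ hP hC using 1
    · ext x
      simp only [GreenNaghdi.Params.grad4₁, GreenNaghdi.layerK]
      ring
    · ext x
      simp only [GreenNaghdi.Params.grad4₂, GreenNaghdi.layerK, GreenNaghdi.tilt]
      ring
  · have hζ' := fun t (ht : t ∈ I) => hζ.exists_smDeriv ht
    exact ⟨fun hint t ht => GreenNaghdi.Params.hasDerivWithinAt_velocity_mass₁ hp hI hA hζ'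
        (fun t ht => hu₁.exists_smDeriv ht) hsol hP hint ht,
      fun hint t ht => GreenNaghdi.Params.hasDerivWithinAt_velocity_mass₂ hp hI hA hζ'
        (fun t ht => hu₂.exists_smDeriv ht) hsol hP hint ht⟩
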